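/- A financial network consists of a finite directed multigraph $G=(V,E)$ without self loops whose nodes are banks and whose edges $e$ are debt contracts with debtor $\mathrm{de}(e)$, creditor $\mathrm{cr}(e)$ and liability $\ell_e\in\mathbb{N}_{>0}$, external assets $a^x_b\in\mathbb{N}$ for every bank $b$, and, for every bank, a ranking of its outgoing edges. With edge-ranking payments, a bank with total funds $x$ pays its outgoing edges in the order of its ranking, each one until it is saturated or the funds are exhausted; that is, $f_e(x)=\min\{\ell_e,\max\{0,x-\sum_{e'}\ell_{e'}\}\}$, where $e'$ ranges over the outgoing edges that $\mathrm{de}(e)$ ranks above $e$. A clearing state is a vector $p=(p_e)_{e\in E}$ with $p_e=f_e\big(a^x_{\mathrm{de}(e)}+\sum_{e':\mathrm{cr}(e')=\mathrm{de}(e)}p_{e'}\big)$ for all $e$; the pointwise maximal clearing state arises, and $a_b=a^x_b+\sum_{e:\mathrm{cr}(e)=b}p_e$ are the total assets of $b$ in it. Let $e$ be an edge with debtor $u$ and creditor $v$, and let $w$ be a bank, with $u,v,w$ distinct. The claims trade of $e$ to $w$ with haircut rate $\alpha\in[0,1]$, $\alpha\ell_e\le a^x_w$, makes $w$ the creditor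 of $e$, increases the external assets of $v$ by $\alpha\ell_e$ and decreases those of $w$ by $\alpha\ell_e$; let $a'_b(\alpha)$ be the total assets of $b$ in the maximal clearing state afterwards. Such an $\alpha$ is creditor-positive if $a'_v(\alpha)>a_v$ and $a'_w(\alpha)\ge a_w$, and optimal if moreover $a'_v(\alpha)\ge a'_v(\beta)$ for all creditor-positive $\beta$. Proposition 3.3. There is an algorithm that, given a financial network with edge-ranking payments, an edge $e$ and a buyer $w$ as above, either outputs (as a fraction of two natural numbers) an optimal creditor-positive haircut rate $\alpha^*\in[0,1]$, or correctly reports that no creditor-positive haircut rate exists, and whose running time is bounded by a polynomial in the bit length of the input. (Running time is the number of steps of a random access machine with addition and truncated subtraction of natural numbers as its arithmetic operations, which is polynomially equivalent to Turing machine time.) -/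

import Mathlib

namespace ClaimsTrade

/-! ### Financial networks with edge-ranking payments -/

/-- A financial network on banks `V` and debt contracts (claims) `E` whose banks use edge-ranking
payments. `rank e` is the position of `e` in the ranking of the outgoing edges of its debtor;
a smaller position means a higher priority. Liabilities are natural numbers; external assets are
real, since after a trade they need not be integers. -/
structure Network (V E : Type*) where
  debtor : E → V
  creditor : E → V
  liab : E → ℕ
  rank : E → ℕ
  ext : V → ℝ

namespace Network

variable {V E : Type*} [Fintype E] [DecidableEq V] (N : Network V E)

/-- Total liability of the edges that the debtor of `e` ranks above `e`. -/
def liabAbove (e : E) : ℕ :=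
  ∑ e' with N.debtor e' = N.debtor e ∧ N.rank e' < N.rank e, N.liab e'

/-- The edge-ranking payment function of `e`: a debtor with funds `b` first saturates all edges
ranked above `e`, then pays towards `e` until `e` is saturated or the funds are exhausted. -/
noncomputable def pay (e : E) (b : ℝ) : ℝ :=
  min (N.liab e : ℝ) (max 0 (b - N.liabAbove e))

/-- Total assets of bank `b` under payments `p`: external assets plus incoming payments. -/
def assetsOf (p : E → ℝ) (b : V) : ℝ :=
  N.ext b + ∑ e with N.creditor e = b, p e

/-- A clearing state: payments that arise when every bank distributes exactly the total assets
that these payments give it. -/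
def IsClearing (p : E → ℝ) : Prop :=
  ∀ e, p e = N.pay e (N.assetsOf p (N.debtor e))

theorem pay_mono (e : E) : Monotone (N.pay e) := fun _ _ h =>
  min_le_min le_rfl (max_le_max le_rfl (sub_le_sub_right h _))

theorem pay_mem (e : E) (b : ℝ) : N.pay e b ∈ Set.Icc (0 : ℝ) (N.liab e) :=
  ⟨le_min (Nat.cast_nonneg _) (le_max_left _ _), min_le_left _ _⟩

theorem assetsOf_mono {p q : E → ℝ} (h : p ≤ q) (b : V) : N.assetsOf p b ≤ N.assetsOf q b :=
  add_le_add le_rfl (Finset.sum_le_sum fun e _ => h e)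

/-- The clearing states of a network have a pointwise greatest element. -/
theorem exists_isGreatest_clearing : ∃ p, IsGreatest {p | N.IsClearing p} p := by
  have : ∀ e, Fact ((0 : ℝ) ≤ N.liab e) := fun e => ⟨Nat.cast_nonneg _⟩
  let Φ : (∀ e, Set.Icc (0 : ℝ) (N.liab e)) →o (∀ e, Set.Icc (0 : ℝ) (N.liab e)) :=
    { toFun := fun p e => ⟨N.pay e (N.assetsOf (fun e => (p e : ℝ)) (N.debtor e)), N.pay_mem _ _⟩
      monotone' := fun p q h e =>
        N.pay_mono e (N.assetsOf_mono (fun e' => h e') (N.debtor e)) }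
  obtain ⟨hfix, hmax⟩ := Φ.isGreatest_gfp
  refine ⟨fun e => (Φ.gfp e : ℝ), fun e => ?_, fun q hq => ?_⟩
  · exact (congrArg Subtype.val (congrFun hfix e)).symm
  · have hmem : ∀ e, q e ∈ Set.Icc (0 : ℝ) (N.liab e) := fun e => by
      rw [hq e]; exact N.pay_mem _ _
    have := @hmax (fun e => ⟨q e, hmem e⟩) (by
      funext e
      exact Subtype.ext (hq e).symm)
    exact fun e => this e

/-- The clearing state that arises in the network: the pointwise maximal one. -/
noncomputable def clearing : E → ℝ := N.exists_isGreatest_clearing.choose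

theorem clearing_spec : IsGreatest {p | N.IsClearing p} N.clearing :=
  N.exists_isGreatest_clearing.choose_spec

/-- Total assets of bank `b` in the (maximal) clearing state. -/
noncomputable def assets (b : V) : ℝ := N.assetsOf N.clearing b

/-- The post-trade network of the claims trade of `e` to `w` with haircut rate `α`: `w` becomes
the creditor of `e`, and the return `α * liab e` moves from the external assets of `w` to those
of the former creditor of `e`. -/
noncomputable def trade [DecidableEq E] (e : E) (w : V) (α : ℝ) : Network V E where
  debtor := N.debtor
  creditor := Function.update N.creditor e w
  liab := N.liab
  rank := N.rank
  ext := fun b => N.ext b + (if b = N.creditor e then α * N.liab e else 0)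
    - (if b = w then α * N.liab e else 0)

/-- `α` is creditor-positive for the trade of `e` to `w`: it is a haircut rate in `[0, 1]`, the
buyer can afford the return, the creditor strictly gains and the buyer does not lose. -/
def CreditorPositive [DecidableEq E] (e : E) (w : V) (α : ℝ) : Prop :=
  α ∈ Set.Icc (0 : ℝ) 1 ∧ α * N.liab e ≤ N.ext w ∧
    N.assets (N.creditor e) < (N.trade e w α).assets (N.creditor e) ∧
    N.assets w ≤ (N.trade e w α).assets w

/-- `α` is creditor-positive and maximizes the post-trade assets of the creditor (equivalently
their improvement) among all creditor-positive haircut rates. -/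
def OptimalCreditorPositive [DecidableEq E] (e : E) (w : V) (α : ℝ) : Prop :=
  N.CreditorPositive e w α ∧ ∀ β, N.CreditorPositive e w β →
    (N.trade e w β).assets (N.creditor e) ≤ (N.trade e w α).assets (N.creditor e)

end Network

/-! ### Problem instances -/

/-- An input of the problem: a financial network with natural external assets, positive
liabilities, no self loops and edge-ranking payments, together with a single claims trade of the
claim `claim` to the bank `buyer`, where debtor, creditor and buyer are three distinct banks. -/
structure TradeInstance where
  n : ℕ
  m : ℕ
  debtor : Fin m → Fin n
  creditor : Fin m → Fin n
  liab : Fin m → ℕ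
  rank : Fin m → ℕ
  ext : Fin n → ℕ
  claim : Fin m
  buyer : Fin n
  no_loop : ∀ e, debtor e ≠ creditor e
  liab_pos : ∀ e, 0 < liab e
  /-- `rank` enumerates the outgoing edges of every bank by `0, …, outdegree - 1`. -/
  rank_lt : ∀ e, rank e < Fintype.card {e' // debtor e' = debtor e}
  rank_inj : ∀ e e', debtor e = debtor e' → rank e = rank e' → e = e'
  buyer_ne_debtor : buyer ≠ debtor claim
  buyer_ne_creditor : buyer ≠ creditor claim

namespace TradeInstance

variable (I : TradeInstance)

/-- The network before the trade. -/
def network : Network (Fin I.n) (Fin I.m) where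
  debtor := I.debtor
  creditor := I.creditor
  liab := I.liab
  rank := I.rank
  ext := fun b => (I.ext b : ℝ)

/-- The input of an algorithm: the numbers `n`, `m`, the traded claim, the buyer, the external
assets of all banks, and debtor, creditor, liability and rank of every edge. -/
def encode : List ℕ :=
  [I.n, I.m, I.claim, I.buyer] ++ List.ofFn I.ext ++
    (List.ofFn fun e => [(I.debtor e : ℕ), (I.creditor e : ℕ), I.liab e, I.rank e]).flatten

end TradeInstance

/-! ### Algorithms: programs of a random access machine with a step count -/

/-- Length of a list of numbers in binary, with one extra symbol to end each number. -/
def bitLength (l : List ℕ) : ℕ := (l.map fun x => x.size + 1).sum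

/-- A machine state: registers and a random access memory, all holding natural numbers. -/
structure State where
  reg : ℕ → ℕ
  mem : ℕ → ℕ

def State.setReg (s : State) (i x : ℕ) : State := { s with reg := Function.update s.reg i x }

def State.setMem (s : State) (a x : ℕ) : State := { s with mem := Function.update s.mem a x }

/-- Programs. The arithmetic instructions are addition and (truncated) subtraction only, so that a
single step lengthens the largest number in a state by at most one bit; unit-cost time on this
machine is therefore polynomially related to time on a Turing machine. -/
inductive Program where
  | skip
  /-- `r i := c` -/
  | const (i c : ℕ)
  /-- `r i := r j + r k` -/
  | add (i j k : ℕ)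
  /-- `r i := r j - r k`, or `0` if `r j < r k` -/
  | sub (i j k : ℕ)
  /-- `r i := mem (r j)` -/
  | load (i j : ℕ)
  /-- `mem (r i) := r j` -/
  | store (i j : ℕ)
  | seq (c d : Program)
  /-- if `r i < r j` then `c` else `d` -/
  | ite (i j : ℕ) (c d : Program)
  /-- while `r i < r j` do `c` -/
  | loop (i j : ℕ) (c : Program)

/-- `Exec c s s' t`: program `c` started in state `s` halts in state `s'` after exactly `t` steps,
where every instruction and every test of a branch or loop condition is a step. -/
inductive Exec : Program → State → State → ℕ → Prop
  | skip (s) : Exec .skip s s 1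
  | const (i c s) : Exec (.const i c) s (s.setReg i c) 1
  | add (i j k s) : Exec (.add i j k) s (s.setReg i (s.reg j + s.reg k)) 1
  | sub (i j k s) : Exec (.sub i j k) s (s.setReg i (s.reg j - s.reg k)) 1
  | load (i j s) : Exec (.load i j) s (s.setReg i (s.mem (s.reg j))) 1
  | store (i j s) : Exec (.store i j) s (s.setMem (s.reg i) (s.reg j)) 1
  | seq {c d s s' s'' t t'} (h : Exec c s s' t) (h' : Exec d s' s'' t') :
      Exec (.seq c d) s s'' (t + t')
  | ite_true {i j c d s s' t} (hlt : s.reg i < s.reg j) (h : Exec c s s' t) :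
      Exec (.ite i j c d) s s' (t + 1)
  | ite_false {i j c d s s' t} (hlt : ¬ s.reg i < s.reg j) (h : Exec d s s' t) :
      Exec (.ite i j c d) s s' (t + 1)
  | loop_done {i j c s} (hlt : ¬ s.reg i < s.reg j) : Exec (.loop i j c) s s 1
  | loop_step {i j c s s' s'' t t'} (hlt : s.reg i < s.reg j) (h : Exec c s s' t)
      (h' : Exec (.loop i j c) s' s'' t') : Exec (.loop i j c) s s'' (t + t' + 1)

/-- The start state on an input list: the input stands in memory from address `0` on, and all
other memory cells and all registers are `0`. -/
def startState (l : List ℕ) : State where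
  reg := fun _ => 0
  mem := fun a => l.getD a 0

end ClaimsTrade

/-!
Payments before and after a trade are flows in one kind of closed network. A super source supplies
every bank with its external assets and takes back what the bank retains, along an edge of last
choice that is never saturated. Clearing states then are the flows that saturate edges in the order
of the ranking, are conserved at all banks, and exhaust the source (`Network.IsClearing.isGreedy`,
`Network.IsGreedy.isClearing`, `IsClaimNet.isClearing`, `IsClaimNet.flowOf_isRanked`).

Call the first unsaturated edge of a node active. A flow whose active edges contain no cycle is
maximal (`FlowNet.IsFlow.le_of_not_cyclic`): if another flow exceeds it at some nodes, the surplus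
cannot leave the set of these nodes, so following active edges inside this set one gets into a
cycle. Conversely, along a cycle of active edges the flow can be raised by the smallest remaining
capacity, which saturates an edge (`FlowNet.IsFlow.raise`). So a maximal flow is reached from any
flow by at most as many raises as there are edges, with natural numbers throughout
(`run_saturateCmd`).

For the trade, let `x` be the maximal flow before it. If the creditor gains from a trade, then the
assets of the buyer do not grow, and the return exceeds the payment of `x` on the claim
(`IsInitialNet.buyer_le_and_lt_of_gain`): otherwise the surplus again circulates among the banks
that gain, giving a cycle of active edges already before the trade. A creditor-positive rate thus
leaves the assets of the buyer, and with them its payments, unchanged. Hence these payments can be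
frozen, the claim directed to the buyer, and an edge of the buyer to the former creditor be added
that carries the return. The capacity of this edge is the smaller of the liability and the external
assets of the buyer (or the old payment on the claim, if that is larger). Post-trade states of
creditor-positive rates are flows of this network, and `x` with a return equal to the payment on the
claim is another one, so the maximal flow `z` above it decides the question: the return of `z`
exceeds the old payment if and only if some rate is creditor-positive, and then it is the return of
an optimal rate (`IsTradeNet.not_creditorPositive`, `IsTradeNet.optimalCreditorPositive`). The rate
is output as this return over the liability of the claim.

The program is written in a small language in which every loop runs through a fixed number of
iterations, the number of edges of the flow network. Its compilation to the random access machine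
comes with a bound on the running time that is a polynomial in this number (`Cmd.exec`).
-/

namespace ClaimsTrade

/-! ### A small imperative language and its compilation to the random access machine -/

/-- What a command cannot change: the input cells (the memory below address `size`) and the common
number of iterations `len` of all loops. -/
structure Env where
  inp : ℕ → ℕ
  size : ℕ
  len : ℕ

/-- A store of the language: numeric variables and eight arrays. -/
structure Store where
  var : ℕ → ℕ
  arr : Fin 8 → ℕ → ℕ

namespace Store

def setVar (a : Store) (i x : ℕ) : Store := { a with var := Function.update a.var i x }

def put (a : Store) (k : Fin 8) (i x : ℕ) : Store :=
  { a with arr := Function.update a.arr k (Function.update (a.arr k) i x) }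

@[simp] theorem setVar_var (a : Store) (i x j : ℕ) :
    (a.setVar i x).var j = if j = i then x else a.var j := by
  simp [setVar, Function.update_apply]

@[simp] theorem setVar_arr (a : Store) (i x : ℕ) : (a.setVar i x).arr = a.arr := rfl

@[simp] theorem put_var (a : Store) (k : Fin 8) (i x : ℕ) : (a.put k i x).var = a.var := rfl

theorem put_arr (a : Store) (k k' : Fin 8) (i x : ℕ) :
    (a.put k i x).arr k' = if k' = k then Function.update (a.arr k) i x else a.arr k' := by
  by_cases h : k' = k
  · subst h; simp [put]
  · simp [put, h]

end Store

/-- Expressions. `inp e` reads the input cell with number `e`, and `get k e` the cell `e` of the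
array `k`. -/
inductive Expr where
  | lit (c : ℕ)
  | var (i : ℕ)
  | len
  | inp (e : Expr)
  | get (k : Fin 8) (e : Expr)
  | add (e f : Expr)
  | sub (e f : Expr)

/-- Value of an expression. The arrays occupy the memory above the input, interleaved cell by cell,
and this is what `inp` finds at an address beyond the input. -/
def Expr.eval (E : Env) (a : Store) : Expr → ℕ
  | lit c => c
  | var i => a.var i
  | len => E.len
  | inp e => if e.eval E a < E.size then E.inp (e.eval E a) else
      a.arr (Fin.ofNat 8 ((e.eval E a - E.size) % 8)) ((e.eval E a - E.size) / 8)
  | get k e => a.arr k (e.eval E a)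
  | add e f => e.eval E a + f.eval E a
  | sub e f => e.eval E a - f.eval E a

/-- Commands. `forLen i c` executes `c` for the values `0, …, len - 1` of the variable `i`; since
there are no other loops, the running time is a polynomial in `len`. -/
inductive Cmd where
  | assign (i : ℕ) (e : Expr)
  | put (k : Fin 8) (e f : Expr)
  | seq (c d : Cmd)
  | ite (e f : Expr) (c d : Cmd)
  | forLen (i : ℕ) (c : Cmd)

/-- `iter f n a` applies `f 0`, …, `f (n - 1)` to `a` in this order. -/
def iter {α : Type*} (f : ℕ → α → α) : ℕ → α → α
  | 0, a => a
  | n + 1, a => f n (iter f n a)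

/-- Final store of a command. -/
def Cmd.run (E : Env) : Cmd → Store → Store
  | assign i e, a => a.setVar i (e.eval E a)
  | put k e f, a => a.put k (e.eval E a) (f.eval E a)
  | seq c d, a => d.run E (c.run E a)
  | ite e f c d, a => if e.eval E a < f.eval E a then c.run E a else d.run E a
  | forLen i c, a => iter (fun j b => c.run E (b.setVar i j)) E.len a

/-- Code that leaves the value of an expression in the register `3 * t + 5`. The registers
`3 * t' + 5` with `t' > t` serve as scratch, and the registers `3` and `4` hold the address of the
first array cell and the number of loop iterations. -/
def Expr.code (t : ℕ) : Expr → Program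
  | lit c => .const (3 * t + 5) c
  | var i => .seq (.const (3 * t + 5) 0) (.add (3 * t + 5) (3 * t + 5) (3 * i + 6))
  | len => .seq (.const (3 * t + 5) 0) (.add (3 * t + 5) (3 * t + 5) 4)
  | inp e => .seq (e.code t) (.load (3 * t + 5) (3 * t + 5))
  | get k e => .seq (e.code t) (.seq (.add (3 * t + 5) (3 * t + 5) (3 * t + 5))
      (.seq (.add (3 * t + 5) (3 * t + 5) (3 * t + 5))
      (.seq (.add (3 * t + 5) (3 * t + 5) (3 * t + 5))
      (.seq (.const (3 * t + 8) k) (.seq (.add (3 * t + 5) (3 * t + 5) (3 * t + 8))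
      (.seq (.add (3 * t + 5) (3 * t + 5) 3) (.load (3 * t + 5) (3 * t + 5))))))))
  | add e f => .seq (e.code t) (.seq (f.code (t + 1)) (.add (3 * t + 5) (3 * t + 5) (3 * t + 8)))
  | sub e f => .seq (e.code t) (.seq (f.code (t + 1)) (.sub (3 * t + 5) (3 * t + 5) (3 * t + 8)))

/-- Exact running time of the code of an expression. -/
def Expr.cost : Expr → ℕ
  | lit _ => 1
  | var _ => 2
  | len => 2
  | inp e => e.cost + 1
  | get _ e => e.cost + 7
  | add e f => e.cost + (f.cost + 1)
  | sub e f => e.cost + (f.cost + 1)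

/-- Code of a command at nesting depth `d`: the variable `i` lives in the register `3 * i + 6`, and
the iterations of a loop at depth `d` are counted in the register `3 * d + 7`. -/
def Cmd.code (d : ℕ) : Cmd → Program
  | assign i e => .seq (e.code 0) (.seq (.const 8 0) (.add (3 * i + 6) 5 8))
  | put k e f => .seq (e.code 0) (.seq (.add 5 5 5) (.seq (.add 5 5 5) (.seq (.add 5 5 5)
      (.seq (.const 8 k) (.seq (.add 5 5 8) (.seq (.add 5 5 3) (.seq (f.code 1) (.store 5 8))))))))
  | seq c c' => .seq (c.code d) (c'.code d)
  | ite e f c c' => .seq (e.code 0) (.seq (f.code 1) (.ite 5 8 (c.code d) (c'.code d)))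
  | forLen i c => .seq (.const (3 * d + 7) 0) (.loop (3 * d + 7) 4
      (.seq (.const 5 0) (.seq (.add (3 * i + 6) (3 * d + 7) 5) (.seq (c.code (d + 1))
      (.seq (.const 5 1) (.add (3 * d + 7) (3 * d + 7) 5))))))

/-- Bound on the running time of a command, as a polynomial in the number of loop iterations. -/
noncomputable def Cmd.cost : Cmd → Polynomial ℕ
  | assign _ e => Polynomial.C (e.cost + 2)
  | put _ e f => Polynomial.C (e.cost + f.cost + 7)
  | seq c d => c.cost + d.cost
  | ite e f c d => c.cost + d.cost + Polynomial.C (e.cost + f.cost + 1)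
  | forLen _ c => Polynomial.X * (c.cost + Polynomial.C 5) + Polynomial.C 2

/-- The machine state `s` represents the store `a`. -/
structure Represents (E : Env) (a : Store) (s : State) : Prop where
  base : s.reg 3 = E.size
  len : s.reg 4 = E.len
  var : ∀ i, s.reg (3 * i + 6) = a.var i
  arr : ∀ (k : Fin 8) i, s.mem (E.size + 8 * i + k) = a.arr k i
  inp : ∀ j < E.size, s.mem j = E.inp j

@[simp] theorem State.setReg_reg (s : State) (i x j : ℕ) :
    (s.setReg i x).reg j = if j = i then x else s.reg j := by
  simp [State.setReg, Function.update_apply]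

@[simp] theorem State.setReg_mem (s : State) (i x : ℕ) : (s.setReg i x).mem = s.mem := rfl

@[simp] theorem State.setMem_mem (s : State) (i x j : ℕ) :
    (s.setMem i x).mem j = if j = i then x else s.mem j := by
  simp [State.setMem, Function.update_apply]

@[simp] theorem State.setMem_reg (s : State) (i x : ℕ) : (s.setMem i x).reg = s.reg := rfl

theorem Represents.of_eq {E : Env} {a : Store} {s s' : State} (h : Represents E a s)
    (hm : s'.mem = s.mem) (hr : ∀ r, (∀ t, r ≠ 3 * t + 5) → (∀ d, r ≠ 3 * d + 7) →
      s'.reg r = s.reg r) : Represents E a s' where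
  base := by rw [hr 3 (by omega) (by omega), h.base]
  len := by rw [hr 4 (by omega) (by omega), h.len]
  var i := by rw [hr _ (by omega) (by omega), h.var]
  arr k i := by rw [hm, h.arr]
  inp j hj := by rw [hm, h.inp j hj]

/-- The code of an expression computes its value, touching only scratch registers from its own
level on. -/
theorem Expr.exec {E : Env} {a : Store} (e : Expr) (t : ℕ) {s : State} (h : Represents E a s) :
    ∃ s', Exec (e.code t) s s' e.cost ∧ s'.mem = s.mem ∧ s'.reg (3 * t + 5) = e.eval E a ∧
      ∀ r, (∀ t', t ≤ t' → r ≠ 3 * t' + 5) → s'.reg r = s.reg r := by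
  induction e generalizing t s with
  | lit c =>
    refine ⟨_, .const _ _ _, rfl, by simp [eval], fun r hr => ?_⟩
    have := hr t le_rfl
    simp [this]
  | var i =>
    refine ⟨_, .seq (.const _ _ _) (.add _ _ _ _), rfl, ?_, fun r hr => ?_⟩
    · have h1 : ¬ 3 * i + 6 = 3 * t + 5 := by omega
      simp [eval, h.var i, h1]
    · have := hr t le_rfl
      simp [this]
  | len =>
    refine ⟨_, .seq (.const _ _ _) (.add _ _ _ _), rfl, ?_, fun r hr => ?_⟩
    · simp [eval, h.len]
    · have := hr t le_rfl
      simp [this]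
  | inp e ih =>
    obtain ⟨s', he, hm, hv, hr⟩ := ih t h
    refine ⟨_, .seq he (.load _ _ _), by simpa using hm, ?_, fun r hr' => ?_⟩
    · simp only [State.setReg_reg, if_true, hm, hv, eval]
      split_ifs with hlt
      · exact h.inp _ hlt
      · rw [← h.arr]
        congr 1
        simp only [Fin.val_ofNat]
        omega
    · have := hr' t le_rfl
      simp [this, hr r hr']
  | get k e ih =>
    obtain ⟨s', he, hm, hv, hr⟩ := ih t h
    have hb : s'.reg 3 = E.size := by rw [hr 3 (by omega), h.base]
    refine ⟨_, .seq he (.seq (.add _ _ _ _) (.seq (.add _ _ _ _) (.seq (.add _ _ _ _)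
      (.seq (.const _ _ _) (.seq (.add _ _ _ _) (.seq (.add _ _ _ _) (.load _ _ _))))))),
      by simpa using hm, ?_, fun r hr' => ?_⟩
    · have h1 : ¬ 3 = 3 * t + 5 := by omega
      have h2 : ¬ 3 = 3 * t + 8 := by omega
      simp only [State.setReg_reg, State.setReg_mem, if_true, hm, hv, eval, hb, h1, h2, if_false,
        show ¬ 3 * t + 5 = 3 * t + 8 by omega]
      rw [← h.arr]
      congr 1
      omega
    · have h1 := hr' t le_rfl
      have h2 : r ≠ 3 * t + 8 := fun h => hr' (t + 1) (by omega) (by omega)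
      simp [h1, h2, hr r hr']
  | add e f ihe ihf =>
    obtain ⟨s', he, hm, hv, hr⟩ := ihe t h
    obtain ⟨s'', he', hm', hv', hr'⟩ := ihf (t + 1)
      (h.of_eq hm fun r h5 _ => hr r fun t' _ => h5 t')
    refine ⟨_, .seq he (.seq he' (.add _ _ _ _)), by simp [hm', hm], ?_, fun r hr2 => ?_⟩
    · simp only [State.setReg_reg, if_true, eval]
      rw [show 3 * t + 8 = 3 * (t + 1) + 5 by ring, hv', hr' _ (by omega), hv]
    · have := hr2 t le_rfl
      simp only [State.setReg_reg, this, if_false]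
      rw [hr' r fun t' ht => hr2 t' (by omega), hr r hr2]
  | sub e f ihe ihf =>
    obtain ⟨s', he, hm, hv, hr⟩ := ihe t h
    obtain ⟨s'', he', hm', hv', hr'⟩ := ihf (t + 1)
      (h.of_eq hm fun r h5 _ => hr r fun t' _ => h5 t')
    refine ⟨_, .seq he (.seq he' (.sub _ _ _ _)), by simp [hm', hm], ?_, fun r hr2 => ?_⟩
    · simp only [State.setReg_reg, if_true, eval]
      rw [show 3 * t + 8 = 3 * (t + 1) + 5 by ring, hv', hr' _ (by omega), hv]
    · have := hr2 t le_rfl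
      simp only [State.setReg_reg, this, if_false]
      rw [hr' r fun t' ht => hr2 t' (by omega), hr r hr2]

/-- The code of a command simulates its run on stores, within the stated cost. The counters of the
surrounding loops are left alone. -/
theorem Cmd.exec {E : Env} (c : Cmd) (d : ℕ) {a : Store} {s : State} (h : Represents E a s) :
    ∃ s' t, Exec (c.code d) s s' t ∧ t ≤ c.cost.eval E.len ∧ Represents E (c.run E a) s' ∧
      ∀ d' < d, s'.reg (3 * d' + 7) = s.reg (3 * d' + 7) := by
  induction c generalizing d a s with
  | assign i e =>
    obtain ⟨s', he, hm, hv, hr⟩ := e.exec 0 h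
    have hv : s'.reg 5 = e.eval E a := hv
    have h' : Represents E a s' := h.of_eq hm fun r h5 _ => hr r fun t' _ => h5 t'
    refine ⟨_, _, .seq he (.seq (.const _ _ _) (.add _ _ _ _)), by simp [cost], ?_,
      fun d' hd' => ?_⟩
    · constructor
      · simp [h'.base]
      · simp [h'.len]
      · intro j
        by_cases hj : j = i
        · simp [hj, run, hv]
        · have h8 : ¬ 3 * j + 6 = 8 := by omega
          simp [hj, run, h8, h'.var]
      · intro k i
        simp [run, h'.arr]
      · intro j hj
        simp [h'.inp j hj]
    · have h1 : ¬ 3 * d' + 7 = 3 * i + 6 := by omega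
      have h2 : ¬ 3 * d' + 7 = 8 := by omega
      simp only [State.setReg_reg, h1, h2, if_false]
      exact hr _ (by omega)
  | put k e f =>
    obtain ⟨s', he, hm, hv, hr⟩ := e.exec 0 h
    have hv : s'.reg 5 = e.eval E a := hv
    have h' : Represents E a s' := h.of_eq hm fun r h5 _ => hr r fun t' _ => h5 t'
    set s1 := s'.setReg 5 (s'.reg 5 + s'.reg 5) with hs1
    set s2 := s1.setReg 5 (s1.reg 5 + s1.reg 5) with hs2
    set s3 := s2.setReg 5 (s2.reg 5 + s2.reg 5) with hs3
    set s4 := s3.setReg 8 k with hs4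
    set s5 := s4.setReg 5 (s4.reg 5 + s4.reg 8) with hs5
    set s6 := s5.setReg 5 (s5.reg 5 + s5.reg 3) with hs6
    have h6 : s6.reg 5 = E.size + 8 * e.eval E a + k := by
      simp [hs6, hs5, hs4, hs3, hs2, hs1, hv, h'.base]
      omega
    have hreg6 : ∀ r, r ≠ 5 → r ≠ 8 → s6.reg r = s'.reg r := by
      intro r h1 h2
      simp [hs6, hs5, hs4, hs3, hs2, hs1, h1, h2]
    have hrep6 : Represents E a s6 := h'.of_eq rfl fun r h5 _ => hreg6 r (h5 0) (h5 1)
    obtain ⟨s7, he7, hm7, hv7, hr7⟩ := f.exec 1 hrep6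
    have h75 : s7.reg 5 = E.size + 8 * e.eval E a + k := by rw [hr7 _ (by omega), h6]
    have hv7 : s7.reg 8 = f.eval E a := hv7
    have h7 : Represents E a s7 := hrep6.of_eq hm7 fun r h5 _ => hr7 r fun t' _ => h5 t'
    refine ⟨_, _, .seq he (.seq (.add _ _ _ _) (.seq (.add _ _ _ _) (.seq (.add _ _ _ _)
      (.seq (.const _ _ _) (.seq (.add _ _ _ _) (.seq (.add _ _ _ _) (.seq he7
        (.store _ _ _)))))))), by simp [cost]; omega, ?_, fun d' hd' => ?_⟩
    · constructor
      · simp [h7.base]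
      · simp [h7.len]
      · intro j
        simp [run, h7.var]
      · intro k' i'
        simp only [State.setMem_mem, h75, hv7, run, Store.put_arr]
        by_cases hk : k' = k
        · subst hk
          by_cases hi : i' = e.eval E a
          · simp [hi]
          · simp [hi, h7.arr]
        · have : ¬ E.size + 8 * i' + k' = E.size + 8 * e.eval E a + k := by
            have := Fin.val_ne_of_ne hk
            omega
          simp [hk, this, h7.arr]
      · intro j hj
        have : ¬ j = E.size + 8 * e.eval E a + k := by omega
        simp [h75, this, h7.inp j hj]
    · simp only [State.setMem_reg]
      rw [hr7 _ (by omega), hreg6 _ (by omega) (by omega), hr _ (by omega)]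
  | seq c c' ihc ihc' =>
    obtain ⟨s1, t1, h1, ht1, hr1, hc1⟩ := ihc d h
    obtain ⟨s2, t2, h2, ht2, hr2, hc2⟩ := ihc' d hr1
    exact ⟨s2, _, .seq h1 h2, by simp [cost]; omega, hr2,
      fun d' hd' => by rw [hc2 d' hd', hc1 d' hd']⟩
  | ite e f c c' ihc ihc' =>
    obtain ⟨s1, he, hm, hv, hr⟩ := e.exec 0 h
    have h1 : Represents E a s1 := h.of_eq hm fun r h5 _ => hr r fun t' _ => h5 t'
    obtain ⟨s2, he2, hm2, hv2, hr2⟩ := f.exec 1 h1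
    have h2 : Represents E a s2 := h1.of_eq hm2 fun r h5 _ => hr2 r fun t' _ => h5 t'
    have hv5 : s2.reg 5 = e.eval E a := by rw [hr2 _ (by omega)]; exact hv
    have hv8 : s2.reg 8 = f.eval E a := hv2
    have hctr : ∀ d', s2.reg (3 * d' + 7) = s.reg (3 * d' + 7) := fun d' => by
      rw [hr2 _ (by omega), hr _ (by omega)]
    by_cases hlt : e.eval E a < f.eval E a
    · obtain ⟨s3, t3, h3, ht3, hr3, hc3⟩ := ihc d h2
      refine ⟨s3, _, .seq he (.seq he2 (.ite_true (by rwa [hv5, hv8]) h3)), ?_, ?_,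
        fun d' hd' => by rw [hc3 d' hd', hctr]⟩
      · simp [cost]; omega
      · simpa [run, hlt] using hr3
    · obtain ⟨s3, t3, h3, ht3, hr3, hc3⟩ := ihc' d h2
      refine ⟨s3, _, .seq he (.seq he2 (.ite_false (by rwa [hv5, hv8]) h3)), ?_, ?_,
        fun d' hd' => by rw [hc3 d' hd', hctr]⟩
      · simp [cost]; omega
      · simpa [run, hlt] using hr3
  | forLen i c ih =>
    have key : ∀ k j, j + k = E.len → ∀ s : State,
        Represents E (iter (fun j b => c.run E (b.setVar i j)) j a) s → s.reg (3 * d + 7) = j →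
        ∃ s' t, Exec (.loop (3 * d + 7) 4
          (.seq (.const 5 0) (.seq (.add (3 * i + 6) (3 * d + 7) 5) (.seq (c.code (d + 1))
          (.seq (.const 5 1) (.add (3 * d + 7) (3 * d + 7) 5)))))) s s' t ∧
          t ≤ k * (c.cost.eval E.len + 5) + 1 ∧
          Represents E (iter (fun j b => c.run E (b.setVar i j)) E.len a) s' ∧
          ∀ d' < d, s'.reg (3 * d' + 7) = s.reg (3 * d' + 7) := by
      intro k
      induction k with
      | zero =>
        intro j hj s hs hd
        have : j = E.len := by omega
        subst this
        exact ⟨s, 1, .loop_done (by rw [hd, hs.len]; omega), by omega, hs, fun _ _ => rfl⟩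
      | succ k ihk =>
        intro j hj s hs hd
        set b := iter (fun j b => c.run E (b.setVar i j)) j a with hb
        set s1 := (s.setReg 5 0).setReg (3 * i + 6)
          ((s.setReg 5 0).reg (3 * d + 7) + (s.setReg 5 0).reg 5) with hs1
        have hd5 : ∀ d, ¬ 3 * d + 7 = 5 := by omega
        have hrep1 : Represents E (b.setVar i j) s1 := by
          constructor
          · simp [hs1, hs.base]
          · simp [hs1, hs.len]
          · intro i'
            by_cases hi : i' = i
            · simp [hs1, hi, hd]
            · simp [hs1, hi, hs.var]
          · intro k i'
            simp [hs1, hs.arr]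
          · intro j hj
            simp [hs1, hs.inp j hj]
        obtain ⟨s2, t2, h2, ht2, hr2, hc2⟩ := ih (d + 1) hrep1
        set s3 := (s2.setReg 5 1).setReg (3 * d + 7)
          ((s2.setReg 5 1).reg (3 * d + 7) + (s2.setReg 5 1).reg 5) with hs3
        have hrep3 : Represents E (iter (fun j b => c.run E (b.setVar i j)) (j + 1) a) s3 :=
          hr2.of_eq rfl fun r h5 h7 => by
            have h5 : r ≠ 5 := h5 0
            have h7 := h7 d
            simp [hs3, h5, h7]
        have hd1 : ∀ d', s1.reg (3 * d' + 7) = s.reg (3 * d' + 7) := fun d' => by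
          have : ¬ 3 * d' + 7 = 3 * i + 6 := by omega
          simp [hs1, this]
        have hd3 : s3.reg (3 * d + 7) = j + 1 := by
          simp [hs3, hc2 d (by omega), hd1, hd]
        obtain ⟨s4, t4, h4, ht4, hr4, hc4⟩ := ihk (j + 1) (by omega) s3 hrep3 hd3
        refine ⟨s4, _, .loop_step (by rw [hd, hs.len]; omega)
          (.seq (.const _ _ _) (.seq (.add _ _ _ _) (.seq h2 (.seq (.const _ _ _)
            (.add _ _ _ _))))) h4, ?_, hr4, fun d' hd' => ?_⟩
        · rw [Nat.succ_mul]; omega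
        · rw [hc4 d' hd', ← hd1 d', ← hc2 d' (by omega)]
          have : ¬ d' = d := by omega
          simp [hs3, this]
    have h0 : Represents E a (s.setReg (3 * d + 7) 0) := h.of_eq rfl fun r _ h7 => by
      simp [h7 d]
    obtain ⟨s', t, he, ht, hr, hc⟩ := key E.len 0 (by omega) _ h0 (by simp)
    refine ⟨s', _, .seq (.const _ _ _) he, ?_, hr, fun d' hd' => ?_⟩
    · simp [cost]; omega
    · rw [hc d' hd']
      have : ¬ d' = d := by omega
      simp [this]

/-! ### Reasoning about commands -/

/-- Whether a command writes to the array `k`. -/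
def Cmd.writes (k : Fin 8) : Cmd → Bool
  | assign _ _ => false
  | put k' _ _ => k' = k
  | seq c d => c.writes k || d.writes k
  | ite _ _ c d => c.writes k || d.writes k
  | forLen _ c => c.writes k

theorem iter_induction {α : Type*} {f : ℕ → α → α} {n : ℕ} {a : α} (I : ℕ → α → Prop) (h0 : I 0 a)
    (hs : ∀ j < n, ∀ b, I j b → I (j + 1) (f j b)) : I n (iter f n a) := by
  induction n with
  | zero => exact h0
  | succ n ih => exact hs n (by omega) _ (ih fun j hj => hs j (by omega))

/-- Loop invariants. -/
theorem Cmd.run_forLen_induction {E : Env} {i : ℕ} {c : Cmd} {a : Store} (I : ℕ → Store → Prop)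
    (h0 : I 0 a) (hs : ∀ j < E.len, ∀ b, I j b → I (j + 1) (c.run E (b.setVar i j))) :
    I E.len ((Cmd.forLen i c).run E a) :=
  iter_induction I h0 hs

theorem Cmd.run_arr_of_not_writes {E : Env} {k : Fin 8} (c : Cmd) (h : c.writes k = false)
    (a : Store) : (c.run E a).arr k = a.arr k := by
  induction c generalizing a with
  | assign i e => rfl
  | put k' e f =>
    have : ¬ k = k' := by simpa [writes, eq_comm] using h
    simp [run, Store.put_arr, this]
  | seq c d ihc ihd =>
    simp only [writes, Bool.or_eq_false_iff] at h
    rw [run, ihd h.2, ihc h.1]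
  | ite e f c d ihc ihd =>
    simp only [writes, Bool.or_eq_false_iff] at h
    rw [run]
    split_ifs
    · exact ihc h.1 a
    · exact ihd h.2 a
  | forLen i c ih =>
    exact run_forLen_induction (fun _ b => b.arr k = a.arr k) rfl fun j _ b hb => by
      rw [ih h, Store.setVar_arr, hb]

/-- Whether a command assigns to the variable `i`. -/
def Cmd.assigns (i : ℕ) : Cmd → Bool
  | assign j _ => j = i
  | put _ _ _ => false
  | seq c d => c.assigns i || d.assigns i
  | ite _ _ c d => c.assigns i || d.assigns i
  | forLen j c => j = i || c.assigns i

theorem Cmd.run_var_of_not_assigns {E : Env} {i : ℕ} (c : Cmd) (h : c.assigns i = false)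
    (a : Store) : (c.run E a).var i = a.var i := by
  induction c generalizing a with
  | assign j e =>
    have : ¬ i = j := by simpa [assigns, eq_comm] using h
    simp [run, this]
  | put k e f => rfl
  | seq c d ihc ihd =>
    simp only [assigns, Bool.or_eq_false_iff] at h
    rw [run, ihd h.2, ihc h.1]
  | ite e f c d ihc ihd =>
    simp only [assigns, Bool.or_eq_false_iff] at h
    rw [run]
    split_ifs
    · exact ihc h.1 a
    · exact ihd h.2 a
  | forLen j c ih =>
    simp only [assigns, Bool.or_eq_false_iff, decide_eq_false_iff_not] at h
    exact run_forLen_induction (fun _ b => b.var i = a.var i) rfl fun _ _ b hb => by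
      rw [ih h.2, Store.setVar_var, if_neg (Ne.symm h.1), hb]

/-- A command without effect. -/
def Cmd.skip : Cmd := .assign 5 (.var 5)

@[simp] theorem Cmd.run_skip (E : Env) (a : Store) : Cmd.skip.run E a = a := by
  simp [skip, run, Store.setVar, Expr.eval]

theorem polynomial_nat_eval_mono (P : Polynomial ℕ) : Monotone fun x => P.eval x := by
  intro x y h
  simp only [Polynomial.eval_eq_sum_range]
  gcongr

open Finset

/-! ### Flows that respect priorities, and their maximality -/

/-- A directed multigraph with capacities whose edges `f < edges` are ranked at their source by
`prio`. Flow is conserved at the nodes `b < banks`; other nodes are free sources and sinks. -/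
structure FlowNet where
  edges : ℕ
  banks : ℕ
  src : ℕ → ℕ
  dst : ℕ → ℕ
  cap : ℕ → ℕ
  prio : ℕ → ℕ

namespace FlowNet

variable (G : FlowNet)

def outflow (y : ℕ → ℝ) (b : ℕ) : ℝ := ∑ f ∈ range G.edges with G.src f = b, y f

def inflow (y : ℕ → ℝ) (b : ℕ) : ℝ := ∑ f ∈ range G.edges with G.dst f = b, y f

/-- A flow on every edge that is within the capacities and sends something along an edge only when
all edges ranked above it at the same source are saturated. -/
structure IsRanked (y : ℕ → ℝ) : Prop where
  nonneg : ∀ f < G.edges, 0 ≤ y f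
  le_cap : ∀ f < G.edges, y f ≤ G.cap f
  saturated : ∀ f < G.edges, ∀ f' < G.edges, G.src f = G.src f' → G.prio f' < G.prio f → 0 < y f →
    (G.cap f' : ℝ) ≤ y f'

/-- A ranked flow that is conserved at all banks. -/
structure IsFlow (y : ℕ → ℝ) : Prop extends G.IsRanked y where
  conserved : ∀ b < G.banks, G.outflow y b = G.inflow y b

/-- Node names and edge names share the range below `edges`, so that a loop over the edges also
visits every node; priorities rank the edges at each source strictly. -/
structure WellFormed : Prop where
  src_lt : ∀ f < G.edges, G.src f < G.edges
  dst_lt : ∀ f < G.edges, G.dst f < G.edges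
  prio_inj : ∀ f < G.edges, ∀ f' < G.edges, G.src f = G.src f' → G.prio f = G.prio f' → f = f'

/-- `f` is the edge along which its source would send the next unit of flow. -/
def IsActive (x : ℕ → ℝ) (f : ℕ) : Prop :=
  f < G.edges ∧ x f < G.cap f ∧
    ∀ f' < G.edges, G.src f' = G.src f → x f' < G.cap f' → G.prio f ≤ G.prio f'

/-- Following active edges, one never leaves `S` and never gets stuck in it. -/
def IsClosed (x : ℕ → ℝ) (S : Set ℕ) : Prop :=
  ∀ b ∈ S, ∃ f, G.src f = b ∧ G.IsActive x f ∧ G.dst f ∈ S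

/-- The walk along active edges from `b` never gets stuck; since the graph is finite, it then runs
into a cycle. -/
def Cyclic (x : ℕ → ℝ) (b : ℕ) : Prop := ∃ S, G.IsClosed x S ∧ b ∈ S

variable {G} {x y : ℕ → ℝ}

theorem exists_isActive {f : ℕ} (hf : f < G.edges) (h : x f < G.cap f) :
    ∃ a, G.src a = G.src f ∧ G.IsActive x a := by
  have hne : ((range G.edges).filter fun f' => G.src f' = G.src f ∧ x f' < G.cap f').Nonempty :=
    ⟨f, by simp [hf, h]⟩
  obtain ⟨a, ha, hmin⟩ := exists_min_image _ G.prio hne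
  simp only [mem_filter, mem_range] at ha hmin
  exact ⟨a, ha.2.1, ha.1, ha.2.2, fun f' hf' hs hx => hmin f' ⟨hf', hs.trans ha.2.1, hx⟩⟩

/-- Ranked flows on the edges out of one node are totally ordered: the flow on one edge determines
which of two is larger on all of them. -/
theorem IsRanked.le_of_lt (hG : G.WellFormed) (hx : G.IsRanked x) (hy : G.IsRanked y) {f f' : ℕ}
    (hf : f < G.edges) (hf' : f' < G.edges) (hs : G.src f = G.src f') (hlt : x f < y f) :
    x f' ≤ y f' := by
  rcases lt_trichotomy (G.prio f') (G.prio f) with h | h | h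
  · exact (hx.le_cap f' hf').trans
      (hy.saturated f hf f' hf' hs h ((hx.nonneg f hf).trans_lt hlt))
  · exact (hG.prio_inj f hf f' hf' hs h.symm) ▸ hlt.le
  · by_contra! hc
    have := hx.saturated f' hf' f hf hs.symm h ((hy.nonneg f' hf').trans_lt hc)
    linarith [hy.le_cap f hf]

theorem IsRanked.le_of_outflow_lt (hG : G.WellFormed) (hx : G.IsRanked x) (hy : G.IsRanked y)
    {f : ℕ} (hf : f < G.edges) (h : G.outflow x (G.src f) < G.outflow y (G.src f)) :
    x f ≤ y f := by
  obtain ⟨f', hf', hlt⟩ := exists_lt_of_sum_lt h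
  simp only [mem_filter, mem_range] at hf'
  exact hx.le_of_lt hG hy hf'.1 hf hf'.2 hlt

theorem IsRanked.le_of_outflow_le (hG : G.WellFormed) (hx : G.IsRanked x) (hy : G.IsRanked y)
    {f : ℕ} (hf : f < G.edges) (h : G.outflow y (G.src f) ≤ G.outflow x (G.src f)) :
    y f ≤ x f := by
  by_contra! hlt
  refine absurd h (not_le.2 (sum_lt_sum (fun f' hf' => ?_) ⟨f, by simp [hf], hlt⟩))
  simp only [mem_filter, mem_range] at hf'
  exact hx.le_of_lt hG hy hf hf'.1 hf'.2.symm hlt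

/-- Of two ranked flows let `y` send out more than `x` exactly at the nodes of `T`. If the surplus
leaving the nodes of `T` is no larger than the surplus entering them, all of it circulates in `T`,
and as every node spends its surplus on its active edge first, active edges do not leave `T`. -/
theorem IsRanked.isClosed (hG : G.WellFormed) (hx : G.IsRanked x) (hy : G.IsRanked y)
    (T : Finset ℕ) (hT : ∀ b, b ∈ T ↔ G.outflow x b < G.outflow y b)
    (hsum : ∑ f ∈ range G.edges with G.src f ∈ T, (y f - x f) ≤
      ∑ f ∈ range G.edges with G.dst f ∈ T, (y f - x f)) :
    G.IsClosed x (T : Set ℕ) := by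
  have hup : ∀ f < G.edges, G.src f ∈ T → x f ≤ y f := fun f hf h =>
    hx.le_of_outflow_lt hG hy hf ((hT _).1 h)
  have hdown : ∀ f < G.edges, G.src f ∉ T → y f ≤ x f := fun f hf h =>
    hx.le_of_outflow_le hG hy hf (not_lt.1 fun hlt => h ((hT _).2 hlt))
  have hstay : ∀ f < G.edges, G.src f ∈ T → G.dst f ∉ T → y f ≤ x f := by
    have h1 := sum_filter_add_sum_filter_not ((range G.edges).filter fun f => G.src f ∈ T)
      (fun f => G.dst f ∈ T) (fun f => y f - x f)
    have h2 := sum_filter_add_sum_filter_not ((range G.edges).filter fun f => G.dst f ∈ T)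
      (fun f => G.src f ∈ T) (fun f => y f - x f)
    simp only [filter_filter] at h1 h2
    have h3 : ∑ f ∈ range G.edges with G.dst f ∈ T ∧ G.src f ∉ T, (y f - x f) ≤ 0 :=
      sum_nonpos fun f hf => by
        simp only [mem_filter, mem_range] at hf
        linarith [hdown f hf.1 hf.2.2]
    have h4 : ∑ f ∈ range G.edges with G.src f ∈ T ∧ G.dst f ∈ T, (y f - x f) =
        ∑ f ∈ range G.edges with G.dst f ∈ T ∧ G.src f ∈ T, (y f - x f) := by
      simp only [and_comm]
    intro f hf hs hd
    have h5 := single_le_sum (s := (range G.edges).filter fun f => G.src f ∈ T ∧ G.dst f ∉ T)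
      (f := fun f => y f - x f) (fun f hf => by
        simp only [mem_filter, mem_range] at hf
        linarith [hup f hf.1 hf.2.1]) (a := f) (by simp [hf, hs, hd])
    linarith
  intro b hb
  obtain ⟨f, hf, hlt⟩ := exists_lt_of_sum_lt ((hT b).1 hb)
  simp only [mem_filter, mem_range] at hf
  obtain ⟨hf, rfl⟩ := hf
  obtain ⟨a, has, ha⟩ := exists_isActive hf (hlt.trans_le (hy.le_cap f hf))
  refine ⟨a, has, ha, ?_⟩
  by_contra hd
  have hle := hstay a ha.1 (by rw [has]; exact hb) hd
  have hpr := ha.2.2 f hf has.symm (hlt.trans_le (hy.le_cap f hf))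
  rcases hpr.lt_or_eq with h | h
  · have := hy.saturated f hf a ha.1 has.symm h ((hx.nonneg f hf).trans_lt hlt)
    linarith [ha.2.1]
  · rw [hG.prio_inj a ha.1 f hf has h] at hle
    linarith

theorem sum_filter_mem_eq (A T : Finset ℕ) (h : ℕ → ℕ) (z : ℕ → ℝ) :
    ∑ f ∈ A with h f ∈ T, z f = ∑ b ∈ T, ∑ f ∈ A with h f = b, z f := by
  rw [← sum_fiberwise_of_maps_to (s := A.filter fun f => h f ∈ T) (t := T) (g := h)
    (fun f hf => (mem_filter.1 hf).2)]
  refine sum_congr rfl fun b hb => ?_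
  rw [filter_filter]
  refine sum_congr (filter_congr fun f _ => ?_) fun _ _ => rfl
  constructor
  · exact fun h => h.2
  · rintro rfl
    exact ⟨hb, rfl⟩

/-- A flow whose active edges form no cycle is maximal, provided that it exhausts the sources. -/
theorem IsFlow.le_of_not_cyclic (hG : G.WellFormed) (hx : G.IsFlow x) (hy : G.IsFlow y)
    (hterm : ∀ b, ¬ G.Cyclic x b)
    (hsource : ∀ f < G.edges, G.banks ≤ G.src f → (G.cap f : ℝ) ≤ x f) {f : ℕ}
    (hf : f < G.edges) : y f ≤ x f := by
  classical
  have hbank : ∀ b, G.outflow x b < G.outflow y b → b < G.banks := by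
    intro b hb
    by_contra! hc
    obtain ⟨f, hf, hlt⟩ := exists_lt_of_sum_lt hb
    simp only [mem_filter, mem_range] at hf
    have := hsource f hf.1 (by omega)
    linarith [hy.le_cap f hf.1]
  let T := (range G.banks).filter fun b => G.outflow x b < G.outflow y b
  have hT : ∀ b, b ∈ T ↔ G.outflow x b < G.outflow y b := fun b => by
    simp only [T, mem_filter, mem_range, and_iff_right_iff_imp]
    exact hbank b
  have hclosed := hx.toIsRanked.isClosed hG hy.toIsRanked T hT (by
    rw [sum_filter_mem_eq, sum_filter_mem_eq]
    refine (sum_congr rfl fun b hb => ?_).le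
    have hb := hbank b ((hT b).1 hb)
    have h1 := hx.conserved b hb
    have h2 := hy.conserved b hb
    simp only [outflow, inflow] at h1 h2
    rw [sum_sub_distrib, sum_sub_distrib, h1, h2])
  refine hx.toIsRanked.le_of_outflow_le hG hy.toIsRanked hf (not_lt.1 fun hlt => ?_)
  exact hterm _ ⟨_, hclosed, mem_coe.2 ((hT _).2 hlt)⟩

/-! ### Raising the flow along a cycle of active edges -/

/-- `act` gives the active edge of every node, and no edge (a number out of range) at nodes all of
whose edges are saturated. -/
def IsActiveMap (G : FlowNet) (x : ℕ → ℝ) (act : ℕ → ℕ) : Prop :=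
  ∀ b < G.edges, (G.edges ≤ act b ∧ ∀ f < G.edges, G.src f = b → (G.cap f : ℝ) ≤ x f) ∨
    (G.src (act b) = b ∧ G.IsActive x (act b))

/-- One step along the active edge; the walk rests at nodes without one. -/
def next (G : FlowNet) (act : ℕ → ℕ) (b : ℕ) : ℕ :=
  if act b < G.edges then G.dst (act b) else b

/-- The number of saturated edges. -/
noncomputable def saturatedCard (G : FlowNet) (x : ℕ → ℝ) : ℕ := by
  classical exact #{f ∈ range G.edges | (G.cap f : ℝ) ≤ x f}

variable {act : ℕ → ℕ}

theorem next_iterate_lt (hG : G.WellFormed) {b : ℕ} (hb : b < G.edges) (k : ℕ) :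
    (G.next act)^[k] b < G.edges := by
  induction k with
  | zero => exact hb
  | succ k ih =>
    rw [Function.iterate_succ_apply', next]
    split_ifs with h
    · exact hG.dst_lt _ h
    · exact ih

theorem next_iterate_of_le {c : ℕ} (h : G.edges ≤ act c) (k : ℕ) : (G.next act)^[k] c = c :=
  Function.iterate_fixed (by simp [next, h]) k

/-- After `edges` steps the walk along active edges has entered its cycle, by the pigeonhole
principle. -/
theorem exists_period (hG : G.WellFormed) {b : ℕ} (hb : b < G.edges) :
    ∃ p, 0 < p ∧ p ≤ G.edges ∧
      (G.next act)^[p] ((G.next act)^[G.edges] b) = (G.next act)^[G.edges] b := by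
  obtain ⟨i, hi, j, hj, hne, heq⟩ := exists_ne_map_eq_of_card_lt_of_maps_to
    (s := range (G.edges + 1)) (t := range G.edges) (by simp)
    (f := fun k => (G.next act)^[k] b) (fun k _ => by
      simpa using next_iterate_lt hG hb k)
  simp only [mem_range] at hi hj
  wlog hij : i < j generalizing i j
  · exact this j i hne.symm heq.symm hj hi (by omega)
  refine ⟨j - i, by omega, by omega, ?_⟩
  have h1 : (G.next act)^[G.edges] b = (G.next act)^[G.edges - i] ((G.next act)^[i] b) := by
    rw [← Function.iterate_add_apply]; congr 1; omega
  rw [h1, ← Function.iterate_add_apply,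
    show j - i + (G.edges - i) = (G.edges - i) + (j - i) by ring, Function.iterate_add_apply, ← Function.iterate_add_apply _ (j - i), show j - i + i = j by omega]
  exact congrArg _ heq.symm

/-- A walk that has come to rest after `edges` steps does not run into a cycle. -/
theorem IsActiveMap.not_cyclic (hG : G.WellFormed) (hact : G.IsActiveMap x act) {b : ℕ}
    (h : G.edges ≤ act ((G.next act)^[G.edges] b)) : ¬ G.Cyclic x b := by
  rintro ⟨S, hS, hb⟩
  have hmem : ∀ b ∈ S, act b < G.edges ∧ G.next act b ∈ S := by
    intro b hb
    obtain ⟨f, rfl, hf, hd⟩ := hS b hb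
    rcases hact _ (hG.src_lt f hf.1) with h | h
    · exact absurd (h.2 f hf.1 rfl) (not_le.2 hf.2.1)
    · have : act (G.src f) = f := hG.prio_inj _ h.2.1 _ hf.1 h.1
        (le_antisymm (h.2.2.2 f hf.1 h.1.symm hf.2.1) (hf.2.2 _ h.2.1 h.1 h.2.2.1))
      rw [next, this, if_pos hf.1]
      exact ⟨hf.1, hd⟩
  have hall : ∀ k, (G.next act)^[k] b ∈ S := fun k => by
    induction k with
    | zero => exact hb
    | succ k ih => rw [Function.iterate_succ_apply']; exact (hmem _ ih).2
  exact absurd (hmem _ (hall G.edges)).1 (not_lt.2 h)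

/-- The nodes visited from a periodic node `c`, along with the facts that make the active edges
between them a cycle. -/
theorem exists_cycle (hG : G.WellFormed) (hact : G.IsActiveMap x act) {c p : ℕ} (hc : c < G.edges)
    (hp : 0 < p) (hpL : p ≤ G.edges) (hper : (G.next act)^[p] c = c) (hlt : act c < G.edges) :
    ∃ C : Finset ℕ, (∀ a, a ∈ C ↔ ∃ i < G.edges, (G.next act)^[i] c = a) ∧
      (∀ a ∈ C, act a < G.edges ∧ G.src (act a) = a ∧ G.IsActive x (act a)) ∧
      C.image (fun a => G.dst (act a)) = C := by
  set σ := G.next act with hσ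
  let C := (range G.edges).image fun i => σ^[i] c
  have hmem : ∀ a, a ∈ C ↔ ∃ i < G.edges, σ^[i] c = a := fun a => by simp [C]
  have hall : ∀ i, σ^[i] c ∈ C := by
    intro i
    refine (hmem _).2 ⟨i % p, (Nat.mod_lt _ hp).trans_le hpL, ?_⟩
    exact Function.IsPeriodicPt.iterate_mod_apply hper i
  have hactive : ∀ a ∈ C, act a < G.edges ∧ G.src (act a) = a ∧ G.IsActive x (act a) := by
    intro a ha
    obtain ⟨i, hi, rfl⟩ := (hmem a).1 ha
    rcases hact _ (next_iterate_lt hG hc i) with h | h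
    · exfalso
      -- A resting point of the walk would be `c` itself, as the walk comes back to `c`.
      have h1 : σ^[p * i - i] (σ^[i] c) = σ^[i] c := next_iterate_of_le h.1 _
      have hle : i ≤ p * i := Nat.le_mul_of_pos_left i hp
      rw [← Function.iterate_add_apply, show p * i - i + i = p * i by omega] at h1
      have h2 : σ^[p * i] c = c := Function.IsPeriodicPt.mul_const hper i
      rw [h2] at h1
      have h3 : G.edges ≤ act (σ^[i] c) := h.1
      rw [← h1] at h3
      omega
    · exact ⟨h.2.1, h⟩
  have hnext : ∀ a ∈ C, σ a = G.dst (act a) := fun a ha => if_pos (hactive a ha).1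
  refine ⟨C, hmem, hactive, ?_⟩
  ext a
  simp only [mem_image]
  constructor
  · rintro ⟨a', ha', rfl⟩
    rw [← hnext a' ha']
    obtain ⟨i, _, rfl⟩ := (hmem a').1 ha'
    rw [← Function.iterate_succ_apply' σ]
    exact hall _
  · intro ha
    obtain ⟨i, _, rfl⟩ := (hmem a).1 ha
    refine ⟨σ^[i + (p - 1)] c, hall _, ?_⟩
    rw [← hnext _ (hall _), ← Function.iterate_succ_apply' σ,
      show (i + (p - 1)).succ = i + p by omega, Function.iterate_add_apply, hper]

theorem sum_indicator_image {C : Finset ℕ} {act key : ℕ → ℕ} {L : ℕ} {d : ℝ}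
    (hL : ∀ a ∈ C, act a < L) (hinj : Set.InjOn act C) (b : ℕ) :
    (∑ f ∈ range L with key f = b, if f ∈ C.image act then d else 0) =
      ∑ a ∈ C, if key (act a) = b then d else 0 := by
  rw [sum_filter]
  have h1 : ∀ f, (if key f = b then (if f ∈ C.image act then d else 0) else 0) =
      if f ∈ C.image act then (if key f = b then d else 0) else 0 := by
    intro f; split_ifs <;> rfl
  simp only [h1]
  rw [← sum_filter, ← sum_image (s := C) (g := act) (f := fun f => if key f = b then d else 0) hinj]
  refine sum_congr ?_ fun _ _ => rfl
  ext f
  simp only [mem_filter, mem_range, and_iff_right_iff_imp, mem_image]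
  rintro ⟨a, ha, rfl⟩
  exact hL a ha

/-- Raise the flow by `d` on the cycle into which the walk from `b` runs, where `d` is the smallest
remaining capacity on that cycle. -/
theorem IsFlow.raise (hG : G.WellFormed) (hx : G.IsFlow x) (hact : G.IsActiveMap x act)
    {b c : ℕ} (hb : b < G.edges) (hc : c = (G.next act)^[G.edges] b) {x' : ℕ → ℝ} {d : ℝ}
    {M : ℕ → Prop} [DecidablePred M]
    (hM : ∀ f < G.edges, M f ↔ ∃ i < G.edges, act ((G.next act)^[i] c) = f)
    (hx' : ∀ f < G.edges, x' f = if M f then x f + d else x f)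
    (hd : act c < G.edges → (∀ f < G.edges, M f → d ≤ G.cap f - x f) ∧
      ∃ f < G.edges, M f ∧ d = G.cap f - x f) :
    G.IsFlow x' ∧ (∀ f < G.edges, x f ≤ x' f) ∧
      ((¬ G.Cyclic x b ∧ ∀ f < G.edges, x' f = x f) ∨
        ((∃ v, G.Cyclic x v) ∧ G.saturatedCard x < G.saturatedCard x')) := by
  classical
  by_cases hlt : act c < G.edges
  swap
  · have hsame : ∀ f < G.edges, x' f = x f := by
      intro f hf
      rw [hx' f hf, if_neg]
      rw [hM f hf]
      rintro ⟨i, _, rfl⟩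
      rw [next_iterate_of_le (not_lt.1 hlt)] at hf
      exact hlt hf
    refine ⟨⟨⟨fun f hf => ?_, fun f hf => ?_, fun f hf f' hf' => ?_⟩, fun a ha => ?_⟩,
      fun f hf => (hsame f hf).ge, Or.inl ⟨hact.not_cyclic hG (hc ▸ not_lt.1 hlt), hsame⟩⟩
    · rw [hsame f hf]; exact hx.nonneg f hf
    · rw [hsame f hf]; exact hx.le_cap f hf
    · rw [hsame f hf, hsame f' hf']; exact hx.saturated f hf f' hf'
    · have h := hx.conserved a ha
      simp only [outflow, inflow] at h ⊢
      rw [sum_congr rfl fun f hf => hsame f (by simp at hf; exact hf.1), h]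
      exact (sum_congr rfl fun f hf => hsame f (by simp at hf; exact hf.1)).symm
  obtain ⟨p, hp, hpL, hper⟩ := exists_period (act := act) hG hb
  rw [← hc] at hper
  have hcL : c < G.edges := hc ▸ next_iterate_lt hG hb _
  obtain ⟨C, hC, hCact, hCimg⟩ := exists_cycle hG hact hcL hp hpL hper hlt
  obtain ⟨hd1, f0, hf0, hMf0, hd0⟩ := hd hlt
  have hMC : ∀ f < G.edges, M f ↔ f ∈ C.image act := by
    intro f hf
    rw [hM f hf, mem_image]
    constructor
    · rintro ⟨i, hi, rfl⟩
      exact ⟨_, (hC _).2 ⟨i, hi, rfl⟩, rfl⟩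
    · rintro ⟨a, ha, rfl⟩
      obtain ⟨i, hi, rfl⟩ := (hC a).1 ha
      exact ⟨i, hi, rfl⟩
  have hMact : ∀ f < G.edges, M f → G.IsActive x f := by
    intro f hf hMf
    obtain ⟨a, ha, rfl⟩ := mem_image.1 ((hMC f hf).1 hMf)
    exact (hCact a ha).2.2
  have hdpos : 0 < d := by
    have := (hMact f0 hf0 hMf0).2.1
    linarith
  have hle : ∀ f < G.edges, x f ≤ x' f := by
    intro f hf
    rw [hx' f hf]
    split_ifs
    · linarith
    · exact le_rfl
  have hlecap : ∀ f < G.edges, x' f ≤ G.cap f := by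
    intro f hf
    rw [hx' f hf]
    split_ifs with h
    · linarith [hd1 f hf h]
    · exact hx.le_cap f hf
  have hinj : Set.InjOn act C := fun a ha a' ha' h => by
    rw [← (hCact a ha).2.1, ← (hCact a' ha').2.1, h]
  have hinj' : Set.InjOn (fun a => G.dst (act a)) C := by
    rw [← card_image_iff, hCimg]
  have hx'' : ∀ f < G.edges, x' f = x f + if f ∈ C.image act then d else 0 := by
    intro f hf
    rw [hx' f hf]
    simp only [hMC f hf]
    split_ifs <;> simp
  refine ⟨⟨⟨fun f hf => (hx.nonneg f hf).trans (hle f hf), hlecap,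
    fun f hf f' hf' hs hpr hpos => ?_⟩, fun a ha => ?_⟩, hle,
    Or.inr ⟨⟨c, C, fun a ha => ?_, ?_⟩, ?_⟩⟩
  · refine le_trans ?_ (hle f' hf')
    by_cases hMf : M f
    · by_contra! hns
      exact absurd ((hMact f hf hMf).2.2 f' hf' hs.symm hns) (not_le.2 hpr)
    · rw [hx' f hf, if_neg hMf] at hpos
      exact hx.saturated f hf f' hf' hs hpr hpos
  · have h := hx.conserved a ha
    simp only [outflow, inflow] at h ⊢
    rw [sum_congr rfl fun f hf => hx'' f (by simp at hf; exact hf.1), sum_add_distrib, h,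
      sum_indicator_image (fun a ha => (hCact a ha).1) hinj]
    rw [sum_congr rfl fun f hf => hx'' f (by simp at hf; exact hf.1), sum_add_distrib,
      sum_indicator_image (fun a ha => (hCact a ha).1) hinj]
    congr 1
    rw [sum_congr rfl fun a' ha' => by rw [(hCact a' ha').2.1]]
    conv_lhs => rw [← hCimg]
    rw [sum_image hinj']
  · exact ⟨act a, (hCact a ha).2.1, (hCact a ha).2.2,
      mem_coe.2 (hCimg ▸ mem_image_of_mem (fun a => G.dst (act a)) ha)⟩
  · exact mem_coe.2 ((hC c).2 ⟨0, Nat.zero_lt_of_lt hcL, rfl⟩)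
  · unfold saturatedCard
    refine card_lt_card ⟨fun f hf => ?_, fun hsub => ?_⟩
    · simp only [mem_filter, mem_range] at hf ⊢
      exact ⟨hf.1, hf.2.trans (hle f hf.1)⟩
    · have := @hsub f0 (by
        simp only [mem_filter, mem_range]
        refine ⟨hf0, ?_⟩
        rw [hx' f0 hf0, if_pos hMf0]
        linarith)
      simp only [mem_filter, mem_range] at this
      linarith [(hMact f0 hf0 hMf0).2.1, this.2]

theorem saturatedCard_mono (h : ∀ f < G.edges, x f ≤ y f) :
    G.saturatedCard x ≤ G.saturatedCard y := by
  classical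
  unfold saturatedCard
  refine card_le_card fun f hf => ?_
  simp only [mem_filter, mem_range] at hf ⊢
  exact ⟨hf.1, hf.2.trans (h f hf.1)⟩

theorem Cyclic.congr {b : ℕ} (h : G.Cyclic x b) (hxy : ∀ f < G.edges, x f = y f) :
    G.Cyclic y b := by
  obtain ⟨S, hS, hb⟩ := h
  refine ⟨S, fun b hb => ?_, hb⟩
  obtain ⟨f, hs, ⟨hf, hlt, hmin⟩, hd⟩ := hS b hb
  exact ⟨f, hs, ⟨hf, hxy f hf ▸ hlt, fun f' hf' hs' h' => hmin f' hf' hs' (hxy f' hf' ▸ h')⟩, hd⟩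

theorem Cyclic.lt (hG : G.WellFormed) {b : ℕ} (h : G.Cyclic x b) : b < G.edges := by
  obtain ⟨S, hS, hb⟩ := h
  obtain ⟨f, rfl, hf, -⟩ := hS b hb
  exact hG.src_lt f hf.1

theorem not_cyclic_of_saturatedCard (h : G.edges ≤ G.saturatedCard x) (b : ℕ) :
    ¬ G.Cyclic x b := by
  classical
  rintro ⟨S, hS, hb⟩
  obtain ⟨f, -, hf, -⟩ := hS b hb
  unfold saturatedCard at h
  have heq := filter_card_eq (p := fun f => (G.cap f : ℝ) ≤ x f) (s := range G.edges)
    (le_antisymm ((card_filter_le _ _)) (by simpa using h)) f (by simpa using hf.1)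
  linarith [hf.2.1]

end FlowNet

/-! ### The program that removes all cycles of active edges -/

/-- The arrays `0`, `1`, `2`, `3` of the store hold the network `G`. The array `4` holds the flow,
the array `5` the active edges of the nodes, and the array `6` marks the edges of a cycle. -/
structure Stores (E : Env) (G : FlowNet) (a : Store) : Prop where
  len : E.len = G.edges
  src : a.arr 0 = G.src
  dst : a.arr 1 = G.dst
  cap : a.arr 2 = G.cap
  prio : a.arr 3 = G.prio

/-- The flow in the array `4`. -/
def Store.flow (a : Store) (f : ℕ) : ℝ := a.arr 4 f

theorem Stores.of_arr_eq {E : Env} {G : FlowNet} {a b : Store} (h : Stores E G a)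
    (h0 : b.arr 0 = a.arr 0) (h1 : b.arr 1 = a.arr 1) (h2 : b.arr 2 = a.arr 2)
    (h3 : b.arr 3 = a.arr 3) : Stores E G b :=
  ⟨h.len, h0.trans h.src, h1.trans h.dst, h2.trans h.cap, h3.trans h.prio⟩

theorem Stores.run {E : Env} {G : FlowNet} {a : Store} (h : Stores E G a) (c : Cmd)
    (h0 : c.writes 0 = false) (h1 : c.writes 1 = false) (h2 : c.writes 2 = false)
    (h3 : c.writes 3 = false) : Stores E G (c.run E a) :=
  h.of_arr_eq (c.run_arr_of_not_writes h0 a) (c.run_arr_of_not_writes h1 a)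
    (c.run_arr_of_not_writes h2 a) (c.run_arr_of_not_writes h3 a)

/-- Compute the active edge of every node, or `len` if it has none. The cell of the priorities with
number `len` is assumed to hold a number above all priorities. -/
def activeCmd : Cmd :=
  .seq (.forLen 2 (.put 5 (.var 2) .len))
    (.forLen 2 (.ite (.get 4 (.var 2)) (.get 2 (.var 2))
      (.ite (.get 3 (.var 2)) (.get 3 (.get 5 (.get 0 (.var 2))))
        (.put 5 (.get 0 (.var 2)) (.var 2)) .skip) .skip))

/-- Walk `len` steps along active edges from the node in variable `1`; the end point is left in
variable `3`. -/
def walkCmd : Cmd :=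
  .seq (.assign 3 (.var 1))
    (.forLen 2 (.ite (.get 5 (.var 3)) .len (.assign 3 (.get 1 (.get 5 (.var 3)))) .skip))

/-- Mark the active edges on a walk of `len` steps from the node in variable `3`. -/
def markCmd : Cmd :=
  .seq (.seq (.forLen 2 (.put 6 (.var 2) (.lit 0))) (.assign 5 (.var 3)))
    (.forLen 2 (.ite (.get 5 (.var 5)) .len
      (.seq (.put 6 (.get 5 (.var 5)) (.lit 1)) (.assign 5 (.get 1 (.get 5 (.var 5))))) .skip))

/-- Compute in variable `4` the smallest remaining capacity of a marked edge; the active edge of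
the node in variable `3` has to be marked. -/
def slackCmd : Cmd :=
  .seq (.assign 4 (.sub (.get 2 (.get 5 (.var 3))) (.get 4 (.get 5 (.var 3)))))
    (.forLen 2 (.ite (.lit 0) (.get 6 (.var 2))
      (.ite (.sub (.get 2 (.var 2)) (.get 4 (.var 2))) (.var 4)
        (.assign 4 (.sub (.get 2 (.var 2)) (.get 4 (.var 2)))) .skip) .skip))

/-- Raise the flow by variable `4` on all marked edges. -/
def raiseCmd : Cmd :=
  .forLen 2 (.ite (.lit 0) (.get 6 (.var 2))
    (.put 4 (.var 2) (.add (.get 4 (.var 2)) (.var 4))) .skip)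

/-- Raise the flow on the cycle, if there is one, into which the walk from the node in variable `1`
runs. -/
def cycleCmd : Cmd :=
  .seq activeCmd (.seq walkCmd (.seq markCmd (.seq slackCmd raiseCmd)))

/-- Raise the flow on cycles of active edges until there is none. Every round of attempts from all
nodes saturates an edge unless there is no cycle, so `len` rounds suffice. -/
def saturateCmd : Cmd := .forLen 0 (.forLen 1 cycleCmd)

variable {E : Env} {G : FlowNet} {a : Store}

theorem run_activeCmd (h : Stores E G a) (hG : G.WellFormed)
    (hprio : ∀ f < G.edges, G.prio f < G.prio G.edges) :
    G.IsActiveMap a.flow ((activeCmd.run E a).arr 5) := by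
  rw [activeCmd, Cmd.run]
  set b := (Cmd.forLen 2 (.put 5 (.var 2) .len)).run E a with hb
  have hb4 : b.arr 4 = a.arr 4 := Cmd.run_arr_of_not_writes _ rfl _
  have hbs : Stores E G b := h.run _ rfl rfl rfl rfl
  have hb5 : ∀ v < E.len, b.arr 5 v = E.len :=
    Cmd.run_forLen_induction (fun j (st : Store) => ∀ v < j, st.arr 5 v = E.len) (by simp)
      fun j _ st hst v hv => by
        simp only [Cmd.run, Expr.eval, Store.put_arr, Store.setVar_var, Store.setVar_arr,
          if_true, Function.update_apply]
        split_ifs with hvj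
        · rfl
        · exact hst v (by omega)
  clear_value b
  have key := Cmd.run_forLen_induction (E := E) (i := 2) (a := b)
    (c := .ite (.get 4 (.var 2)) (.get 2 (.var 2))
      (.ite (.get 3 (.var 2)) (.get 3 (.get 5 (.get 0 (.var 2))))
        (.put 5 (.get 0 (.var 2)) (.var 2)) .skip) .skip)
    (fun j st => Stores E G st ∧ st.arr 4 = a.arr 4 ∧ ∀ v < G.edges,
      (st.arr 5 v = G.edges ∧ ∀ f < j, G.src f = v → G.cap f ≤ a.arr 4 f) ∨
      (st.arr 5 v < j ∧ G.src (st.arr 5 v) = v ∧ a.arr 4 (st.arr 5 v) < G.cap (st.arr 5 v) ∧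
        ∀ f < j, G.src f = v → a.arr 4 f < G.cap f → G.prio (st.arr 5 v) ≤ G.prio f))
    ⟨hbs, hb4, fun v hv => Or.inl ⟨by rw [hb5 v (h.len ▸ hv), h.len],
      fun f hf => absurd hf (Nat.not_lt_zero f)⟩⟩ ?_
  · obtain ⟨-, -, key⟩ := key
    intro v hv
    rw [h.len] at key
    rcases key v hv with ⟨h1, h2⟩ | ⟨h1, h2, h3, h4⟩
    · exact Or.inl ⟨h1.ge, fun f hf hs => Nat.cast_le.2 (h2 f hf hs)⟩
    · exact Or.inr ⟨h2, h1, Nat.cast_lt.2 h3, fun f hf hs hx =>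
        h4 f hf (hs.trans h2) (Nat.cast_lt.1 hx)⟩
  · rintro j hj st ⟨hst, h4, hst5⟩
    rw [h.len] at hj
    have hsrc := hG.src_lt j hj
    simp only [Cmd.run, Expr.eval, Store.setVar_var, Store.setVar_arr, if_true, h4, hst.src,
      hst.cap, hst.prio, Cmd.run_skip]
    have hold : ∀ v < G.edges, (G.src j = v → G.cap j ≤ a.arr 4 j ∨
          G.prio (st.arr 5 (G.src j)) ≤ G.prio j) →
        (st.arr 5 v = G.edges ∧ ∀ f < j + 1, G.src f = v → G.cap f ≤ a.arr 4 f) ∨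
        (st.arr 5 v < j + 1 ∧ G.src (st.arr 5 v) = v ∧ a.arr 4 (st.arr 5 v) < G.cap (st.arr 5 v) ∧
          ∀ f < j + 1, G.src f = v → a.arr 4 f < G.cap f → G.prio (st.arr 5 v) ≤ G.prio f) := by
      intro v hv hj'
      rcases hst5 v hv with ⟨h1, h2⟩ | ⟨h1, h2, h3, h4⟩
      · refine Or.inl ⟨h1, fun f hf hs => ?_⟩
        rcases Nat.lt_succ_iff_lt_or_eq.1 hf with hf | rfl
        · exact h2 f hf hs
        · rcases hj' hs with h | h
          · exact h
          · rw [hs, h1] at h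
            exact absurd (hprio f hj) (not_lt.2 h)
      · refine Or.inr ⟨by omega, h2, h3, fun f hf hs hx => ?_⟩
        rcases Nat.lt_succ_iff_lt_or_eq.1 hf with hf | rfl
        · exact h4 f hf hs hx
        · rcases hj' hs with h | h
          · omega
          · rwa [hs] at h
    split_ifs with hlt hp
    · refine ⟨hst.of_arr_eq ?_ ?_ ?_ ?_, ?_, fun v hv => ?_⟩
      · simp [Store.put_arr]
      · simp [Store.put_arr]
      · simp [Store.put_arr]
      · simp [Store.put_arr]
      · simpa [Store.put_arr] using h4
      · simp only [Store.put_arr, Store.setVar_arr, if_true, Function.update_apply]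
        by_cases hvs : v = G.src j
        · subst hvs
          simp only [if_true]
          refine Or.inr ⟨by omega, trivial, hlt, fun f hf hs hx => ?_⟩
          rcases Nat.lt_succ_iff_lt_or_eq.1 hf with hf | rfl
          · rcases hst5 _ hv with ⟨-, h2⟩ | ⟨-, -, -, h4⟩
            · exact absurd hx (not_lt.2 (h2 f hf hs))
            · exact hp.le.trans (h4 f hf hs hx)
          · exact le_rfl
        · simp only [hvs, if_false]
          exact hold v hv fun h => absurd h.symm hvs
    · exact ⟨hst.of_arr_eq rfl rfl rfl rfl, h4, fun v hv => hold v hv fun _ => Or.inr (not_lt.1 hp)⟩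
    · exact ⟨hst.of_arr_eq rfl rfl rfl rfl, h4,
        fun v hv => hold v hv fun _ => Or.inl (not_lt.1 hlt)⟩

theorem run_walkCmd (h : Stores E G a) :
    (walkCmd.run E a).var 3 = (G.next (a.arr 5))^[G.edges] (a.var 1) := by
  rw [walkCmd, Cmd.run, ← h.len]
  refine (Cmd.run_forLen_induction (fun j (st : Store) => Stores E G st ∧ st.arr 5 = a.arr 5 ∧
    st.var 3 = (G.next (a.arr 5))^[j] (a.var 1)) ⟨h.run _ rfl rfl rfl rfl, rfl, ?_⟩ ?_).2.2
  · simp [Cmd.run, Expr.eval]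
  · rintro j - st ⟨hst, h5, h3⟩
    refine ⟨(hst.of_arr_eq (b := st.setVar 2 j) rfl rfl rfl rfl).run _ rfl rfl rfl rfl, ?_, ?_⟩
    · rw [Cmd.run_arr_of_not_writes _ rfl, Store.setVar_arr, h5]
    · rw [Function.iterate_succ_apply', ← h3, FlowNet.next]
      simp only [Cmd.run, Expr.eval, Store.setVar_var, Store.setVar_arr, h5, hst.dst, h.len]
      split_ifs <;> simp_all

theorem run_markCmd (h : Stores E G a) {f : ℕ} (hf : f < G.edges) :
    0 < (markCmd.run E a).arr 6 f ↔
      ∃ i < G.edges, a.arr 5 ((G.next (a.arr 5))^[i] (a.var 3)) = f := by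
  rw [markCmd, Cmd.run]
  set b := (Cmd.seq (.forLen 2 (.put 6 (.var 2) (.lit 0))) (.assign 5 (.var 3))).run E a with hb
  have hb5 : b.arr 5 = a.arr 5 := Cmd.run_arr_of_not_writes _ rfl _
  have hb3 : b.var 5 = a.var 3 := by
    simp only [hb, Cmd.run, Expr.eval, Store.setVar_var, if_true]
    exact Cmd.run_var_of_not_assigns (.forLen 2 (.put 6 (.var 2) (.lit 0))) rfl _
  have hbs : Stores E G b := h.run _ rfl rfl rfl rfl
  have hb6 : ∀ v < E.len, b.arr 6 v = 0 :=
    Cmd.run_forLen_induction (fun j (st : Store) => ∀ v < j, st.arr 6 v = 0) (by simp)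
      fun j _ st hst v hv => by
        simp only [Cmd.run, Expr.eval, Store.put_arr, Store.setVar_var, Store.setVar_arr,
          if_true, Function.update_apply]
        split_ifs with hvj
        · rfl
        · exact hst v (by omega)
  clear hb
  clear_value b
  have key := Cmd.run_forLen_induction (E := E) (i := 2) (a := b)
    (c := .ite (.get 5 (.var 5)) .len
      (.seq (.put 6 (.get 5 (.var 5)) (.lit 1)) (.assign 5 (.get 1 (.get 5 (.var 5))))) .skip)
    (fun j st => Stores E G st ∧ st.arr 5 = a.arr 5 ∧
      st.var 5 = (G.next (a.arr 5))^[j] (a.var 3) ∧ ∀ f < G.edges, 0 < st.arr 6 f ↔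
        ∃ i < j, a.arr 5 ((G.next (a.arr 5))^[i] (a.var 3)) = f)
    ⟨hbs, hb5, hb3, fun f hf => by simp [hb6 f (h.len ▸ hf)]⟩ ?_
  · rw [h.len] at key
    exact key.2.2.2 f hf
  · rintro j - st ⟨hst, h5, h3, h6⟩
    refine ⟨(hst.of_arr_eq (b := st.setVar 2 j) rfl rfl rfl rfl).run _ rfl rfl rfl rfl, ?_, ?_,
      fun f hf => ?_⟩
    · rw [Cmd.run_arr_of_not_writes _ rfl, Store.setVar_arr, h5]
    · rw [Function.iterate_succ_apply', ← h3, FlowNet.next]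
      simp only [Cmd.run, Expr.eval, Store.setVar_var, Store.setVar_arr, h5, h.len]
      split_ifs <;> simp_all [Store.put_arr, hst.dst]
    · have hsplit : (∃ i < j + 1, a.arr 5 ((G.next (a.arr 5))^[i] (a.var 3)) = f) ↔
          (∃ i < j, a.arr 5 ((G.next (a.arr 5))^[i] (a.var 3)) = f) ∨ a.arr 5 (st.var 5) = f := by
        rw [h3]
        constructor
        · rintro ⟨i, hi, rfl⟩
          rcases Nat.lt_succ_iff_lt_or_eq.1 hi with hi | rfl
          · exact Or.inl ⟨i, hi, rfl⟩
          · exact Or.inr rfl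
        · rintro (⟨i, hi, rfl⟩ | rfl)
          · exact ⟨i, by omega, rfl⟩
          · exact ⟨j, by omega, rfl⟩
      rw [hsplit, ← h6 f hf]
      simp only [Cmd.run, Expr.eval, Store.setVar_var, Store.setVar_arr, h5, h.len,
        show ¬ (5 : ℕ) = 2 by omega, if_false, Cmd.run_skip]
      split_ifs with hlt
      · by_cases hfe : f = a.arr 5 (st.var 5)
        · simp [Store.put_arr, hfe]
        · simp [Store.put_arr, hfe, Ne.symm hfe]
      · have : ¬ a.arr 5 (st.var 5) = f := by omega
        simp [this]

theorem run_slackCmd (h : Stores E G a) {c : ℕ} (hc : c = a.arr 5 (a.var 3)) (hlt : c < G.edges)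
    (hmark : 0 < a.arr 6 c) :
    (∀ f < G.edges, 0 < a.arr 6 f → (slackCmd.run E a).var 4 ≤ G.cap f - a.arr 4 f) ∧
      ∃ f < G.edges, 0 < a.arr 6 f ∧ (slackCmd.run E a).var 4 = G.cap f - a.arr 4 f := by
  rw [slackCmd, Cmd.run]
  have key := Cmd.run_forLen_induction (E := E) (i := 2)
    (a := (Cmd.assign 4 (.sub (.get 2 (.get 5 (.var 3))) (.get 4 (.get 5 (.var 3))))).run E a)
    (c := .ite (.lit 0) (.get 6 (.var 2))
      (.ite (.sub (.get 2 (.var 2)) (.get 4 (.var 2))) (.var 4)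
        (.assign 4 (.sub (.get 2 (.var 2)) (.get 4 (.var 2)))) .skip) .skip)
    (fun j st => st.arr = a.arr ∧
      (∀ f < j, 0 < a.arr 6 f → st.var 4 ≤ G.cap f - a.arr 4 f) ∧
      ∃ f < G.edges, 0 < a.arr 6 f ∧ st.var 4 = G.cap f - a.arr 4 f)
    ⟨rfl, by simp, c, hlt, hmark, by simp [Cmd.run, Expr.eval, hc, h.cap]⟩ ?_
  · rw [h.len] at key
    exact key.2
  · rintro j hj st ⟨hst, h1, f0, hf0, hm0, h4⟩
    rw [h.len] at hj
    simp only [Cmd.run, Expr.eval, Store.setVar_var, Store.setVar_arr, if_true, hst, h.cap,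
      Cmd.run_skip, show ¬ (4 : ℕ) = 2 by omega, if_false]
    split_ifs with hm hlt'
    · refine ⟨by simp [hst], fun f hf hmf => ?_, j, hj, hm, by simp⟩
      simp only [Store.setVar_var, if_true]
      rcases Nat.lt_succ_iff_lt_or_eq.1 hf with hf | rfl
      · exact hlt'.le.trans (h1 f hf hmf)
      · exact le_rfl
    · refine ⟨by simp [hst], fun f hf hmf => ?_, f0, hf0, hm0, by simp [h4]⟩
      simp only [Store.setVar_var, show ¬ (4 : ℕ) = 2 by omega, if_false]
      rcases Nat.lt_succ_iff_lt_or_eq.1 hf with hf | rfl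
      · exact h1 f hf hmf
      · exact not_lt.1 hlt'
    · refine ⟨by simp [hst], fun f hf hmf => ?_, f0, hf0, hm0, by simp [h4]⟩
      simp only [Store.setVar_var, show ¬ (4 : ℕ) = 2 by omega, if_false]
      rcases Nat.lt_succ_iff_lt_or_eq.1 hf with hf | rfl
      · exact h1 f hf hmf
      · exact absurd hmf hm

theorem run_raiseCmd {f : ℕ} (hf : f < E.len) :
    (raiseCmd.run E a).arr 4 f = if 0 < a.arr 6 f then a.arr 4 f + a.var 4 else a.arr 4 f := by
  have key := Cmd.run_forLen_induction (E := E) (i := 2) (a := a)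
    (c := .ite (.lit 0) (.get 6 (.var 2))
      (.put 4 (.var 2) (.add (.get 4 (.var 2)) (.var 4))) .skip)
    (fun j st => st.arr 6 = a.arr 6 ∧ st.var 4 = a.var 4 ∧
      ∀ f, st.arr 4 f = if f < j ∧ 0 < a.arr 6 f then a.arr 4 f + a.var 4 else a.arr 4 f)
    ⟨rfl, rfl, by simp⟩ ?_
  · have := key.2.2 f
    simp only [hf, true_and] at this
    exact this
  · rintro j - st ⟨h6, hv, h4⟩
    refine ⟨?_, ?_, fun f => ?_⟩
    · rw [Cmd.run_arr_of_not_writes _ rfl, Store.setVar_arr, h6]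
    · rw [Cmd.run_var_of_not_assigns _ rfl, Store.setVar_var, if_neg (by omega), hv]
    · simp only [Cmd.run, Expr.eval, Store.setVar_var, Store.setVar_arr, if_true, h6, hv,
        Cmd.run_skip, show ¬ (4 : ℕ) = 2 by omega, if_false]
      by_cases hfj : f = j
      · subst hfj
        split_ifs with hm h2 h2
        · simp [Store.put_arr, h4]
        · exact absurd ⟨by omega, hm⟩ h2
        · exact absurd h2.2 hm
        · simp [h4]
      · have hiff : f < j + 1 ↔ f < j := by omega
        simp only [hiff]
        rw [← h4 f]
        split_ifs with hm
        · simp [Store.put_arr, hfj]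
        · rfl

/-- One attempt leaves a flow, at least the old one; either there is no cycle ahead of the node in
variable `1`, or the number of saturated edges grows. -/
theorem run_cycleCmd (h : Stores E G a) (hG : G.WellFormed)
    (hprio : ∀ f < G.edges, G.prio f < G.prio G.edges) (hx : G.IsFlow a.flow)
    (hb : a.var 1 < G.edges) :
    G.IsFlow (cycleCmd.run E a).flow ∧ (∀ f < G.edges, a.flow f ≤ (cycleCmd.run E a).flow f) ∧
      ((¬ G.Cyclic a.flow (a.var 1) ∧ ∀ f < G.edges, (cycleCmd.run E a).flow f = a.flow f) ∨
        ((∃ v, G.Cyclic a.flow v) ∧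
          G.saturatedCard a.flow < G.saturatedCard (cycleCmd.run E a).flow)) := by
  rw [cycleCmd, Cmd.run, Cmd.run, Cmd.run, Cmd.run]
  have hact := run_activeCmd h hG hprio
  set a1 := activeCmd.run E a with ha1
  have h1 : Stores E G a1 := h.run _ rfl rfl rfl rfl
  have h14 : a1.arr 4 = a.arr 4 := Cmd.run_arr_of_not_writes _ rfl _
  have h1v : a1.var 1 = a.var 1 := Cmd.run_var_of_not_assigns _ rfl _
  have hwalk := run_walkCmd h1
  set a2 := walkCmd.run E a1 with ha2
  have h2 : Stores E G a2 := h1.run _ rfl rfl rfl rfl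
  have h24 : a2.arr 4 = a.arr 4 := (Cmd.run_arr_of_not_writes _ rfl _).trans h14
  have h25 : a2.arr 5 = a1.arr 5 := Cmd.run_arr_of_not_writes _ rfl _
  have hmark := fun f hf => run_markCmd h2 (f := f) hf
  set a3 := markCmd.run E a2 with ha3
  have h3 : Stores E G a3 := h2.run _ rfl rfl rfl rfl
  have h34 : a3.arr 4 = a.arr 4 := (Cmd.run_arr_of_not_writes _ rfl _).trans h24
  have h35 : a3.arr 5 = a1.arr 5 := (Cmd.run_arr_of_not_writes _ rfl _).trans h25
  have h3v : a3.var 3 = a2.var 3 := Cmd.run_var_of_not_assigns _ rfl _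
  have hslack := fun hlt hm => run_slackCmd h3 (c := a3.arr 5 (a3.var 3)) rfl hlt hm
  set a4 := slackCmd.run E a3 with ha4
  have h44 : a4.arr 4 = a.arr 4 := (Cmd.run_arr_of_not_writes _ rfl _).trans h34
  have h46 : a4.arr 6 = a3.arr 6 := Cmd.run_arr_of_not_writes _ rfl _
  have hraise := fun f hf => run_raiseCmd (E := E) (a := a4) (f := f) hf
  rw [h1v] at hwalk
  simp only [h25, hwalk] at hmark
  rw [h35, h3v, hwalk] at hslack
  refine hx.raise hG hact hb rfl (d := (a4.var 4 : ℝ)) hmark (fun f hf => ?_) fun hlt => ?_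
  · rw [Store.flow, hraise f (h.len ▸ hf), h44, h46]
    split_ifs
    · rw [Nat.cast_add, Store.flow]
    · rfl
  · obtain ⟨hs1, f0, hf0, hm0, hs2⟩ := hslack hlt
      ((hmark _ hlt).2 ⟨0, Nat.zero_lt_of_lt hlt, rfl⟩)
    rw [h34] at hs1 hs2
    have hle : ∀ f < G.edges, a.arr 4 f ≤ G.cap f := fun f hf => by
      have := hx.le_cap f hf
      exact Nat.cast_le.1 this
    refine ⟨fun f hf hm => ?_, f0, hf0, hm0, ?_⟩
    · have := hs1 f hf hm
      rw [Store.flow, ← Nat.cast_sub (hle f hf)]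
      exact Nat.cast_le.2 this
    · rw [Store.flow, ← Nat.cast_sub (hle f0 hf0), hs2]

theorem Stores.setVar (h : Stores E G a) (i x : ℕ) : Stores E G (a.setVar i x) :=
  h.of_arr_eq rfl rfl rfl rfl

theorem run_saturateCmd (h : Stores E G a) (hG : G.WellFormed)
    (hprio : ∀ f < G.edges, G.prio f < G.prio G.edges) (hx : G.IsFlow a.flow) :
    G.IsFlow (saturateCmd.run E a).flow ∧
      (∀ f < G.edges, a.flow f ≤ (saturateCmd.run E a).flow f) ∧
      ∀ b, ¬ G.Cyclic (saturateCmd.run E a).flow b := by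
  have hround : ∀ st : Store, Stores E G st → G.IsFlow st.flow →
      G.IsFlow ((Cmd.forLen 1 cycleCmd).run E st).flow ∧
      (∀ f < G.edges, st.flow f ≤ ((Cmd.forLen 1 cycleCmd).run E st).flow f) ∧
      ((∀ b, ¬ G.Cyclic ((Cmd.forLen 1 cycleCmd).run E st).flow b) ∨
        ((∃ v, G.Cyclic st.flow v) ∧
          G.saturatedCard st.flow < G.saturatedCard ((Cmd.forLen 1 cycleCmd).run E st).flow)) := by
    intro st hst hflow
    obtain ⟨-, h1, h2, h3⟩ := Cmd.run_forLen_induction (E := E) (i := 1) (a := st) (c := cycleCmd)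
      (fun j b => Stores E G b ∧ G.IsFlow b.flow ∧ (∀ f < G.edges, st.flow f ≤ b.flow f) ∧
        (((∀ v < j, ¬ G.Cyclic b.flow v) ∧ ∀ f < G.edges, b.flow f = st.flow f) ∨
          ((∃ v, G.Cyclic st.flow v) ∧ G.saturatedCard st.flow < G.saturatedCard b.flow)))
      ⟨hst, hflow, fun _ _ => le_rfl, Or.inl ⟨by simp, fun _ _ => rfl⟩⟩ (by
        rintro j hj b ⟨hb, hbf, hle, hor⟩
        obtain ⟨hf', hle', hor'⟩ := run_cycleCmd (hb.setVar 1 j) hG hprio hbf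
          (by simpa using h.len ▸ hj)
        refine ⟨(hb.setVar 1 j).run _ rfl rfl rfl rfl, hf',
          fun f hf => (hle f hf).trans (hle' f hf), ?_⟩
        have hcard := FlowNet.saturatedCard_mono (G := G) hle'
        rcases hor with ⟨hn, hs⟩ | hlt
        · rcases hor' with ⟨hn', hs'⟩ | hlt'
          · refine Or.inl ⟨fun v hv hcyc => ?_, fun f hf => (hs' f hf).trans (hs f hf)⟩
            have hcyc' := hcyc.congr hs'
            rcases Nat.lt_succ_iff_lt_or_eq.1 hv with hv | rfl
            · exact hn v hv hcyc'
            · exact hn' (by simpa using hcyc')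
          · refine Or.inr ⟨hlt'.1.imp fun v hv => FlowNet.Cyclic.congr hv hs,
              lt_of_le_of_lt (FlowNet.saturatedCard_mono fun f hf => ?_) hlt'.2⟩
            exact (hs f hf).ge
        · exact Or.inr ⟨hlt.1, hlt.2.trans_le hcard⟩)
    refine ⟨h1, h2, h3.imp_left fun ⟨hn, _⟩ v hcyc => ?_⟩
    exact hn v (by rw [h.len]; exact hcyc.lt hG) hcyc
  obtain ⟨-, h1, h2, h3⟩ := Cmd.run_forLen_induction (E := E) (i := 0) (a := a)
    (c := .forLen 1 cycleCmd)
    (fun j b => Stores E G b ∧ G.IsFlow b.flow ∧ (∀ f < G.edges, a.flow f ≤ b.flow f) ∧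
      ((∀ v, ¬ G.Cyclic b.flow v) ∨ j ≤ G.saturatedCard b.flow))
    ⟨h, hx, fun _ _ => le_rfl, Or.inr (Nat.zero_le _)⟩ (by
      rintro j - b ⟨hb, hbf, hle, hor⟩
      obtain ⟨hf', hle', hor'⟩ := hround _ (hb.setVar 0 j) hbf
      refine ⟨(hb.setVar 0 j).run _ rfl rfl rfl rfl, hf',
        fun f hf => (hle f hf).trans (hle' f hf), ?_⟩
      rcases hor' with hn | hlt
      · exact Or.inl hn
      · obtain ⟨⟨v, hv⟩, hlt⟩ := hlt
        have hv : G.Cyclic b.flow v := hv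
        have hlt : G.saturatedCard b.flow < _ := hlt
        exact Or.inr ((hor.resolve_left fun hn => hn v hv).trans_lt hlt))
  refine ⟨h1, h2, h3.elim id fun hcard => ?_⟩
  exact FlowNet.not_cyclic_of_saturatedCard (h.len ▸ hcard)

/-! ### Clearing states as ranked payments with retained funds -/

namespace Network

variable {V E : Type*} [Fintype E] [DecidableEq V] (N : Network V E)

/-- Total payments of bank `b`. -/
def paid (p : E → ℝ) (b : V) : ℝ := ∑ e with N.debtor e = b, p e

/-- Payments within the liabilities that go to an edge only when all edges ranked above it are
saturated; a bank pays no more than its total assets, and less only if all its edges are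
saturated. -/
structure IsGreedy (p : E → ℝ) : Prop where
  nonneg : ∀ e, 0 ≤ p e
  le_liab : ∀ e, p e ≤ N.liab e
  saturated : ∀ e e', N.debtor e = N.debtor e' → N.rank e' < N.rank e → 0 < p e →
    (N.liab e' : ℝ) ≤ p e'
  paid_le : ∀ b, N.paid p b ≤ N.assetsOf p b
  retain : ∀ e, N.paid p (N.debtor e) < N.assetsOf p (N.debtor e) → (N.liab e : ℝ) ≤ p e

variable {N} {p : E → ℝ}

theorem paid_eq [DecidableEq E] (e : E)
    (hinj : ∀ e e', N.debtor e = N.debtor e' → N.rank e = N.rank e' → e = e') :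
    N.paid p (N.debtor e) = ∑ e' with N.debtor e' = N.debtor e ∧ N.rank e' < N.rank e, p e' + p e +
      ∑ e' with N.debtor e' = N.debtor e ∧ N.rank e < N.rank e', p e' := by
  have h1 := sum_filter_add_sum_filter_not (univ.filter fun e' => N.debtor e' = N.debtor e)
    (fun e' => N.rank e' < N.rank e) p
  have h2 := sum_filter_add_sum_filter_not
    ((univ.filter fun e' => N.debtor e' = N.debtor e).filter fun e' => ¬ N.rank e' < N.rank e)
    (fun e' => N.rank e < N.rank e') p
  have h3 : (((univ.filter fun e' => N.debtor e' = N.debtor e).filter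
      fun e' => ¬ N.rank e' < N.rank e).filter fun e' => ¬ N.rank e < N.rank e') = {e} := by
    ext e'
    simp only [mem_filter, mem_univ, true_and, mem_singleton]
    constructor
    · rintro ⟨⟨h, h'⟩, h''⟩
      exact hinj _ _ h (by omega)
    · rintro rfl
      simp
  rw [h3, sum_singleton] at h2
  rw [paid, ← h1, ← h2]
  simp only [filter_filter]
  rw [add_assoc, add_comm (p e)]
  congr 3
  ext e'
  simp only [mem_filter, mem_univ, true_and]
  constructor
  · rintro ⟨⟨h, -⟩, h'⟩; exact ⟨h, h'⟩
  · rintro ⟨h, h'⟩; exact ⟨⟨h, by omega⟩, h'⟩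

theorem sum_above_eq (hle : ∀ e, p e ≤ N.liab e) (e : E)
    (h : ∀ e', N.debtor e' = N.debtor e → N.rank e' < N.rank e → (N.liab e' : ℝ) ≤ p e') :
    ∑ e' with N.debtor e' = N.debtor e ∧ N.rank e' < N.rank e, p e' = N.liabAbove e := by
  rw [liabAbove, Nat.cast_sum]
  refine sum_congr rfl fun e' he' => ?_
  simp only [mem_filter, mem_univ, true_and] at he'
  exact le_antisymm (hle e') (h e' he'.1 he'.2)

theorem liabAbove_add_le {e e' : E} (h : N.debtor e' = N.debtor e) (hr : N.rank e' < N.rank e) :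
    N.liabAbove e' + N.liab e' ≤ N.liabAbove e := by
  classical
  rw [liabAbove, liabAbove, add_comm, ← sum_insert (f := N.liab) (a := e') (by simp)]
  refine sum_le_sum_of_subset fun f hf => ?_
  simp only [mem_insert, mem_filter, mem_univ, true_and] at hf ⊢
  rcases hf with rfl | ⟨h1, h2⟩
  · exact ⟨h, hr⟩
  · exact ⟨h1.trans h, h2.trans hr⟩

/-- Clearing states are greedy. The condition `hassets` is needed as a bank with negative assets
pays `0`, which is more than it has. -/
theorem IsClearing.isGreedy (hp : N.IsClearing p)
    (hinj : ∀ e e', N.debtor e = N.debtor e' → N.rank e = N.rank e' → e = e')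
    (hassets : ∀ b, 0 ≤ N.assetsOf p b) : N.IsGreedy p := by
  classical
  have hnonneg : ∀ e, 0 ≤ p e := fun e => by rw [hp e]; exact (N.pay_mem _ _).1
  have hle : ∀ e, p e ≤ N.liab e := fun e => by rw [hp e]; exact (N.pay_mem _ _).2
  have hpos : ∀ e, 0 < p e → p e ≤ N.assetsOf p (N.debtor e) - N.liabAbove e := by
    intro e he
    rw [hp e, pay, lt_min_iff, lt_max_iff] at he
    have h := he.2.resolve_left (lt_irrefl _)
    have h2 := hp e
    rw [pay, max_eq_right h.le] at h2
    rw [h2]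
    exact min_le_right _ _
  have hsat : ∀ e e', N.debtor e = N.debtor e' → N.rank e' < N.rank e → 0 < p e →
      (N.liab e' : ℝ) ≤ p e' := by
    intro e e' hd hr he
    have h1 := hpos e he
    have h2 : ((N.liabAbove e' + N.liab e' : ℕ) : ℝ) ≤ N.liabAbove e :=
      Nat.cast_le.2 (liabAbove_add_le hd.symm hr)
    push_cast at h2
    rw [hp e', pay, ← hd]
    refine le_min le_rfl (le_max_of_le_right ?_)
    linarith
  refine ⟨hnonneg, hle, hsat, fun b => ?_, fun e hlt => ?_⟩
  · by_cases hex : ∃ e, N.debtor e = b ∧ 0 < p e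
    · obtain ⟨e0, he0⟩ := hex
      obtain ⟨e, he, hmax⟩ := exists_max_image (univ.filter fun e => N.debtor e = b ∧ 0 < p e)
        N.rank ⟨e0, by simpa using he0⟩
      simp only [mem_filter, mem_univ, true_and] at he hmax
      obtain ⟨rfl, he⟩ := he
      rw [paid_eq e hinj, sum_above_eq hle e fun e' h h' => hsat e e' h.symm h' he]
      have hlow : ∑ e' with N.debtor e' = N.debtor e ∧ N.rank e < N.rank e', p e' ≤ 0 := by
        refine sum_nonpos fun e' he' => ?_
        simp only [mem_filter, mem_univ, true_and] at he'
        by_contra! hc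
        exact absurd (hmax e' ⟨he'.1, hc⟩) (not_le.2 he'.2)
      linarith [hpos e he]
    · push Not at hex
      refine le_trans (sum_nonpos fun e he => hex e ?_) (hassets b)
      simpa using he
  · by_contra! hc
    obtain ⟨e0, he0, hmin⟩ := exists_min_image
      (univ.filter fun e' => N.debtor e' = N.debtor e ∧ p e' < N.liab e') N.rank
      ⟨e, by simpa using hc⟩
    simp only [mem_filter, mem_univ, true_and] at he0 hmin
    rw [← he0.1] at hlt
    rw [paid_eq e0 hinj, sum_above_eq hle e0 fun e' h h' => by
      by_contra! hc
      exact absurd (hmin e' ⟨h.trans he0.1, hc⟩) (not_le.2 h')] at hlt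
    have hlow : 0 ≤ ∑ e' with N.debtor e' = N.debtor e0 ∧ N.rank e0 < N.rank e', p e' :=
      sum_nonneg fun e' _ => hnonneg e'
    have h1 := hp e0
    rw [pay, min_def] at h1
    split_ifs at h1
    · linarith [he0.2]
    · linarith [le_max_right (0 : ℝ) (N.assetsOf p (N.debtor e0) - N.liabAbove e0)]

/-- Greedy payments are clearing states: on an edge that is not saturated the debtor spends exactly
what the edges ranked above it leave over, as edges ranked below get nothing and nothing is
retained. -/
theorem IsGreedy.isClearing (hp : N.IsGreedy p)
    (hinj : ∀ e e', N.debtor e = N.debtor e' → N.rank e = N.rank e' → e = e')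
    (hliab : ∀ e, 0 < N.liab e) : N.IsClearing p := by
  classical
  intro e
  have hl : (0 : ℝ) < N.liab e := Nat.cast_pos.2 (hliab e)
  have hpaid := paid_eq (p := p) e hinj
  have habove_le : ∑ e' with N.debtor e' = N.debtor e ∧ N.rank e' < N.rank e, p e' ≤
      N.liabAbove e := by
    rw [liabAbove, Nat.cast_sum]
    exact sum_le_sum fun e' _ => hp.le_liab e'
  have hbelow_nonneg : 0 ≤ ∑ e' with N.debtor e' = N.debtor e ∧ N.rank e < N.rank e', p e' :=
    sum_nonneg fun e' _ => hp.nonneg e'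
  have hbelow : p e < N.liab e →
      ∑ e' with N.debtor e' = N.debtor e ∧ N.rank e < N.rank e', p e' ≤ 0 := by
    intro hlt
    refine sum_nonpos fun e' he' => ?_
    simp only [mem_filter, mem_univ, true_and] at he'
    by_contra! hc
    exact absurd (hp.saturated e' e he'.1 he'.2 hc) (not_le.2 hlt)
  have hall : p e < N.liab e → N.assetsOf p (N.debtor e) ≤ N.paid p (N.debtor e) := fun hlt =>
    not_lt.1 fun h => absurd (hp.retain e h) (not_le.2 hlt)
  have hle := hp.paid_le (N.debtor e)
  rw [pay]
  rcases (hp.nonneg e).eq_or_lt with h0 | hpos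
  · have h1 := hbelow (by linarith)
    have h2 := hall (by linarith)
    rw [max_eq_left (by linarith), min_eq_right hl.le, h0]
  · have habove := sum_above_eq hp.le_liab e fun e' h h' => hp.saturated e e' h.symm h' hpos
    rcases (hp.le_liab e).eq_or_lt with heq | hlt
    · rw [min_eq_left (le_max_of_le_right (by linarith)), heq]
    · have h1 := hbelow hlt
      have h2 := hall hlt
      rw [show N.assetsOf p (N.debtor e) - N.liabAbove e = p e by linarith,
        max_eq_right hpos.le, min_eq_right hlt.le]

theorem clearing_eq (h : IsGreatest {p | N.IsClearing p} p) : N.clearing = p :=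
  N.clearing_spec.unique h

end Network

/-! ### Networks of a trade as flow networks -/

namespace TradeInstance

variable (I : TradeInstance)

/-- The change of external assets when `γ` is paid by the buyer to the creditor of the claim. -/
def shift (γ : ℝ) (b : Fin I.n) : ℝ :=
  (if b = I.creditor I.claim then γ else 0) - (if b = I.buyer then γ else 0)

/-- The network with creditors `cr` after a payment of `γ` from the buyer to the original creditor
of the claim. -/
def shifted (cr : Fin I.m → Fin I.n) (γ : ℝ) : Network (Fin I.n) (Fin I.m) where
  debtor := I.debtor
  creditor := cr
  liab := I.liab
  rank := I.rank
  ext := fun b => (I.ext b : ℝ) + I.shift γ b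

/-- Creditors after the trade. -/
def newCreditor : Fin I.m → Fin I.n := Function.update I.creditor I.claim I.buyer

theorem shifted_creditor_zero : I.shifted I.creditor 0 = I.network := by
  simp [shifted, network, shift]

theorem shifted_newCreditor (α : ℝ) :
    I.shifted I.newCreditor (α * I.liab I.claim) = I.network.trade I.claim I.buyer α := by
  unfold shifted newCreditor Network.trade
  congr 1
  funext b
  exact (add_sub_assoc _ _ _).symm

theorem assetsOf_shifted (cr : Fin I.m → Fin I.n) (γ : ℝ) (p : Fin I.m → ℝ) (b : Fin I.n) :
    (I.shifted cr γ).assetsOf p b = I.ext b + I.shift γ b + ∑ e with cr e = b, p e := rfl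

theorem paid_shifted (cr : Fin I.m → Fin I.n) (γ : ℝ) (p : Fin I.m → ℝ) (b : Fin I.n) :
    (I.shifted cr γ).paid p b = ∑ e with I.debtor e = b, p e := rfl

/-- The part common to the flow networks before and after the trade. The edges `0, …, m - 1` are
the claims. A super source `n` supplies every bank `b` with its external assets through the edge
`m + b`, and takes the funds that `b` retains, as its last choice, through the edge `m + n + b`,
which can never be saturated. -/
structure IsClaimNet (cr : Fin I.m → Fin I.n) (G : FlowNet) : Prop where
  banks : G.banks = I.n
  src_claim : ∀ e : Fin I.m, G.src e = I.debtor e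
  dst_claim : ∀ e : Fin I.m, G.dst e = cr e
  cap_claim : ∀ e : Fin I.m, G.cap e = I.liab e
  prio_claim : ∀ e : Fin I.m, G.prio e = I.rank e
  src_source : ∀ b : Fin I.n, G.src (I.m + b) = I.n
  dst_source : ∀ b : Fin I.n, G.dst (I.m + b) = b
  cap_source : ∀ b : Fin I.n, G.cap (I.m + b) = I.ext b
  prio_source : ∀ b : Fin I.n, G.prio (I.m + b) = b
  src_sink : ∀ b : Fin I.n, G.src (I.m + I.n + b) = b
  dst_sink : ∀ b : Fin I.n, G.dst (I.m + I.n + b) = I.n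
  cap_sink : ∀ b : Fin I.n, G.cap (I.m + I.n + b) = ∑ b, I.ext b + ∑ e, (I.liab e + I.liab e) + 1
  prio_sink : ∀ b : Fin I.n, G.prio (I.m + I.n + b) = I.m

variable {I}

theorem rank_lt_m (e : Fin I.m) : I.rank e < I.m :=
  (I.rank_lt e).trans_le ((Fintype.card_subtype_le _).trans (Fintype.card_fin _).le)

theorem edge_cases {f : ℕ} (hf : f < I.m + I.n + I.n) :
    (∃ e : Fin I.m, f = e) ∨ (∃ b : Fin I.n, f = I.m + b) ∨ ∃ b : Fin I.n, f = I.m + I.n + b := by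
  by_cases h1 : f < I.m
  · exact Or.inl ⟨⟨f, h1⟩, rfl⟩
  · by_cases h2 : f < I.m + I.n
    · exact Or.inr (Or.inl ⟨⟨f - I.m, by omega⟩, by simp; omega⟩)
    · exact Or.inr (Or.inr ⟨⟨f - (I.m + I.n), by omega⟩, by simp; omega⟩)

theorem sum_edges (key : ℕ → ℕ) (b : ℕ) (y : ℕ → ℝ) :
    ∑ f ∈ range (I.m + I.n + I.n) with key f = b, y f =
      ∑ e ∈ univ.filter (fun e : Fin I.m => key e = b), y e +
        ∑ i ∈ univ.filter (fun i : Fin I.n => key (I.m + i) = b), y (I.m + i) +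
        ∑ i ∈ univ.filter (fun i : Fin I.n => key (I.m + I.n + i) = b), y (I.m + I.n + i) := by
  simp only [sum_filter]
  rw [sum_range, Fin.sum_univ_add, Fin.sum_univ_add]
  simp

namespace IsClaimNet

variable {cr : Fin I.m → Fin I.n} {G : FlowNet} {y : ℕ → ℝ}

theorem outflow_eq (H : I.IsClaimNet cr G) (hE : G.edges = I.m + I.n + I.n) (b : Fin I.n) :
    G.outflow y b = ∑ e : Fin I.m with I.debtor e = b, y e + y (I.m + I.n + b) := by
  have hb : ¬ I.n = (b : ℕ) := by omega
  rw [FlowNet.outflow, hE, sum_edges]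
  simp only [H.src_claim, H.src_source, H.src_sink, hb, Fin.val_inj]
  simp [sum_filter]

theorem inflow_eq (H : I.IsClaimNet cr G) (hE : G.edges = I.m + I.n + I.n) (b : Fin I.n) :
    G.inflow y b = ∑ e : Fin I.m with cr e = b, y e + y (I.m + b) := by
  have hb : ¬ I.n = (b : ℕ) := by omega
  rw [FlowNet.inflow, hE, sum_edges]
  simp only [H.dst_claim, H.dst_source, H.dst_sink, hb, Fin.val_inj]
  simp [sum_filter]

/-- A ranked flow that exhausts the sources is a clearing state on the claims. -/
theorem isClearing (H : I.IsClaimNet cr G) (hE : G.edges = I.m + I.n + I.n) {γ : ℝ}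
    (hy : G.IsRanked y) (hsource : ∀ b : Fin I.n, y (I.m + b) = I.ext b)
    (hcons : ∀ b : Fin I.n, G.outflow y b = G.inflow y b + I.shift γ b) :
    (I.shifted cr γ).IsClearing (fun e => y e) ∧
      ∀ b : Fin I.n, (I.shifted cr γ).assetsOf (fun e => y e) b = G.outflow y b := by
  have hassets : ∀ b : Fin I.n, (I.shifted cr γ).assetsOf (fun e => y e) b = G.outflow y b := by
    intro b
    rw [hcons, H.inflow_eq hE, hsource]
    rw [assetsOf_shifted]
    ring
  have hpaid : ∀ b : Fin I.n, (I.shifted cr γ).paid (fun e => y e) b + y (I.m + I.n + b) =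
      G.outflow y b := fun b => (H.outflow_eq hE b).symm
  have hlt : ∀ e : Fin I.m, (e : ℕ) < G.edges := fun e => by omega
  refine ⟨Network.IsGreedy.isClearing ⟨fun e => hy.nonneg e (hlt e), fun e => ?_,
    fun e e' hd hr hpos => ?_, fun b => ?_, fun e hret => ?_⟩ I.rank_inj I.liab_pos, hassets⟩
  · have := hy.le_cap e (hlt e)
    rwa [H.cap_claim] at this
  · have := hy.saturated e (hlt e) e' (hlt e')
      (by rw [H.src_claim, H.src_claim]; exact congrArg _ hd)
      (by rw [H.prio_claim, H.prio_claim]; exact hr) hpos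
    rwa [H.cap_claim] at this
  · rw [hassets, ← hpaid]
    linarith [hy.nonneg (I.m + I.n + b) (by omega)]
  · rw [hassets, ← hpaid] at hret
    have := hy.saturated (I.m + I.n + I.debtor e) (by omega) e (hlt e)
      (by rw [H.src_claim, H.src_sink]) (by rw [H.prio_claim, H.prio_sink]; exact rank_lt_m e)
      (by change 0 < y (I.m + I.n + ((I.shifted cr γ).debtor e : ℕ)); linarith)
    rwa [H.cap_claim] at this

end IsClaimNet

/-- The flow of a clearing state `p`: payments on the claims, external assets on the sources,
retained funds on the sinks, and `γ` on the edge after these. -/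
noncomputable def flowOf (I : TradeInstance) (cr : Fin I.m → Fin I.n) (γ : ℝ) (p : Fin I.m → ℝ)
    (f : ℕ) : ℝ :=
  if h : f < I.m then p ⟨f, h⟩ else if h : f - I.m < I.n then I.ext ⟨f - I.m, h⟩ else
    if h : f - (I.m + I.n) < I.n then
      (I.shifted cr γ).assetsOf p ⟨f - (I.m + I.n), h⟩ -
        (I.shifted cr γ).paid p ⟨f - (I.m + I.n), h⟩
    else γ

section flowOf

variable {cr : Fin I.m → Fin I.n} {γ : ℝ} {p : Fin I.m → ℝ}

theorem flowOf_claim (e : Fin I.m) : I.flowOf cr γ p e = p e := by simp [flowOf]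

theorem flowOf_source (b : Fin I.n) : I.flowOf cr γ p (I.m + b) = I.ext b := by simp [flowOf]

theorem flowOf_sink (b : Fin I.n) : I.flowOf cr γ p (I.m + I.n + b) =
    (I.shifted cr γ).assetsOf p b - (I.shifted cr γ).paid p b := by
  have h1 : ¬ I.m + I.n + b < I.m := by omega
  have h2 : ¬ I.m + I.n + b - I.m < I.n := by omega
  simp [flowOf, h1, h2]

theorem flowOf_extra : I.flowOf cr γ p (I.m + I.n + I.n) = γ := by
  have h1 : ¬ I.m + I.n + I.n < I.m := by omega
  have h2 : ¬ I.m + I.n + I.n - I.m < I.n := by omega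
  simp [flowOf, h1, h2]

end flowOf

/-- Clearing states are ranked flows, conserved up to the payment of `γ`. The bounds on `γ` keep the
assets nonnegative and below the capacity of the sinks. -/
theorem IsClaimNet.flowOf_isRanked {cr : Fin I.m → Fin I.n} {G : FlowNet} {γ : ℝ} {p : Fin I.m → ℝ}
    (H : I.IsClaimNet cr G) (hE : G.edges = I.m + I.n + I.n) (hp : (I.shifted cr γ).IsClearing p)
    (h0 : 0 ≤ γ) (hw : γ ≤ I.ext I.buyer) (hl : γ ≤ I.liab I.claim) :
    G.IsRanked (I.flowOf cr γ p) ∧ ∀ b : Fin I.n,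
      G.outflow (I.flowOf cr γ p) b = (I.shifted cr γ).assetsOf p b ∧
      G.outflow (I.flowOf cr γ p) b = G.inflow (I.flowOf cr γ p) b + I.shift γ b := by
  have hpmem : ∀ e, p e ∈ Set.Icc (0 : ℝ) (I.liab e) := fun e => by
    rw [hp e]; exact (I.shifted cr γ).pay_mem _ _
  have hext : ∀ b, 0 ≤ (I.ext b : ℝ) + I.shift γ b := by
    intro b
    have hb : (0 : ℝ) ≤ I.ext b := Nat.cast_nonneg _
    rw [shift]
    by_cases h : b = I.buyer
    · subst h
      split_ifs <;> linarith
    · split_ifs <;> linarith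
  have hassets0 : ∀ b, 0 ≤ (I.shifted cr γ).assetsOf p b := fun b =>
    add_nonneg (hext b) (sum_nonneg fun e _ => (hpmem e).1)
  have hg := hp.isGreedy I.rank_inj hassets0
  have hassets_le : ∀ b, (I.shifted cr γ).assetsOf p b ≤
      ((∑ b, I.ext b + ∑ e, (I.liab e + I.liab e) + 1 : ℕ) : ℝ) := by
    intro b
    push_cast
    rw [sum_add_distrib]
    have h1 : (I.ext b : ℝ) ≤ ∑ b, (I.ext b : ℝ) :=
      single_le_sum (f := fun b => (I.ext b : ℝ)) (fun _ _ => Nat.cast_nonneg _) (mem_univ b)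
    have h2 : I.shift γ b ≤ ∑ e, (I.liab e : ℝ) := by
      have h3 : (I.liab I.claim : ℝ) ≤ ∑ e, (I.liab e : ℝ) :=
        single_le_sum (f := fun e => (I.liab e : ℝ)) (fun _ _ => Nat.cast_nonneg _) (mem_univ _)
      rw [shift]
      split_ifs <;> linarith
    have h3 : ∑ e with cr e = b, p e ≤ ∑ e, (I.liab e : ℝ) :=
      (sum_le_sum_of_subset_of_nonneg (filter_subset _ _) fun e _ _ => (hpmem e).1).trans
        (sum_le_sum fun e _ => (hpmem e).2)
    rw [assetsOf_shifted]
    linarith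
  refine ⟨⟨fun f hf => ?_, fun f hf => ?_, fun f hf f' hf' => ?_⟩, fun b => ?_⟩
  · rw [hE] at hf
    obtain ⟨e, rfl⟩ | ⟨b, rfl⟩ | ⟨b, rfl⟩ := edge_cases hf
    · rw [flowOf_claim]; exact hg.nonneg e
    · rw [flowOf_source]; exact Nat.cast_nonneg _
    · rw [flowOf_sink]; linarith [hg.paid_le b]
  · rw [hE] at hf
    obtain ⟨e, rfl⟩ | ⟨b, rfl⟩ | ⟨b, rfl⟩ := edge_cases hf
    · rw [flowOf_claim, H.cap_claim]; exact hg.le_liab e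
    · rw [flowOf_source, H.cap_source]
    · rw [flowOf_sink, H.cap_sink]
      have : 0 ≤ (I.shifted cr γ).paid p b := sum_nonneg fun e _ => (hpmem e).1
      linarith [hassets_le b]
  · rw [hE] at hf hf'
    obtain ⟨e, rfl⟩ | ⟨b, rfl⟩ | ⟨b, rfl⟩ := edge_cases hf <;>
    obtain ⟨e', rfl⟩ | ⟨b', rfl⟩ | ⟨b', rfl⟩ := edge_cases hf' <;>
    simp only [H.src_claim, H.src_source, H.src_sink, H.prio_claim, H.prio_source, H.prio_sink,
      H.cap_claim, H.cap_source, flowOf_claim, flowOf_source, flowOf_sink] <;> intro hs hr hpos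
    · exact hg.saturated e e' (Fin.ext hs) hr hpos
    · exact absurd (I.debtor e).2 (by omega)
    · exact absurd (rank_lt_m e) (by omega)
    · exact absurd (I.debtor e').2 (by omega)
    · exact le_rfl
    · exact absurd b'.2 (by omega)
    · refine hg.retain e' ?_
      have : (I.shifted cr γ).debtor e' = b := Fin.ext hs.symm
      rw [this]
      linarith
    · exact absurd b.2 (by omega)
    · omega
  · rw [H.outflow_eq hE, H.inflow_eq hE, flowOf_source, flowOf_sink]
    simp only [flowOf_claim]
    constructor
    · rw [paid_shifted]
      ring
    · rw [paid_shifted, assetsOf_shifted]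
      ring

end TradeInstance

/-! ### Optimal haircut rates from maximal flows -/

theorem FlowNet.outflow_congr {G G' : FlowNet} {y y' : ℕ → ℝ} (hE : G'.edges = G.edges)
    (hs : ∀ f < G.edges, G'.src f = G.src f) (hy : ∀ f < G.edges, y' f = y f) (b : ℕ) :
    G'.outflow y' b = G.outflow y b := by
  rw [outflow, outflow, hE]
  refine sum_congr (filter_congr fun f hf => by rw [hs f (mem_range.1 hf)]) fun f hf => ?_
  simp only [mem_filter, mem_range] at hf
  exact hy f hf.1

theorem FlowNet.inflow_congr {G G' : FlowNet} {y y' : ℕ → ℝ} (hE : G'.edges = G.edges)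
    (hs : ∀ f < G.edges, G'.dst f = G.dst f) (hy : ∀ f < G.edges, y' f = y f) (b : ℕ) :
    G'.inflow y' b = G.inflow y b := by
  rw [inflow, inflow, hE]
  refine sum_congr (filter_congr fun f hf => by rw [hs f (mem_range.1 hf)]) fun f hf => ?_
  simp only [mem_filter, mem_range] at hf
  exact hy f hf.1

theorem FlowNet.outflow_succ (G : FlowNet) (y : ℕ → ℝ) (k b : ℕ) :
    ({ G with edges := k + 1 } : FlowNet).outflow y b =
      ({ G with edges := k } : FlowNet).outflow y b + if G.src k = b then y k else 0 := by
  simp only [outflow, sum_filter, sum_range_succ]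

theorem FlowNet.inflow_succ (G : FlowNet) (y : ℕ → ℝ) (k b : ℕ) :
    ({ G with edges := k + 1 } : FlowNet).inflow y b =
      ({ G with edges := k } : FlowNet).inflow y b + if G.dst k = b then y k else 0 := by
  simp only [inflow, sum_filter, sum_range_succ]

namespace TradeInstance

variable {I : TradeInstance}

theorem IsClaimNet.wellFormed {cr : Fin I.m → Fin I.n} {G : FlowNet} (H : I.IsClaimNet cr G)
    (hE : G.edges = I.m + I.n + I.n) : G.WellFormed := by
  have hn := I.buyer.2
  have hm := I.claim.2
  refine ⟨fun f hf => ?_, fun f hf => ?_, fun f hf f' hf' => ?_⟩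
  · rw [hE] at hf ⊢
    obtain ⟨e, rfl⟩ | ⟨b, rfl⟩ | ⟨b, rfl⟩ := edge_cases hf
    · rw [H.src_claim]; omega
    · rw [H.src_source]; omega
    · rw [H.src_sink]; omega
  · rw [hE] at hf ⊢
    obtain ⟨e, rfl⟩ | ⟨b, rfl⟩ | ⟨b, rfl⟩ := edge_cases hf
    · rw [H.dst_claim]; omega
    · rw [H.dst_source]; omega
    · rw [H.dst_sink]; omega
  · rw [hE] at hf hf'
    obtain ⟨e, rfl⟩ | ⟨b, rfl⟩ | ⟨b, rfl⟩ := edge_cases hf <;>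
    obtain ⟨e', rfl⟩ | ⟨b', rfl⟩ | ⟨b', rfl⟩ := edge_cases hf' <;>
    simp only [H.src_claim, H.src_source, H.src_sink, H.prio_claim, H.prio_source, H.prio_sink] <;>
    intro hs hr
    · exact congrArg _ (I.rank_inj e e' (Fin.ext hs) hr)
    · omega
    · exact absurd (rank_lt_m e) (by omega)
    · omega
    · omega
    · omega
    · exact absurd (rank_lt_m e') (by omega)
    · omega
    · omega

variable (I)

/-- The flow network before the trade. Its last edge, along which the buyer pays the return to the
creditor, is still closed. -/
structure IsInitialNet (G : FlowNet) : Prop extends I.IsClaimNet I.creditor G where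
  edges : G.edges = I.m + I.n + I.n + 1
  src_extra : G.src (I.m + I.n + I.n) = I.buyer
  dst_extra : G.dst (I.m + I.n + I.n) = I.creditor I.claim
  cap_extra : G.cap (I.m + I.n + I.n) = 0
  prio_extra : G.prio (I.m + I.n + I.n) = I.m + 1

/-- The flow network after the trade, relative to the flow `x` before it. The payments of the buyer
are frozen, and whatever it receives in addition goes to the former creditor as return; this return
is at least the present payment on the claim, and is bounded by the liability of the claim and the
external assets of the buyer. -/
structure IsTradeNet (G : FlowNet) (x : ℕ → ℝ) (G' : FlowNet) : Prop where
  edges : G'.edges = G.edges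
  banks : G'.banks = G.banks
  src : ∀ f < G.edges, G'.src f = G.src f
  dst : ∀ f < G.edges, G'.dst f = if f = I.claim then (I.buyer : ℕ) else G.dst f
  cap : ∀ f < I.m + I.n + I.n, (G'.cap f : ℝ) = if G.src f = I.buyer then x f else (G.cap f : ℝ)
  cap_extra : (G'.cap (I.m + I.n + I.n) : ℝ) =
    max (min (I.liab I.claim : ℝ) (I.ext I.buyer)) (x I.claim)
  prio : ∀ f < G.edges, G'.prio f = G.prio f

/-- The network `G` on its claims, sources and sinks only, with the heads `dst`. -/
def core (G : FlowNet) (dst : ℕ → ℕ) : FlowNet :=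
  { G with edges := I.m + I.n + I.n, dst := dst }

variable {I} {G G' : FlowNet} {x y z : ℕ → ℝ}

namespace IsInitialNet

theorem core_isClaimNet (H : I.IsInitialNet G) : I.IsClaimNet I.creditor (I.core G G.dst) :=
  ⟨H.banks, H.src_claim, H.dst_claim, H.cap_claim, H.prio_claim, H.src_source, H.dst_source,
    H.cap_source, H.prio_source, H.src_sink, H.dst_sink, H.cap_sink, H.prio_sink⟩

theorem core_newCreditor_isClaimNet (H : I.IsInitialNet G) (T : I.IsTradeNet G x G') :
    I.IsClaimNet I.newCreditor (I.core G G'.dst) := by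
  have hE := H.edges
  refine ⟨H.banks, H.src_claim, fun e => ?_, H.cap_claim, H.prio_claim, H.src_source, fun b => ?_,
    H.cap_source, H.prio_source, H.src_sink, fun b => ?_, H.cap_sink, H.prio_sink⟩
  · change G'.dst e = _
    rw [T.dst e (by omega), newCreditor, Function.update_apply]
    simp only [Fin.val_inj]
    split_ifs
    · rfl
    · exact H.dst_claim e
  · change G'.dst _ = _
    rw [T.dst _ (by omega), if_neg (by omega), H.dst_source]
  · change G'.dst _ = _
    rw [T.dst _ (by omega), if_neg (by omega), H.dst_sink]

theorem wellFormed (H : I.IsInitialNet G) : G.WellFormed := by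
  have h := H.core_isClaimNet.wellFormed rfl
  have hE := H.edges
  have hlast : ∀ f < G.edges, f < I.m + I.n + I.n ∨ f = I.m + I.n + I.n := fun f hf => by omega
  have hprio : ∀ f < I.m + I.n + I.n, G.src f = I.buyer → G.prio f ≤ I.m := by
    intro f hf hs
    obtain ⟨e, rfl⟩ | ⟨b, rfl⟩ | ⟨b, rfl⟩ := edge_cases hf
    · rw [H.prio_claim]; exact (rank_lt_m e).le
    · rw [H.src_source] at hs; omega
    · rw [H.prio_sink]
  refine ⟨fun f hf => ?_, fun f hf => ?_, fun f hf f' hf' hs hp => ?_⟩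
  · rcases hlast f hf with hf | rfl
    · have : G.src f < I.m + I.n + I.n := h.src_lt f hf
      omega
    · rw [H.src_extra]; omega
  · rcases hlast f hf with hf | rfl
    · have : G.dst f < I.m + I.n + I.n := h.dst_lt f hf
      omega
    · rw [H.dst_extra]; omega
  · rcases hlast f hf with hf | rfl <;> rcases hlast f' hf' with hf' | rfl
    · exact h.prio_inj f hf f' hf' hs hp
    · have := hprio f hf (hs.trans H.src_extra)
      rw [H.prio_extra] at hp
      omega
    · have := hprio f' hf' (hs.symm.trans H.src_extra)
      rw [H.prio_extra] at hp
      omega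
    · rfl

theorem outflow_eq (H : I.IsInitialNet G) (d : ℕ → ℕ) (b : ℕ) :
    G.outflow y b = (I.core G d).outflow y b +
      if (I.buyer : ℕ) = b then y (I.m + I.n + I.n) else 0 := by
  have h := G.outflow_succ y (I.m + I.n + I.n) b
  rw [H.src_extra, ← H.edges] at h
  exact h

theorem inflow_eq (H : I.IsInitialNet G) (b : ℕ) :
    G.inflow y b = (I.core G G.dst).inflow y b +
      if (I.creditor I.claim : ℕ) = b then y (I.m + I.n + I.n) else 0 := by
  have h := G.inflow_succ y (I.m + I.n + I.n) b
  rw [H.dst_extra, ← H.edges] at h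
  exact h

theorem extra_eq_zero (H : I.IsInitialNet G) (hx : G.IsFlow x) : x (I.m + I.n + I.n) = 0 := by
  have hE := H.edges
  have h1 := hx.le_cap (I.m + I.n + I.n) (by omega)
  rw [H.cap_extra] at h1
  exact le_antisymm (by simpa using h1) (hx.nonneg _ (by omega))

theorem core_isRanked (H : I.IsInitialNet G) (hx : G.IsFlow x) (d : ℕ → ℕ) :
    (I.core G d).IsRanked x := by
  have hE := H.edges
  have hlt : ∀ f < I.m + I.n + I.n, f < G.edges := fun f hf => by omega
  exact ⟨fun f hf => hx.nonneg f (hlt f hf), fun f hf => hx.le_cap f (hlt f hf),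
    fun f hf f' hf' => hx.saturated f (hlt f hf) f' (hlt f' hf')⟩

theorem core_conserved (H : I.IsInitialNet G) (hx : G.IsFlow x) (b : Fin I.n) :
    (I.core G G.dst).outflow x b = (I.core G G.dst).inflow x b := by
  have h := hx.conserved b (by rw [H.banks]; exact b.2)
  rw [H.outflow_eq G.dst, H.inflow_eq, H.extra_eq_zero hx] at h
  simpa using h

/-- Without cycles of active edges the external assets of all banks are in use: retained funds have
somewhere to go, so otherwise the super source could still be drained. -/
theorem source_eq (H : I.IsInitialNet G) (hx : G.IsFlow x) (hterm : ∀ b, ¬ G.Cyclic x b)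
    (b : Fin I.n) : x (I.m + b) = I.ext b := by
  have hE := H.edges
  have hle := hx.le_cap (I.m + b) (by omega)
  rw [H.cap_source] at hle
  refine hle.antisymm (not_lt.1 fun hlt => hterm I.n ⟨{v | v ≤ I.n}, fun v hv => ?_, le_refl I.n⟩)
  have hdst : ∀ f < G.edges, G.dst f ≤ I.n := by
    intro f hf
    rcases (show f < I.m + I.n + I.n ∨ f = I.m + I.n + I.n by omega) with hf | rfl
    · obtain ⟨e, rfl⟩ | ⟨b, rfl⟩ | ⟨b, rfl⟩ := edge_cases hf
      · rw [H.dst_claim]; omega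
      · rw [H.dst_source]; omega
      · rw [H.dst_sink]
    · rw [H.dst_extra]; omega
  suffices hf : ∃ f < G.edges, G.src f = v ∧ x f < G.cap f by
    obtain ⟨f, hf, rfl, hxf⟩ := hf
    obtain ⟨a, has, ha⟩ := FlowNet.exists_isActive hf hxf
    exact ⟨a, has, ha, hdst a ha.1⟩
  rcases Nat.lt_or_eq_of_le hv with hv | rfl
  · refine ⟨I.m + I.n + v, by omega, H.src_sink ⟨v, hv⟩, ?_⟩
    have hout := H.core_isClaimNet.outflow_eq (y := x) rfl ⟨v, hv⟩
    have hin := H.core_isClaimNet.inflow_eq (y := x) rfl ⟨v, hv⟩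
    rw [H.core_conserved hx ⟨v, hv⟩] at hout
    have hv1 := hx.le_cap (I.m + v) (by omega)
    rw [H.cap_source ⟨v, hv⟩] at hv1
    have h1 : (I.ext ⟨v, hv⟩ : ℝ) ≤ ∑ b, (I.ext b : ℝ) :=
      single_le_sum (f := fun b => (I.ext b : ℝ)) (fun _ _ => Nat.cast_nonneg _) (mem_univ _)
    have h2 : ∑ e : Fin I.m with I.creditor e = ⟨v, hv⟩, x e ≤ ∑ e, (I.liab e : ℝ) :=
      (sum_le_sum_of_subset_of_nonneg (filter_subset _ _)
        fun (e : Fin I.m) _ _ => hx.nonneg e (by omega)).trans (sum_le_sum fun (e : Fin I.m) _ => by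
          have := hx.le_cap e (by omega)
          rwa [H.cap_claim] at this)
    have h3 : 0 ≤ ∑ e : Fin I.m with I.debtor e = ⟨v, hv⟩, x e :=
      sum_nonneg fun e _ => hx.nonneg e (by omega)
    have h4 : 0 ≤ ∑ e, (I.liab e : ℝ) := sum_nonneg fun e _ => Nat.cast_nonneg _
    have h5 := H.cap_sink ⟨v, hv⟩
    simp only at h5 hv1 hout hin
    rw [h5]
    push_cast
    rw [sum_add_distrib]
    linarith
  · exact ⟨I.m + b, by omega, H.src_source b, by rw [H.cap_source]; exact hlt⟩

/-- The edges that leave the super source are saturated by a flow without cycles of active edges, as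
`IsFlow.le_of_not_cyclic` requires. -/
theorem source_saturated (H : I.IsInitialNet G) (hx : G.IsFlow x) (hterm : ∀ b, ¬ G.Cyclic x b)
    {f : ℕ} (hf : f < G.edges) (hs : I.n ≤ G.src f) :
    (G.cap f : ℝ) ≤ x f := by
  have hE := H.edges
  rcases (show f < I.m + I.n + I.n ∨ f = I.m + I.n + I.n by omega) with hf | rfl
  · obtain ⟨e, rfl⟩ | ⟨b, rfl⟩ | ⟨b, rfl⟩ := edge_cases hf
    · rw [H.src_claim] at hs; omega
    · rw [H.cap_source, H.source_eq hx hterm]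
    · rw [H.src_sink] at hs; omega
  · rw [H.src_extra] at hs; omega

/-- A flow without cycles of active edges is the maximal clearing state. -/
theorem clearing_eq (H : I.IsInitialNet G) (hx : G.IsFlow x) (hterm : ∀ b, ¬ G.Cyclic x b) :
    I.network.clearing = fun e : Fin I.m => x e := by
  have hE := H.edges
  rw [← I.shifted_creditor_zero]
  refine Network.clearing_eq ⟨(H.core_isClaimNet.isClearing rfl (H.core_isRanked hx _)
    (H.source_eq hx hterm) fun b => ?_).1, fun p hp e => ?_⟩
  · rw [H.core_conserved hx]
    simp [shift]
  · obtain ⟨hr, hb⟩ := H.core_isClaimNet.flowOf_isRanked rfl hp le_rfl (Nat.cast_nonneg _)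
      (Nat.cast_nonneg _)
    have hlast : ∀ f < G.edges, f < I.m + I.n + I.n ∨ f = I.m + I.n + I.n := fun f hf => by omega
    have hflow : G.IsFlow (I.flowOf I.creditor 0 p) := by
      refine ⟨⟨fun f hf => ?_, fun f hf => ?_, fun f hf f' hf' hs hp hpos => ?_⟩, fun b hb' => ?_⟩
      · rcases hlast f hf with hf | rfl
        · exact hr.nonneg f hf
        · rw [flowOf_extra]
      · rcases hlast f hf with hf | rfl
        · exact hr.le_cap f hf
        · rw [flowOf_extra]; exact Nat.cast_nonneg _
      · rcases hlast f hf with hf | rfl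
        · rcases hlast f' hf' with hf' | rfl
          · exact hr.saturated f hf f' hf' hs hp hpos
          · rw [flowOf_extra, H.cap_extra, Nat.cast_zero]
        · rw [flowOf_extra] at hpos
          exact absurd hpos (lt_irrefl _)
      · rw [H.banks] at hb'
        have := (hb ⟨b, hb'⟩).2
        simp only at this
        rw [H.outflow_eq G.dst, H.inflow_eq, flowOf_extra, this]
        simp [shift]
    have := hx.le_of_not_cyclic H.wellFormed hflow hterm
      (fun f hf hs => H.source_saturated hx hterm hf (H.banks ▸ hs)) (f := e) (by omega)
    rwa [flowOf_claim] at this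

theorem assets_eq (H : I.IsInitialNet G) (hx : G.IsFlow x) (hterm : ∀ b, ¬ G.Cyclic x b)
    (b : Fin I.n) : I.network.assets b = (I.core G G.dst).outflow x b := by
  rw [Network.assets, H.clearing_eq hx hterm, ← I.shifted_creditor_zero]
  refine (H.core_isClaimNet.isClearing rfl (H.core_isRanked hx _)
    (H.source_eq hx hterm) fun b => ?_).2 b
  rw [H.core_conserved hx]
  simp [shift]

/-- The incoming payments before the trade are those after it, together with a return of the whole
payment on the claim. -/
theorem sum_newCreditor (y : Fin I.m → ℝ) (b : Fin I.n) :
    ∑ e with I.creditor e = b, y e =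
      ∑ e with I.newCreditor e = b, y e + I.shift (y I.claim) b := by
  have h : ∀ e, (if I.creditor e = b then y e else 0) = (if I.newCreditor e = b then y e else 0) +
      if e = I.claim then I.shift (y e) b else 0 := by
    intro e
    by_cases he : e = I.claim
    · subst he
      simp [newCreditor, shift, eq_comm]
    · simp [newCreditor, he]
  rw [sum_filter, sum_filter, sum_congr rfl fun e _ => h e, sum_add_distrib]
  simp

/-- The flow before the trade is conserved in the network after the trade if the buyer returns the
payment on the claim to the former creditor. -/
theorem conserved_newCreditor (H : I.IsInitialNet G) (T : I.IsTradeNet G z G') (hx : G.IsFlow x)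
    (b : Fin I.n) : (I.core G G'.dst).outflow x b =
      (I.core G G'.dst).inflow x b + I.shift (x I.claim) b := by
  have h := H.core_conserved hx b
  rw [H.core_isClaimNet.inflow_eq rfl, sum_newCreditor (fun e => x e)] at h
  rw [(H.core_newCreditor_isClaimNet T).inflow_eq rfl]
  have h' : (I.core G G'.dst).outflow x b = (I.core G G.dst).outflow x b := rfl
  linarith

/-- The creditor can gain from a trade only if the buyer does not, and only by a return above the
present payment on the claim. Otherwise the additional money circulates among banks that
gain, and this cycle exists before the trade too: if the cycle uses the claim, the buyer gains, and
with the claim directed to the gaining creditor the active edges still do not leave the set of banks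
that gain. -/
theorem buyer_le_and_lt_of_gain (H : I.IsInitialNet G) (T : I.IsTradeNet G z G')
    (hx : G.IsFlow x) (hterm : ∀ b, ¬ G.Cyclic x b) {γ : ℝ} (hy : (I.core G G'.dst).IsRanked y)
    (hcons : ∀ b : Fin I.n, (I.core G G'.dst).outflow y b =
      (I.core G G'.dst).inflow y b + I.shift γ b)
    (hgain : (I.core G G'.dst).outflow x (I.creditor I.claim) <
      (I.core G G'.dst).outflow y (I.creditor I.claim)) :
    (I.core G G'.dst).outflow y I.buyer ≤ (I.core G G'.dst).outflow x I.buyer ∧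
      x I.claim < γ := by
  classical
  by_contra hcon
  have hE := H.edges
  have hclaim := H.core_newCreditor_isClaimNet T
  have hxr := H.core_isRanked hx G'.dst
  set C := I.core G G'.dst with hC
  have hbank : ∀ b, C.outflow x b < C.outflow y b → b < I.n := by
    intro b hb
    by_contra! hc
    obtain ⟨f, hf, hlt⟩ := exists_lt_of_sum_lt hb
    simp only [mem_filter, mem_range] at hf
    obtain ⟨hf, rfl⟩ := hf
    have hf' : f < I.m + I.n + I.n := hf
    have h1 : (G.cap f : ℝ) ≤ x f := H.source_saturated hx hterm (by omega) hc
    have h2 : y f ≤ (G.cap f : ℝ) := hy.le_cap f hf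
    linarith
  let S := (univ : Finset (Fin I.n)).filter fun b : Fin I.n => C.outflow x b < C.outflow y b
  let T' := S.image fun b : Fin I.n => (b : ℕ)
  have hT : ∀ b, b ∈ T' ↔ C.outflow x b < C.outflow y b := fun b => by
    simp only [T', S, mem_image, mem_filter, mem_univ, true_and]
    constructor
    · rintro ⟨b, hb, rfl⟩; exact hb
    · exact fun hb => ⟨⟨b, hbank b hb⟩, hb, rfl⟩
  have hshift : ∑ b ∈ S, (I.shift γ b - I.shift (x I.claim) b) ≤ 0 := by
    have hv : I.creditor I.claim ∈ S := by simpa [S] using hgain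
    simp only [shift]
    by_cases hw : I.buyer ∈ S
    · simp [sum_sub_distrib, sum_ite_eq', hv, hw]
    · have hw' : C.outflow y I.buyer ≤ C.outflow x I.buyer := by simpa [S] using hw
      have hγ : γ ≤ x I.claim := not_lt.1 fun h => hcon ⟨hw', h⟩
      simp [sum_sub_distrib, sum_ite_eq', hv, hw, hγ]
  have hclosed := hxr.isClosed (hclaim.wellFormed rfl) hy T' hT (by
    rw [FlowNet.sum_filter_mem_eq, FlowNet.sum_filter_mem_eq]
    simp only [T']
    rw [sum_image fun a _ b _ h => Fin.ext h, sum_image fun a _ b _ h => Fin.ext h]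
    have hb : ∀ b ∈ S, ∑ f ∈ range C.edges with C.src f = (b : ℕ), (y f - x f) =
        ∑ f ∈ range C.edges with C.dst f = (b : ℕ), (y f - x f) +
          (I.shift γ b - I.shift (x I.claim) b) := by
      intro b _
      have h1 := H.conserved_newCreditor T hx b
      have h2 := hcons b
      rw [← hC] at h1
      simp only [FlowNet.outflow, FlowNet.inflow] at h1 h2
      rw [sum_sub_distrib, sum_sub_distrib, h1, h2]
      ring
    rw [sum_congr rfl hb, sum_add_distrib]
    linarith)
  refine hterm (I.creditor I.claim) ⟨_, fun b hb => ?_, mem_coe.2 ((hT _).2 hgain)⟩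
  obtain ⟨f, hfs, ⟨hf, hlt, hmin⟩, hd⟩ := hclosed b hb
  have hf' : f < I.m + I.n + I.n := hf
  refine ⟨f, hfs, ⟨by omega, hlt, fun f' hf' hs hxf' => ?_⟩, ?_⟩
  · rcases (show f' < I.m + I.n + I.n ∨ f' = I.m + I.n + I.n by omega) with hf' | rfl
    · exact hmin f' hf' hs hxf'
    · rw [H.cap_extra, H.extra_eq_zero hx] at hxf'
      simp at hxf'
  · by_cases hfe : f = I.claim
    · rw [hfe, H.dst_claim]
      exact mem_coe.2 ((hT _).2 hgain)
    · have : C.dst f = G.dst f := by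
        change G'.dst f = _
        rw [T.dst f (by omega), if_neg hfe]
      rwa [this] at hd

end IsInitialNet

namespace IsTradeNet

theorem wellFormed (T : I.IsTradeNet G x G') (H : I.IsInitialNet G) : G'.WellFormed := by
  have hE := H.edges
  have h := H.wellFormed
  refine ⟨fun f hf => ?_, fun f hf => ?_, fun f hf f' hf' hs hp => ?_⟩
  · rw [T.edges] at hf ⊢
    rw [T.src f hf]
    exact h.src_lt f hf
  · rw [T.edges] at hf ⊢
    rw [T.dst f hf]
    split_ifs
    · omega
    · exact h.dst_lt f hf
  · rw [T.edges] at hf hf'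
    rw [T.src f hf, T.src f' hf'] at hs
    rw [T.prio f hf, T.prio f' hf'] at hp
    exact h.prio_inj f hf f' hf' hs hp

theorem outflow_eq (T : I.IsTradeNet G x G') (H : I.IsInitialNet G) (b : ℕ) :
    G'.outflow y b = (I.core G G'.dst).outflow y b +
      if (I.buyer : ℕ) = b then y (I.m + I.n + I.n) else 0 := by
  rw [← H.outflow_eq G'.dst b]
  exact FlowNet.outflow_congr T.edges T.src (fun _ _ => rfl) b

theorem inflow_eq (T : I.IsTradeNet G x G') (H : I.IsInitialNet G) (b : ℕ) :
    G'.inflow y b = (I.core G G'.dst).inflow y b +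
      if (I.creditor I.claim : ℕ) = b then y (I.m + I.n + I.n) else 0 := by
  have hE := H.edges
  have h := G'.inflow_succ y (I.m + I.n + I.n) b
  rw [T.dst (I.m + I.n + I.n) (by omega),
    if_neg (show I.m + I.n + I.n ≠ I.claim by omega), H.dst_extra, ← H.edges, ← T.edges] at h
  exact h

theorem shift_eq_sub (γ : ℝ) (b : Fin I.n) :
    I.shift γ b = (if (I.creditor I.claim : ℕ) = b then γ else 0) -
      if (I.buyer : ℕ) = b then γ else 0 := by
  simp only [shift, Fin.val_inj, eq_comm]

/-- A ranked flow after the trade in which the buyer pays what it pays in `x` is a flow of the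
network after the trade, the return being the flow on the last edge. -/
theorem isFlow (T : I.IsTradeNet G x G') (H : I.IsInitialNet G)
    (hy : (I.core G G'.dst).IsRanked y)
    (hcons : ∀ b : Fin I.n, (I.core G G'.dst).outflow y b =
      (I.core G G'.dst).inflow y b + I.shift (y (I.m + I.n + I.n)) b)
    (h0 : 0 ≤ y (I.m + I.n + I.n)) (hcap : y (I.m + I.n + I.n) ≤ G'.cap (I.m + I.n + I.n))
    (hbuyer : ∀ f < I.m + I.n + I.n, G.src f = I.buyer → y f = x f) : G'.IsFlow y := by
  have hE := H.edges
  have hE' := T.edges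
  have hlast : ∀ f < G'.edges, f < I.m + I.n + I.n ∨ f = I.m + I.n + I.n := fun f hf => by omega
  refine ⟨⟨fun f hf => ?_, fun f hf => ?_, fun f hf f' hf' hs hp hpos => ?_⟩, fun b hb => ?_⟩
  · rcases hlast f hf with hf | rfl
    · exact hy.nonneg f hf
    · exact h0
  · rcases hlast f hf with hf | rfl
    · rw [T.cap f hf]
      split_ifs with h
      · exact (hbuyer f hf h).le
      · exact hy.le_cap f hf
    · exact hcap
  · have hs' := hs
    have hp' := hp
    rw [T.src f (by omega), T.src f' (by omega)] at hs'
    rw [T.prio f (by omega), T.prio f' (by omega)] at hp'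
    rcases hlast f' hf' with hlt' | rfl
    · rw [T.cap f' hlt']
      split_ifs with h
      · exact (hbuyer f' hlt' h).ge
      · rcases hlast f hf with hlt | rfl
        · exact hy.saturated f hlt f' hlt' hs' hp' hpos
        · exact absurd (hs'.symm.trans H.src_extra) h
    · rw [H.prio_extra] at hp'
      rw [H.src_extra] at hs'
      rcases hlast f hf with hlt | rfl
      · obtain ⟨e, rfl⟩ | ⟨b, rfl⟩ | ⟨b, rfl⟩ := edge_cases hlt
        · rw [H.prio_claim] at hp'
          have := rank_lt_m e
          omega
        · rw [H.src_source] at hs'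
          omega
        · rw [H.prio_sink] at hp'
          omega
      · rw [H.prio_extra] at hp'
        omega
  · rw [T.banks, H.banks] at hb
    have h := hcons ⟨b, hb⟩
    rw [shift_eq_sub] at h
    simp only at h
    rw [T.outflow_eq H, T.inflow_eq H, h]
    ring

/-- Raising the flow on cycles may start from the flow before the trade, with a return that equals
the payment on the claim. -/
theorem isFlow_initial (T : I.IsTradeNet G x G') (H : I.IsInitialNet G) (hx : G.IsFlow x)
    (hz : ∀ f < I.m + I.n + I.n, z f = x f) (hze : z (I.m + I.n + I.n) = x I.claim) :
    G'.IsFlow z := by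
  have hE := H.edges
  have hr := H.core_isRanked hx G'.dst
  have hzr : (I.core G G'.dst).IsRanked z := by
    refine ⟨fun f hf => ?_, fun f hf => ?_, fun f hf f' hf' => ?_⟩
    · rw [hz f hf]; exact hr.nonneg f hf
    · rw [hz f hf]; exact hr.le_cap f hf
    · rw [hz f hf, hz f' hf']; exact hr.saturated f hf f' hf'
  refine T.isFlow H hzr (fun b => ?_) ?_ ?_ fun f hf _ => hz f hf
  · rw [hze, FlowNet.outflow_congr (y := x) rfl (fun _ _ => rfl) hz,
      FlowNet.inflow_congr (y := x) rfl (fun _ _ => rfl) hz]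
    exact H.conserved_newCreditor T hx b
  · rw [hze]
    exact hx.nonneg _ (by omega)
  · rw [hze, T.cap_extra]
    exact le_max_right _ _

/-- A flow after the trade above `x` agrees with `x` on the frozen edges of the buyer. -/
theorem buyer_eq (T : I.IsTradeNet G x G') (H : I.IsInitialNet G) (hz : G'.IsFlow z)
    (hle : ∀ f < I.m + I.n + I.n, x f ≤ z f) {f : ℕ} (hf : f < I.m + I.n + I.n)
    (hs : G.src f = I.buyer) : z f = x f := by
  have hE := H.edges
  have h := hz.le_cap f (by rw [T.edges]; omega)
  rw [T.cap f hf, if_pos hs] at h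
  exact h.antisymm (hle f hf)

theorem core_isRanked (T : I.IsTradeNet G x G') (H : I.IsInitialNet G) (hx : G.IsFlow x)
    (hz : G'.IsFlow z) (hle : ∀ f < I.m + I.n + I.n, x f ≤ z f) :
    (I.core G G'.dst).IsRanked z := by
  have hE := H.edges
  have hE' := T.edges
  have hlt : ∀ f < I.m + I.n + I.n, f < G'.edges := fun f hf => by omega
  have hr := H.core_isRanked hx G'.dst
  refine ⟨fun f hf => hz.nonneg f (hlt f hf), fun f hf => ?_, fun f hf f' hf' hs hp hpos => ?_⟩
  · have h := hz.le_cap f (hlt f hf)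
    rw [T.cap f hf] at h
    split_ifs at h
    · exact h.trans (hr.le_cap f hf)
    · exact h
  · have hf1 : f < I.m + I.n + I.n := hf
    have hf1' : f' < I.m + I.n + I.n := hf'
    have hs' : G.src f = G.src f' := hs
    have hp' : G.prio f' < G.prio f := hp
    by_cases hw : G.src f = I.buyer
    · rw [T.buyer_eq H hz hle hf hw] at hpos
      exact (hr.saturated f hf f' hf' hs hp hpos).trans (hle f' hf')
    · have h := hz.saturated f (hlt f hf) f' (hlt f' hf')
        (by rw [T.src f (by omega), T.src f' (by omega)]; exact hs)
        (by rw [T.prio f (by omega), T.prio f' (by omega)]; exact hp) hpos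
      rwa [T.cap f' hf', if_neg (hs' ▸ hw)] at h

theorem core_conserved (T : I.IsTradeNet G x G') (H : I.IsInitialNet G) (hz : G'.IsFlow z)
    (b : Fin I.n) : (I.core G G'.dst).outflow z b =
      (I.core G G'.dst).inflow z b + I.shift (z (I.m + I.n + I.n)) b := by
  have h := hz.conserved b (by rw [T.banks, H.banks]; exact b.2)
  rw [T.outflow_eq H, T.inflow_eq H] at h
  rw [shift_eq_sub]
  linarith

theorem outflow_buyer_eq (T : I.IsTradeNet G x G') (H : I.IsInitialNet G) (hz : G'.IsFlow z)
    (hle : ∀ f < I.m + I.n + I.n, x f ≤ z f) :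
    (I.core G G'.dst).outflow z I.buyer = (I.core G G'.dst).outflow x I.buyer := by
  refine sum_congr rfl fun f hf => ?_
  simp only [mem_filter, mem_range] at hf
  exact T.buyer_eq H hz hle hf.1 hf.2

/-- If the flow `z` after the trade has no cycles of active edges, then its return is above the
payment on the claim as soon as some haircut rate is creditor-positive, and no such rate gives the
former creditor more than `z`. -/
theorem le_of_creditorPositive (T : I.IsTradeNet G x G') (H : I.IsInitialNet G) (hx : G.IsFlow x)
    (hterm : ∀ b, ¬ G.Cyclic x b) (hz : G'.IsFlow z) (hzterm : ∀ b, ¬ G'.Cyclic z b)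
    (hle : ∀ f < I.m + I.n + I.n, x f ≤ z f) {β : ℝ}
    (hβ : I.network.CreditorPositive I.claim I.buyer β) :
    x I.claim < z (I.m + I.n + I.n) ∧
      (I.network.trade I.claim I.buyer β).assets (I.creditor I.claim) ≤
        (I.core G G'.dst).outflow z (I.creditor I.claim) := by
  have hE := H.edges
  have hE' := T.edges
  obtain ⟨⟨hβ0, hβ1⟩, hext, hv, hw⟩ := hβ
  have hext : β * I.liab I.claim ≤ I.ext I.buyer := hext
  have hv : I.network.assets (I.creditor I.claim) <
    (I.network.trade I.claim I.buyer β).assets (I.creditor I.claim) := hv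
  have hl0 : (0 : ℝ) ≤ I.liab I.claim := Nat.cast_nonneg _
  have hγ0 : 0 ≤ β * I.liab I.claim := mul_nonneg hβ0 hl0
  have hγl : β * I.liab I.claim ≤ I.liab I.claim := mul_le_of_le_one_left hl0 hβ1
  rw [← I.shifted_newCreditor] at hv hw ⊢
  set γ : ℝ := β * I.liab I.claim with hγ
  have hclaim := H.core_newCreditor_isClaimNet T
  obtain ⟨hr, hb⟩ := hclaim.flowOf_isRanked rfl (I.shifted I.newCreditor γ).clearing_spec.1
    hγ0 hext hγl
  set y := I.flowOf I.newCreditor γ (I.shifted I.newCreditor γ).clearing with hy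
  have hyE : y (I.m + I.n + I.n) = γ := flowOf_extra
  have hassets : ∀ b, (I.shifted I.newCreditor γ).assets b = (I.core G G'.dst).outflow y b :=
    fun b => (hb b).1.symm
  have hold : ∀ b : Fin I.n, I.network.assets b = (I.core G G'.dst).outflow x b := fun b =>
    H.assets_eq hx hterm b
  rw [hassets, hold] at hv hw
  obtain ⟨hbuyer, hγx⟩ := H.buyer_le_and_lt_of_gain T hx hterm hr (fun b => (hb b).2) hv
  have hxr := H.core_isRanked hx G'.dst
  have hwf := hclaim.wellFormed rfl
  have hyflow : G'.IsFlow y := by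
    refine T.isFlow H hr (fun b => by rw [hyE]; exact (hb b).2) (hyE ▸ hγ0) ?_ fun f hf hs => ?_
    · rw [hyE, T.cap_extra]
      exact le_max_of_le_left (le_min hγl hext)
    · have hs : (I.core G G'.dst).src f = I.buyer := hs
      exact le_antisymm (hxr.le_of_outflow_le hwf hr hf (by rwa [hs]))
        (hr.le_of_outflow_le hwf hxr hf (by rwa [hs]))
  have hyz : ∀ f < G'.edges, y f ≤ z f := fun f hf => by
    refine hz.le_of_not_cyclic (T.wellFormed H) hyflow hzterm (fun f hf hs => ?_) hf
    rw [hE'] at hf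
    rw [T.banks, H.banks, T.src f hf] at hs
    have hne : f ≠ I.m + I.n + I.n := by
      rintro rfl
      rw [H.src_extra] at hs
      omega
    rw [T.cap f (by omega), if_neg (by omega)]
    exact (H.source_saturated hx hterm hf hs).trans (hle f (by omega))
  refine ⟨hγx.trans_le (hyE ▸ hyz _ (by omega)), ?_⟩
  rw [hassets]
  refine sum_le_sum fun f hf => hyz f ?_
  simp only [mem_filter, mem_range] at hf
  have : f < I.m + I.n + I.n := hf.1
  omega

theorem not_creditorPositive (T : I.IsTradeNet G x G') (H : I.IsInitialNet G) (hx : G.IsFlow x)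
    (hterm : ∀ b, ¬ G.Cyclic x b) (hz : G'.IsFlow z) (hzterm : ∀ b, ¬ G'.Cyclic z b)
    (hle : ∀ f < I.m + I.n + I.n, x f ≤ z f) (hnot : z (I.m + I.n + I.n) ≤ x I.claim) :
    ¬ ∃ α, I.network.CreditorPositive I.claim I.buyer α := fun ⟨_, hα⟩ =>
  absurd (T.le_of_creditorPositive H hx hterm hz hzterm hle hα).1 (not_lt.2 hnot)

theorem optimalCreditorPositive (T : I.IsTradeNet G x G') (H : I.IsInitialNet G) (hx : G.IsFlow x)
    (hterm : ∀ b, ¬ G.Cyclic x b) (hz : G'.IsFlow z) (hzterm : ∀ b, ¬ G'.Cyclic z b)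
    (hle : ∀ f < I.m + I.n + I.n, x f ≤ z f) (hlt : x I.claim < z (I.m + I.n + I.n)) :
    I.network.OptimalCreditorPositive I.claim I.buyer
      (z (I.m + I.n + I.n) / I.liab I.claim) := by
  have hE := H.edges
  have hE' := T.edges
  have hl : (0 : ℝ) < I.liab I.claim := Nat.cast_pos.2 (I.liab_pos _)
  set γ := z (I.m + I.n + I.n) with hγ
  have hγl : γ / I.liab I.claim * I.liab I.claim = γ := div_mul_cancel₀ _ hl.ne'
  have hγ0 : 0 ≤ γ := hz.nonneg _ (by omega)
  have hcap : γ ≤ min (I.liab I.claim : ℝ) (I.ext I.buyer) := by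
    have h := hz.le_cap (I.m + I.n + I.n) (by omega)
    rw [T.cap_extra, le_max_iff] at h
    exact h.resolve_right (not_le.2 hlt)
  have hclaim := H.core_newCreditor_isClaimNet T
  have hsource : ∀ b : Fin I.n, z (I.m + b) = I.ext b := by
    intro b
    have h := hz.le_cap (I.m + b) (by omega)
    rw [T.cap _ (by omega), H.src_source, if_neg (by omega), H.cap_source] at h
    refine h.antisymm ?_
    rw [← H.source_eq hx hterm b]
    exact hle _ (by omega)
  obtain ⟨hclear, hassets⟩ := hclaim.isClearing rfl (T.core_isRanked H hx hz hle) hsource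
    (T.core_conserved H hz)
  have hge : ∀ b : Fin I.n, (I.core G G'.dst).outflow z b ≤
      (I.network.trade I.claim I.buyer (γ / I.liab I.claim)).assets b := by
    intro b
    rw [← I.shifted_newCreditor, hγl, ← hassets b]
    exact Network.assetsOf_mono _ ((I.shifted I.newCreditor γ).clearing_spec.2 hclear) b
  have hold : ∀ b : Fin I.n, I.network.assets b = (I.core G G'.dst).outflow x b := fun b =>
    H.assets_eq hx hterm b
  have hgain : (I.core G G'.dst).outflow x (I.creditor I.claim) <
      (I.core G G'.dst).outflow z (I.creditor I.claim) := by
    rw [H.conserved_newCreditor T hx, T.core_conserved H hz]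
    have h1 : (I.core G G'.dst).inflow x (I.creditor I.claim) ≤
        (I.core G G'.dst).inflow z (I.creditor I.claim) := by
      refine sum_le_sum fun f hf => hle f ?_
      simp only [mem_filter, mem_range] at hf
      exact hf.1
    simp only [shift, if_true, I.buyer_ne_creditor.symm, if_false]
    linarith
  refine ⟨⟨⟨div_nonneg hγ0 hl.le, (div_le_one hl).2 (hcap.trans (min_le_left _ _))⟩, ?_, ?_, ?_⟩,
    fun β hβ => ?_⟩
  · change γ / I.liab I.claim * I.liab I.claim ≤ (I.ext I.buyer : ℝ)
    rw [hγl]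
    exact hcap.trans (min_le_right _ _)
  · rw [hold]
    exact hgain.trans_le (hge _)
  · rw [hold, ← T.outflow_buyer_eq H hz hle]
    exact hge _
  · exact (T.le_of_creditorPositive H hx hterm hz hzterm hle hβ).2.trans (hge _)

end IsTradeNet

end TradeInstance

/-! ### Reading the input -/

theorem getD_flatten_of_length_eq {l : List (List ℕ)} {q : ℕ} (hl : ∀ x ∈ l, x.length = q)
    {k : ℕ} (hk : k < q) (i : ℕ) :
    l.flatten.getD (q * i + k) 0 = (l.getD i []).getD k 0 := by
  induction l generalizing i with
  | nil => simp
  | cons x l ih =>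
    have hx := hl x (by simp)
    have ih := ih fun y hy => hl y (by simp [hy])
    cases i with
    | zero =>
      rw [List.flatten_cons, List.getD_append _ _ _ _ (by simpa [hx] using hk)]
      simp
    | succ i =>
      rw [List.flatten_cons, List.getD_append_right _ _ _ _ (by rw [hx, Nat.mul_succ]; omega), hx,
        show q * (i + 1) + k - q = q * i + k by rw [Nat.mul_succ]; omega, ih]
      simp

namespace TradeInstance

variable (I : TradeInstance)

/-- The input of the instance, with as many loop iterations as the flow network has edges. -/
def env : Env where
  inp := fun a => I.encode.getD a 0
  size := 4 + I.n + 4 * I.m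
  len := I.m + I.n + I.n + 1

theorem encode_length : I.encode.length = 4 + I.n + 4 * I.m := by
  simp [encode, List.length_flatten, List.map_ofFn, Function.comp_def]
  ring

theorem inp_n : I.env.inp 0 = I.n := by simp [env, encode]

theorem inp_m : I.env.inp 1 = I.m := by simp [env, encode]

theorem inp_claim : I.env.inp 2 = I.claim := by simp [env, encode]

theorem inp_buyer : I.env.inp 3 = I.buyer := by simp [env, encode]

theorem inp_ext (b : Fin I.n) : I.env.inp (4 + b) = I.ext b := by
  have hb := b.2
  simp only [env, encode, List.append_assoc]
  rw [List.getD_append_right _ _ _ _ (by simp), List.getD_append _ _ _ _ (by simp)]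
  simp [List.getD_eq_getElem?_getD]

theorem inp_edge (e : Fin I.m) {k : ℕ} (hk : k < 4) : I.env.inp (4 + I.n + (4 * e + k)) =
    [(I.debtor e : ℕ), (I.creditor e : ℕ), I.liab e, I.rank e].getD k 0 := by
  simp only [env, encode]
  rw [List.getD_append_right _ _ _ _ (by simp; omega),
    show 4 + I.n + (4 * e + k) - _ = 4 * e + k by simp; omega,
    getD_flatten_of_length_eq (by simp [List.mem_ofFn]) hk]
  simp [List.getD_eq_getElem?_getD]

end TradeInstance

/-- The number of banks. -/
def nExpr : Expr := .inp (.lit 0)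

/-- The number of claims. -/
def mExpr : Expr := .inp (.lit 1)

def claimExpr : Expr := .inp (.lit 2)

def buyerExpr : Expr := .inp (.lit 3)

/-- External assets of the bank in variable `2`. -/
def extExpr : Expr := .inp (.add (.lit 4) (.var 2))

/-- The field `k` of the claim in variable `2`. -/
def fieldExpr (k : ℕ) : Expr :=
  .inp (.add (.add (.lit 4) nExpr)
    (.add (.add (.add (.var 2) (.var 2)) (.add (.var 2) (.var 2))) (.lit k)))

/-- The edge from the buyer to the former creditor. -/
def extraExpr : Expr := .add (.add mExpr nExpr) nExpr

/-- Set up an edge of the flow network. -/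
def edgeCmd (f src dst cap prio : Expr) : Cmd :=
  .seq (.put 0 f src) (.seq (.put 1 f dst) (.seq (.put 2 f cap) (.put 3 f prio)))

/-- Set up the claims, and add twice their liabilities to variable `6`. -/
def claimsCmd : Cmd :=
  .forLen 2 (.ite (.var 2) mExpr
    (.seq (edgeCmd (.var 2) (fieldExpr 0) (fieldExpr 1) (fieldExpr 2) (fieldExpr 3))
      (.assign 6 (.add (.var 6) (.add (fieldExpr 2) (fieldExpr 2))))) .skip)

/-- Set up the sources, and add the external assets to variable `6`. -/
def sourcesCmd : Cmd :=
  .forLen 2 (.ite (.var 2) nExpr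
    (.seq (edgeCmd (.add mExpr (.var 2)) nExpr (.var 2) extExpr (.var 2))
      (.assign 6 (.add (.var 6) extExpr))) .skip)

/-- Set up the sinks, with a capacity above variable `6`. -/
def sinksCmd : Cmd :=
  .forLen 2 (.ite (.var 2) nExpr
    (edgeCmd (.add (.add mExpr nExpr) (.var 2)) (.var 2) nExpr (.add (.var 6) (.lit 1)) mExpr)
    .skip)

/-- Set up the edge from the buyer to the creditor, and a number above all priorities beyond the
last edge. -/
def extraCmd : Cmd :=
  .seq (.assign 2 claimExpr)
    (.seq (edgeCmd extraExpr buyerExpr (fieldExpr 1) (.lit 0) (.add mExpr (.lit 1)))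
      (.put 3 .len (.add extraExpr (.lit 2))))

def initCmd : Cmd := .seq claimsCmd (.seq sourcesCmd (.seq sinksCmd extraCmd))

variable {I : TradeInstance} {a : Store}

theorem eval_nExpr : nExpr.eval I.env a = I.n := by
  have h : 0 < I.env.size := by simp only [TradeInstance.env]; omega
  simp [nExpr, Expr.eval, h, I.inp_n]

theorem eval_mExpr : mExpr.eval I.env a = I.m := by
  have h : 1 < I.env.size := by simp only [TradeInstance.env]; omega
  simp [mExpr, Expr.eval, h, I.inp_m]

theorem eval_claimExpr : claimExpr.eval I.env a = I.claim := by
  have h : 2 < I.env.size := by simp only [TradeInstance.env]; omega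
  simp [claimExpr, Expr.eval, h, I.inp_claim]

theorem eval_buyerExpr : buyerExpr.eval I.env a = I.buyer := by
  have h : 3 < I.env.size := by simp only [TradeInstance.env]; omega
  simp [buyerExpr, Expr.eval, h, I.inp_buyer]

theorem eval_extExpr (b : Fin I.n) (h : a.var 2 = b) : extExpr.eval I.env a = I.ext b := by
  have h' : 4 + (b : ℕ) < I.env.size := by simp only [TradeInstance.env]; omega
  simp [extExpr, Expr.eval, h, h', I.inp_ext]

theorem eval_fieldExpr (e : Fin I.m) (h : a.var 2 = e) {k : ℕ} (hk : k < 4) :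
    (fieldExpr k).eval I.env a =
      [(I.debtor e : ℕ), (I.creditor e : ℕ), I.liab e, I.rank e].getD k 0 := by
  have h' : 4 + I.n + (4 * (e : ℕ) + k) < I.env.size := by simp only [TradeInstance.env]; omega
  have h4 : (e : ℕ) + e + (e + e) = 4 * e := by ring
  simp only [fieldExpr, Expr.eval, eval_nExpr, h, h4, h', if_true, I.inp_edge e hk]

theorem eval_extraExpr : extraExpr.eval I.env a = I.m + I.n + I.n := by
  simp [extraExpr, Expr.eval, eval_nExpr, eval_mExpr]

/-- The store holds the edge `f` with these data. -/
def Store.HasEdge (a : Store) (f src dst cap prio : ℕ) : Prop :=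
  a.arr 0 f = src ∧ a.arr 1 f = dst ∧ a.arr 2 f = cap ∧ a.arr 3 f = prio

/-- The hypotheses say that the data of the edge depend on the variables only, so the order of the
writes does not matter. -/
theorem run_edgeCmd {E : Env} {f src dst cap prio : Expr} {vf vs vd vc vp : ℕ}
    (hf : ∀ b : Store, b.var = a.var → f.eval E b = vf)
    (hs : ∀ b : Store, b.var = a.var → src.eval E b = vs)
    (hd : ∀ b : Store, b.var = a.var → dst.eval E b = vd)
    (hc : ∀ b : Store, b.var = a.var → cap.eval E b = vc)
    (hp : ∀ b : Store, b.var = a.var → prio.eval E b = vp) :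
    ((edgeCmd f src dst cap prio).run E a).var = a.var ∧
      ((edgeCmd f src dst cap prio).run E a).HasEdge vf vs vd vc vp ∧
      ∀ g s d c p, g ≠ vf → a.HasEdge g s d c p →
        ((edgeCmd f src dst cap prio).run E a).HasEdge g s d c p := by
  have hrun : (edgeCmd f src dst cap prio).run E a =
      (((a.put 0 vf vs).put 1 vf vd).put 2 vf vc).put 3 vf vp := by
    simp only [edgeCmd, Cmd.run]
    rw [hf a rfl, hs a rfl, hf (a.put 0 vf vs) rfl, hd (a.put 0 vf vs) rfl,
      hf ((a.put 0 vf vs).put 1 vf vd) rfl, hc ((a.put 0 vf vs).put 1 vf vd) rfl,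
      hf (((a.put 0 vf vs).put 1 vf vd).put 2 vf vc) rfl,
      hp (((a.put 0 vf vs).put 1 vf vd).put 2 vf vc) rfl]
  rw [hrun]
  refine ⟨rfl, by simp [Store.HasEdge, Store.put_arr], ?_⟩
  rintro g s d c p hg ⟨rfl, rfl, rfl, rfl⟩
  simp [Store.HasEdge, Store.put_arr, hg]

theorem sum_fin_lt_succ {n : ℕ} (g : Fin n → ℕ) (j : ℕ) :
    ∑ e ∈ univ.filter (fun e : Fin n => (e : ℕ) < j + 1), g e =
      ∑ e ∈ univ.filter (fun e : Fin n => (e : ℕ) < j), g e +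
        if h : j < n then g ⟨j, h⟩ else 0 := by
  by_cases h : j < n
  · have : (univ.filter fun e : Fin n => (e : ℕ) < j + 1) =
        insert ⟨j, h⟩ (univ.filter fun e : Fin n => (e : ℕ) < j) := by
      ext e
      simp only [mem_filter, mem_univ, true_and, mem_insert, Fin.ext_iff]
      omega
    rw [this, sum_insert (by simp), dif_pos h, add_comm]
  · rw [dif_neg h, add_zero]
    refine sum_congr (filter_congr fun e _ => ?_) fun _ _ => rfl
    omega

theorem run_claimsCmd (h6 : a.var 6 = 0) :
    (∀ e : Fin I.m, (claimsCmd.run I.env a).HasEdge e (I.debtor e) (I.creditor e) (I.liab e)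
      (I.rank e)) ∧ (claimsCmd.run I.env a).var 6 = ∑ e, (I.liab e + I.liab e) := by
  have key := Cmd.run_forLen_induction (E := I.env) (i := 2) (a := a)
    (c := .ite (.var 2) mExpr
      (.seq (edgeCmd (.var 2) (fieldExpr 0) (fieldExpr 1) (fieldExpr 2) (fieldExpr 3))
        (.assign 6 (.add (.var 6) (.add (fieldExpr 2) (fieldExpr 2))))) .skip)
    (fun j st => (∀ e : Fin I.m, (e : ℕ) < j →
      st.HasEdge e (I.debtor e) (I.creditor e) (I.liab e) (I.rank e)) ∧
      st.var 6 = ∑ e ∈ univ.filter (fun e : Fin I.m => (e : ℕ) < j), (I.liab e + I.liab e))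
    ⟨by simp, by simp [h6]⟩ ?_
  · have hlt : ∀ e : Fin I.m, (e : ℕ) < I.env.len := fun e => by
      simp only [TradeInstance.env]; omega
    refine ⟨fun e => key.1 e (hlt e), key.2.trans ?_⟩
    rw [filter_true_of_mem fun e _ => hlt e]
  · rintro j - st ⟨hst, hv6⟩
    rw [sum_fin_lt_succ]
    simp only [Cmd.run, eval_mExpr]
    have hv2 : (st.setVar 2 j).var 2 = j := by simp
    simp only [Expr.eval, hv2]
    by_cases hj : j < I.m
    · rw [if_pos hj, dif_pos hj]
      obtain ⟨hvar, hnew, hold⟩ := run_edgeCmd (E := I.env) (a := st.setVar 2 j) (f := .var 2)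
        (src := fieldExpr 0) (dst := fieldExpr 1) (cap := fieldExpr 2) (prio := fieldExpr 3)
        (vf := j) (vs := I.debtor ⟨j, hj⟩) (vd := I.creditor ⟨j, hj⟩) (vc := I.liab ⟨j, hj⟩)
        (vp := I.rank ⟨j, hj⟩) (fun b hb => by simp [Expr.eval, hb])
        (fun b hb => by rw [eval_fieldExpr ⟨j, hj⟩ (by simp [hb]) (by omega)]; rfl)
        (fun b hb => by rw [eval_fieldExpr ⟨j, hj⟩ (by simp [hb]) (by omega)]; rfl)
        (fun b hb => by rw [eval_fieldExpr ⟨j, hj⟩ (by simp [hb]) (by omega)]; rfl)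
        (fun b hb => by rw [eval_fieldExpr ⟨j, hj⟩ (by simp [hb]) (by omega)]; rfl)
      refine ⟨fun e he => ?_, ?_⟩
      · by_cases hej : (e : ℕ) = j
        · subst hej
          exact hnew
        · exact hold _ _ _ _ _ hej (hst e (by omega))
      · rw [eval_fieldExpr ⟨j, hj⟩ (by rw [hvar]; exact hv2) (by omega)]
        simp [hvar, hv6]
    · rw [if_neg hj, dif_neg hj, Cmd.run_skip]
      refine ⟨fun e he => hst e (by omega), by simp [hv6]⟩

theorem run_sourcesCmd :
    (∀ b : Fin I.n, (sourcesCmd.run I.env a).HasEdge (I.m + b) I.n b (I.ext b) b) ∧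
      (sourcesCmd.run I.env a).var 6 = a.var 6 + ∑ b, I.ext b ∧
      ∀ g s d c p, g < I.m → a.HasEdge g s d c p →
        (sourcesCmd.run I.env a).HasEdge g s d c p := by
  have key := Cmd.run_forLen_induction (E := I.env) (i := 2) (a := a)
    (c := .ite (.var 2) nExpr
      (.seq (edgeCmd (.add mExpr (.var 2)) nExpr (.var 2) extExpr (.var 2))
        (.assign 6 (.add (.var 6) extExpr))) .skip)
    (fun j st => (∀ b : Fin I.n, (b : ℕ) < j → st.HasEdge (I.m + b) I.n b (I.ext b) b) ∧
      st.var 6 = a.var 6 + ∑ b ∈ univ.filter (fun b : Fin I.n => (b : ℕ) < j), I.ext b ∧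
      ∀ g s d c p, g < I.m → a.HasEdge g s d c p → st.HasEdge g s d c p)
    ⟨by simp, by simp, fun _ _ _ _ _ _ h => h⟩ ?_
  · have hlt : ∀ b : Fin I.n, (b : ℕ) < I.env.len := fun b => by
      simp only [TradeInstance.env]; omega
    refine ⟨fun b => key.1 b (hlt b), key.2.1.trans ?_, key.2.2⟩
    rw [filter_true_of_mem fun b _ => hlt b]
  · rintro j - st ⟨hst, hv6, hold'⟩
    rw [sum_fin_lt_succ]
    simp only [Cmd.run, eval_nExpr]
    have hv2 : (st.setVar 2 j).var 2 = j := by simp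
    simp only [Expr.eval, hv2]
    by_cases hj : j < I.n
    · rw [if_pos hj, dif_pos hj]
      obtain ⟨hvar, hnew, hold⟩ := run_edgeCmd (E := I.env) (a := st.setVar 2 j)
        (f := .add mExpr (.var 2))
        (src := nExpr) (dst := .var 2) (cap := extExpr) (prio := .var 2)
        (vf := I.m + j) (vs := I.n) (vd := j) (vc := I.ext ⟨j, hj⟩) (vp := j)
        (fun b hb => by simp [Expr.eval, hb, eval_mExpr]) (fun b _ => eval_nExpr)
        (fun b hb => by simp [Expr.eval, hb])
        (fun b hb => eval_extExpr ⟨j, hj⟩ (by simp [hb])) (fun b hb => by simp [Expr.eval, hb])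
      refine ⟨fun b hb => ?_, ?_, fun g s d c p hg h => ?_⟩
      · by_cases hbj : (b : ℕ) = j
        · subst hbj
          exact hnew
        · exact hold _ _ _ _ _ (by omega) (hst b (by omega))
      · rw [eval_extExpr ⟨j, hj⟩ (by rw [hvar]; exact hv2)]
        simp [hvar, hv6, add_assoc]
      · exact hold _ _ _ _ _ (by omega) (hold' g s d c p hg h)
    · rw [if_neg hj, dif_neg hj, Cmd.run_skip]
      refine ⟨fun b hb => hst b (by omega), by simp [hv6], hold'⟩

theorem run_sinksCmd :
    (∀ b : Fin I.n,
      (sinksCmd.run I.env a).HasEdge (I.m + I.n + b) b I.n (a.var 6 + 1) I.m) ∧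
      ∀ g s d c p, g < I.m + I.n → a.HasEdge g s d c p →
        (sinksCmd.run I.env a).HasEdge g s d c p := by
  have key := Cmd.run_forLen_induction (E := I.env) (i := 2) (a := a)
    (c := .ite (.var 2) nExpr
      (edgeCmd (.add (.add mExpr nExpr) (.var 2)) (.var 2) nExpr (.add (.var 6) (.lit 1)) mExpr)
      .skip)
    (fun j st => (∀ b : Fin I.n, (b : ℕ) < j →
      st.HasEdge (I.m + I.n + b) b I.n (a.var 6 + 1) I.m) ∧ st.var 6 = a.var 6 ∧
      ∀ g s d c p, g < I.m + I.n → a.HasEdge g s d c p → st.HasEdge g s d c p)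
    ⟨by simp, rfl, fun _ _ _ _ _ _ h => h⟩ ?_
  · exact ⟨fun b => key.1 b (by simp only [TradeInstance.env]; omega), key.2.2⟩
  · rintro j - st ⟨hst, hv6, hold'⟩
    simp only [Cmd.run, eval_nExpr]
    have hv2 : (st.setVar 2 j).var 2 = j := by simp
    simp only [Expr.eval, hv2]
    by_cases hj : j < I.n
    · rw [if_pos hj]
      obtain ⟨hvar, hnew, hold⟩ := run_edgeCmd (E := I.env) (a := st.setVar 2 j)
        (f := .add (.add mExpr nExpr) (.var 2))
        (src := .var 2) (dst := nExpr) (cap := .add (.var 6) (.lit 1)) (prio := mExpr)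
        (vf := I.m + I.n + j) (vs := j) (vd := I.n) (vc := a.var 6 + 1) (vp := I.m)
        (fun b hb => by simp [Expr.eval, hb, eval_mExpr, eval_nExpr])
        (fun b hb => by simp [Expr.eval, hb]) (fun b _ => eval_nExpr)
        (fun b hb => by simp [Expr.eval, hb, hv6]) (fun b hb => eval_mExpr)
      refine ⟨fun b hb => ?_, by simp [hvar, hv6], fun g s d c p hg h => ?_⟩
      · by_cases hbj : (b : ℕ) = j
        · subst hbj
          exact hnew
        · exact hold _ _ _ _ _ (by omega) (hst b (by omega))
      · exact hold _ _ _ _ _ (by omega) (hold' g s d c p hg h)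
    · rw [if_neg hj, Cmd.run_skip]
      exact ⟨fun b hb => hst b (by omega), by simp [hv6], hold'⟩

theorem run_extraCmd :
    (extraCmd.run I.env a).HasEdge (I.m + I.n + I.n) I.buyer (I.creditor I.claim) 0 (I.m + 1) ∧
      (extraCmd.run I.env a).arr 3 (I.m + I.n + I.n + 1) = I.m + I.n + I.n + 2 ∧
      ∀ g s d c p, g < I.m + I.n + I.n → a.HasEdge g s d c p →
        (extraCmd.run I.env a).HasEdge g s d c p := by
  obtain ⟨-, hnew, hold⟩ := run_edgeCmd (E := I.env) (a := a.setVar 2 I.claim)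
    (f := extraExpr) (src := buyerExpr) (dst := fieldExpr 1) (cap := .lit 0)
    (prio := .add mExpr (.lit 1))
    (vf := I.m + I.n + I.n) (vs := I.buyer) (vd := I.creditor I.claim) (vc := 0) (vp := I.m + 1)
    (fun b _ => eval_extraExpr) (fun b _ => eval_buyerExpr)
    (fun b hb => by rw [eval_fieldExpr I.claim (by simp [hb]) (by omega)]; rfl)
    (fun b _ => rfl) (fun b _ => by simp [Expr.eval, eval_mExpr])
  have hlen : I.env.len = I.m + I.n + I.n + 1 := rfl
  have hput : ∀ (b : Store) g s d c p v, g < I.m + I.n + I.n + 1 → b.HasEdge g s d c p →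
      (b.put 3 (I.m + I.n + I.n + 1) v).HasEdge g s d c p := by
    rintro b g s d c p v hg ⟨rfl, rfl, rfl, rfl⟩
    simp [Store.HasEdge, Store.put_arr, hg.ne]
  simp only [extraCmd, Cmd.run, eval_claimExpr, Expr.eval, eval_extraExpr, hlen]
  refine ⟨hput _ _ _ _ _ _ _ (by omega) hnew, by simp [Store.put_arr], fun g s d c p hg h => ?_⟩
  exact hput _ _ _ _ _ _ _ (by omega) (hold _ _ _ _ _ (by omega) h)

/-- The network in the arrays of a store. -/
def Store.net (I : TradeInstance) (a : Store) : FlowNet where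
  edges := I.m + I.n + I.n + 1
  banks := I.n
  src := a.arr 0
  dst := a.arr 1
  cap := a.arr 2
  prio := a.arr 3

theorem Store.net_stores (a : Store) : Stores I.env (a.net I) a := ⟨rfl, rfl, rfl, rfl, rfl⟩

theorem run_initCmd (h6 : a.var 6 = 0) :
    I.IsInitialNet ((initCmd.run I.env a).net I) ∧
      ∀ f < I.m + I.n + I.n + 1, (initCmd.run I.env a).arr 3 f <
        (initCmd.run I.env a).arr 3 (I.m + I.n + I.n + 1) := by
  have hinit : initCmd.run I.env a = extraCmd.run I.env (sinksCmd.run I.env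
    (sourcesCmd.run I.env (claimsCmd.run I.env a))) := rfl
  rw [hinit]
  obtain ⟨h1, hv1⟩ := run_claimsCmd (I := I) h6
  set a1 := claimsCmd.run I.env a
  obtain ⟨h2, hv2, hold2⟩ := run_sourcesCmd (I := I) (a := a1)
  set a2 := sourcesCmd.run I.env a1
  obtain ⟨h3, hold3⟩ := run_sinksCmd (I := I) (a := a2)
  set a3 := sinksCmd.run I.env a2
  obtain ⟨h4, hs4, hold4⟩ := run_extraCmd (I := I) (a := a3)
  set a4 := extraCmd.run I.env a3
  have hc : ∀ e : Fin I.m, a4.HasEdge e (I.debtor e) (I.creditor e) (I.liab e) (I.rank e) :=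
    fun e => hold4 _ _ _ _ _ (by omega) (hold3 _ _ _ _ _ (by omega)
      (hold2 _ _ _ _ _ (by omega) (h1 e)))
  have hso : ∀ b : Fin I.n, a4.HasEdge (I.m + b) I.n b (I.ext b) b :=
    fun b => hold4 _ _ _ _ _ (by omega) (hold3 _ _ _ _ _ (by omega) (h2 b))
  have hsi : ∀ b : Fin I.n, a4.HasEdge (I.m + I.n + b) b I.n (a2.var 6 + 1) I.m :=
    fun b => hold4 _ _ _ _ _ (by omega) (h3 b)
  refine ⟨⟨⟨rfl, fun e => (hc e).1, fun e => (hc e).2.1, fun e => (hc e).2.2.1,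
    fun e => (hc e).2.2.2, fun b => (hso b).1, fun b => (hso b).2.1, fun b => (hso b).2.2.1,
    fun b => (hso b).2.2.2, fun b => (hsi b).1, fun b => (hsi b).2.1, fun b => ?_,
    fun b => (hsi b).2.2.2⟩, rfl, h4.1, h4.2.1, h4.2.2.1, h4.2.2.2⟩, fun f hf => ?_⟩
  · refine (hsi b).2.2.1.trans ?_
    rw [hv2, hv1, add_comm (∑ e, _)]
  · rw [hs4]
    rcases (show f < I.m + I.n + I.n ∨ f = I.m + I.n + I.n by omega) with hf | rfl
    · obtain ⟨e, rfl⟩ | ⟨b, rfl⟩ | ⟨b, rfl⟩ := TradeInstance.edge_cases hf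
      · rw [(hc e).2.2.2]
        have := TradeInstance.rank_lt_m e
        omega
      · rw [(hso b).2.2.2]; omega
      · rw [(hsi b).2.2.2]; omega
    · rw [h4.2.2.2]; omega

/-! ### The algorithm -/

/-- Freeze the payments of the buyer: the capacities of its edges become their present flow. -/
def freezeCmd : Cmd :=
  .forLen 2 (.ite (.get 0 (.var 2)) buyerExpr .skip
    (.ite buyerExpr (.get 0 (.var 2)) .skip (.put 2 (.var 2) (.get 4 (.var 2)))))

/-- Turn the network before the trade into the network after it. The payment on the claim is saved
in the array `7`. The largest return is computed in variable `6`. -/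
def tradeCmd : Cmd :=
  .seq (.put 7 (.lit 0) (.get 4 claimExpr)) (.seq freezeCmd (.seq (.put 1 claimExpr buyerExpr)
    (.seq (.put 4 extraExpr (.get 4 claimExpr)) (.seq (.assign 2 buyerExpr)
      (.seq (.ite extExpr (.get 2 claimExpr) (.assign 6 extExpr) (.assign 6 (.get 2 claimExpr)))
        (.seq (.ite (.var 6) (.get 4 claimExpr) (.assign 6 (.get 4 claimExpr)) .skip)
          (.put 2 extraExpr (.var 6))))))))

/-- Output: whether there is a creditor-positive rate in variable `10`, and the optimal rate as the
fraction of the variables `11` and `12`. -/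
def outputCmd : Cmd :=
  .seq (.assign 10 (.lit 0)) (.seq (.ite (.get 7 (.lit 0)) (.get 4 extraExpr)
    (.assign 10 (.lit 1)) .skip) (.seq (.assign 11 (.get 4 extraExpr))
      (.assign 12 (.get 2 claimExpr))))

/-- The maximal flow before the trade, then the maximal flow after it, starting from the former. -/
def mainCmd : Cmd :=
  .seq initCmd (.seq saturateCmd (.seq tradeCmd (.seq saturateCmd outputCmd)))

variable {I : TradeInstance} {a : Store}

theorem run_freezeCmd : ∀ f, (freezeCmd.run I.env a).arr 2 f =
    if f < I.m + I.n + I.n + 1 ∧ a.arr 0 f = I.buyer then a.arr 4 f else a.arr 2 f := by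
  have key := Cmd.run_forLen_induction (E := I.env) (i := 2) (a := a)
    (c := .ite (.get 0 (.var 2)) buyerExpr .skip
      (.ite buyerExpr (.get 0 (.var 2)) .skip (.put 2 (.var 2) (.get 4 (.var 2)))))
    (fun j st => st.arr 0 = a.arr 0 ∧ st.arr 4 = a.arr 4 ∧ ∀ f, st.arr 2 f =
      if f < j ∧ a.arr 0 f = I.buyer then a.arr 4 f else a.arr 2 f) ⟨rfl, rfl, by simp⟩ ?_
  · exact key.2.2
  · rintro j - st ⟨h0, h4, h2⟩
    refine ⟨?_, ?_, fun f => ?_⟩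
    · rw [Cmd.run_arr_of_not_writes _ rfl, Store.setVar_arr, h0]
    · rw [Cmd.run_arr_of_not_writes _ rfl, Store.setVar_arr, h4]
    · simp only [Cmd.run, Expr.eval, eval_buyerExpr, Store.setVar_var, Store.setVar_arr, if_true,
        h0, h4, Cmd.run_skip]
      by_cases hfj : f = j
      · subst hfj
        rcases lt_trichotomy (a.arr 0 f) I.buyer with h | h | h
        · simp [h, h.ne, h2]
        · simp [h, Store.put_arr]
        · simp [h, h.ne', h.not_gt, h2]
      · have hiff : f < j + 1 ↔ f < j := by omega
        simp only [hiff]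
        rw [← h2 f]
        split_ifs <;> simp [Store.put_arr, hfj]

/-- `tradeCmd` sets up the network after the trade, and the flow to start from there: the flow
before the trade, with a return equal to the payment on the claim. -/
theorem run_tradeCmd (H : I.IsInitialNet (a.net I)) :
    I.IsTradeNet (a.net I) a.flow ((tradeCmd.run I.env a).net I) ∧
      (tradeCmd.run I.env a).arr 2 I.claim = I.liab I.claim ∧
      (tradeCmd.run I.env a).arr 7 0 = a.arr 4 I.claim ∧
      (∀ f < I.m + I.n + I.n, (tradeCmd.run I.env a).arr 4 f = a.arr 4 f) ∧
      (tradeCmd.run I.env a).arr 4 (I.m + I.n + I.n) = a.arr 4 I.claim := by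
  have hclaim : (I.claim : ℕ) < I.m := I.claim.2
  have hne : ¬ (I.claim : ℕ) = I.m + I.n + I.n := by omega
  have hdebtor : ¬ (I.debtor I.claim : ℕ) = I.buyer := fun h =>
    I.buyer_ne_debtor (Fin.ext h).symm
  have hsrc : a.arr 0 I.claim = I.debtor I.claim := H.src_claim I.claim
  have hcap : a.arr 2 I.claim = I.liab I.claim := H.cap_claim I.claim
  set a1 := a.put 7 0 (a.arr 4 I.claim) with ha1
  set a2 := freezeCmd.run I.env a1 with ha2
  have h2arr : ∀ k, k ≠ 2 → a2.arr k = a1.arr k := fun k hk =>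
    Cmd.run_arr_of_not_writes _ (by simp [freezeCmd, Cmd.writes, Cmd.skip, hk.symm]) _
  have h22 : ∀ f, a2.arr 2 f =
      if f < I.m + I.n + I.n + 1 ∧ a.arr 0 f = I.buyer then a.arr 4 f else a.arr 2 f := fun f => by
    rw [ha2, run_freezeCmd]
    simp [ha1, Store.put_arr]
  have h2claim : a2.arr 2 I.claim = I.liab I.claim := by
    rw [h22, if_neg (by rw [hsrc]; exact fun h => hdebtor h.2), hcap]
  set a3 := a2.put 1 I.claim I.buyer with ha3
  set a4 := a3.put 4 (I.m + I.n + I.n) (a.arr 4 I.claim) with ha4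
  set v := max (min (I.liab I.claim) (I.ext I.buyer)) (a.arr 4 I.claim) with hv
  obtain ⟨b, hb, hrun⟩ : ∃ b : Store, b.arr = a4.arr ∧
      tradeCmd.run I.env a = b.put 2 (I.m + I.n + I.n) v := by
    have e1 : (Cmd.put 7 (.lit 0) (.get 4 claimExpr)).run I.env a = a1 := by
      simp [Cmd.run, Expr.eval, eval_claimExpr, ha1]
    have e3 : (Cmd.put 1 claimExpr buyerExpr).run I.env a2 = a3 := by
      simp [Cmd.run, eval_claimExpr, eval_buyerExpr, ha3]
    have e4 : (Cmd.put 4 extraExpr (.get 4 claimExpr)).run I.env a3 = a4 := by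
      simp [Cmd.run, Expr.eval, eval_claimExpr, eval_extraExpr, ha4, ha3, ha1, h2arr,
        Store.put_arr]
    have e5 : (Cmd.assign 2 buyerExpr).run I.env a4 = a4.setVar 2 I.buyer := by
      simp [Cmd.run, eval_buyerExpr]
    have h42 : a4.arr 2 I.claim = I.liab I.claim := by
      simp [ha4, ha3, Store.put_arr, h2claim]
    have h44 : a4.arr 4 I.claim = a.arr 4 I.claim := by
      simp [ha4, ha3, ha1, h2arr, Store.put_arr, hne]
    have e6 : (Cmd.ite extExpr (.get 2 claimExpr) (.assign 6 extExpr)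
        (.assign 6 (.get 2 claimExpr))).run I.env (a4.setVar 2 I.buyer) =
        (a4.setVar 2 I.buyer).setVar 6 (min (I.liab I.claim) (I.ext I.buyer)) := by
      simp only [Cmd.run, Expr.eval, eval_claimExpr, Store.setVar_arr, h42,
        eval_extExpr (a := a4.setVar 2 I.buyer) I.buyer (by simp)]
      split_ifs with h
      · rw [min_eq_right h.le]
      · rw [min_eq_left (not_lt.1 h)]
    have e7 : ((Cmd.ite (.var 6) (.get 4 claimExpr) (.assign 6 (.get 4 claimExpr)) .skip).run I.env
        ((a4.setVar 2 I.buyer).setVar 6 (min (I.liab I.claim) (I.ext I.buyer)))).arr = a4.arr ∧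
        ((Cmd.ite (.var 6) (.get 4 claimExpr) (.assign 6 (.get 4 claimExpr)) .skip).run I.env
        ((a4.setVar 2 I.buyer).setVar 6 (min (I.liab I.claim) (I.ext I.buyer)))).var 6 = v := by
      simp only [Cmd.run, Expr.eval, eval_claimExpr, Store.setVar_arr, Store.setVar_var, h44,
        if_true, Cmd.run_skip]
      split_ifs with h
      · exact ⟨rfl, by simp [hv, h.le]⟩
      · exact ⟨rfl, by rw [hv, max_eq_left (not_lt.1 h)]; simp⟩
    refine ⟨_, e7.1, ?_⟩
    change (Cmd.put 2 extraExpr (.var 6)).run _ ((Cmd.ite (.var 6) (.get 4 claimExpr)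
      (.assign 6 (.get 4 claimExpr)) .skip).run _ ((Cmd.ite extExpr (.get 2 claimExpr)
      (.assign 6 extExpr) (.assign 6 (.get 2 claimExpr))).run _ ((Cmd.assign 2 buyerExpr).run _
      ((Cmd.put 4 extraExpr (.get 4 claimExpr)).run _ ((Cmd.put 1 claimExpr buyerExpr).run _
      (freezeCmd.run _ ((Cmd.put 7 (.lit 0) (.get 4 claimExpr)).run _ a))))))) = _
    rw [e1, ← ha2, e3, e4, e5, e6]
    simp only [Cmd.run.eq_2, Expr.eval, eval_extraExpr, e7.2]
  have h7 : (tradeCmd.run I.env a).arr 7 = a1.arr 7 := by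
    rw [hrun, Store.put_arr, if_neg (by decide), hb]
    simp [ha4, ha3, Store.put_arr, h2arr]
  have h4 : (tradeCmd.run I.env a).arr 4 =
      Function.update (a.arr 4) (I.m + I.n + I.n) (a.arr 4 I.claim) := by
    rw [hrun, Store.put_arr, if_neg (by decide), hb]
    simp [ha4, ha3, ha1, Store.put_arr, h2arr]
  have h0 : (tradeCmd.run I.env a).arr 0 = a.arr 0 := by
    rw [hrun, Store.put_arr, if_neg (by decide), hb]
    simp [ha4, ha3, ha1, Store.put_arr, h2arr]
  have h1 : (tradeCmd.run I.env a).arr 1 = Function.update (a.arr 1) I.claim I.buyer := by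
    rw [hrun, Store.put_arr, if_neg (by decide), hb]
    simp [ha4, ha3, ha1, Store.put_arr, h2arr]
  have h3 : (tradeCmd.run I.env a).arr 3 = a.arr 3 := by
    rw [hrun, Store.put_arr, if_neg (by decide), hb]
    simp [ha4, ha3, ha1, Store.put_arr, h2arr]
  have h2 : (tradeCmd.run I.env a).arr 2 = Function.update (a2.arr 2) (I.m + I.n + I.n) v := by
    rw [hrun, Store.put_arr, if_pos rfl, hb]
    simp [ha4, ha3, Store.put_arr]
  refine ⟨⟨rfl, rfl, fun f _ => congrFun h0 f, fun f _ => ?_, fun f hf => ?_, ?_,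
    fun f _ => congrFun h3 f⟩, ?_, ?_, fun f hf => ?_, ?_⟩
  · refine (congrFun h1 f).trans ?_
    rw [Function.update_apply]
    rfl
  · have : ((tradeCmd.run I.env a).net I).cap f = a2.arr 2 f := by
      refine (congrFun h2 f).trans ?_
      rw [Function.update_of_ne hf.ne]
    rw [this, h22]
    have hf' : f < I.m + I.n + I.n + 1 := by omega
    by_cases hs : a.arr 0 f = I.buyer <;> simp [hf', Store.net, Store.flow, hs]
  · have : ((tradeCmd.run I.env a).net I).cap (I.m + I.n + I.n) = v := by
      refine (congrFun h2 _).trans ?_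
      rw [Function.update_self]
    rw [this, hv, Store.flow]
    push_cast
    rfl
  · rw [h2, Function.update_of_ne hne, h2claim]
  · rw [h7, ha1, Store.put_arr, if_pos rfl, Function.update_self]
  · rw [h4, Function.update_of_ne hf.ne]
  · rw [h4, Function.update_self]

theorem run_outputCmd :
    (outputCmd.run I.env a).var 10 =
        (if a.arr 7 0 < a.arr 4 (I.m + I.n + I.n) then 1 else 0) ∧
      (outputCmd.run I.env a).var 11 = a.arr 4 (I.m + I.n + I.n) ∧
      (outputCmd.run I.env a).var 12 = a.arr 2 I.claim := by
  simp only [outputCmd, Cmd.run, Expr.eval, eval_extraExpr, eval_claimExpr, Cmd.run_skip,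
    Store.setVar_arr]
  split_ifs <;> simp

/-- The command decides whether there is a creditor-positive rate and computes an optimal one. -/
theorem run_mainCmd (h6 : a.var 6 = 0) (h4 : ∀ f, a.arr 4 f = 0) :
    ((mainCmd.run I.env a).var 10 = 1 ∧ 0 < (mainCmd.run I.env a).var 12 ∧
        I.network.OptimalCreditorPositive I.claim I.buyer
          (((mainCmd.run I.env a).var 11 : ℝ) / ((mainCmd.run I.env a).var 12 : ℝ))) ∨
      ((mainCmd.run I.env a).var 10 = 0 ∧
        ¬ ∃ α : ℝ, I.network.CreditorPositive I.claim I.buyer α) := by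
  have hmain : mainCmd.run I.env a = outputCmd.run I.env (saturateCmd.run I.env
    (tradeCmd.run I.env (saturateCmd.run I.env (initCmd.run I.env a)))) := rfl
  rw [hmain]
  obtain ⟨H1, hprio1⟩ := run_initCmd (I := I) h6
  have h14 : (initCmd.run I.env a).arr 4 = a.arr 4 := Cmd.run_arr_of_not_writes _ rfl _
  generalize initCmd.run I.env a = a1 at *
  have hx1 : (a1.net I).IsFlow a1.flow := by
    have h0 : a1.flow = fun _ => 0 := by
      funext f
      simp [Store.flow, h14, h4]
    rw [h0]
    refine ⟨⟨fun _ _ => le_rfl, fun _ _ => Nat.cast_nonneg _, fun _ _ _ _ _ _ h => ?_⟩,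
      fun b _ => ?_⟩
    · exact absurd h (lt_irrefl _)
    · simp [FlowNet.outflow, FlowNet.inflow]
  obtain ⟨hx2, -, hterm2⟩ := run_saturateCmd (a1.net_stores (I := I)) H1.wellFormed hprio1 hx1
  have h20 : (saturateCmd.run I.env a1).arr 0 = a1.arr 0 := Cmd.run_arr_of_not_writes _ rfl _
  have h21 : (saturateCmd.run I.env a1).arr 1 = a1.arr 1 := Cmd.run_arr_of_not_writes _ rfl _
  have h22 : (saturateCmd.run I.env a1).arr 2 = a1.arr 2 := Cmd.run_arr_of_not_writes _ rfl _
  have h23 : (saturateCmd.run I.env a1).arr 3 = a1.arr 3 := Cmd.run_arr_of_not_writes _ rfl _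
  generalize saturateCmd.run I.env a1 = a2 at *
  have hnet2 : a2.net I = a1.net I := by
    rw [Store.net, Store.net, h20, h21, h22, h23]
  rw [← hnet2] at H1 hx2 hterm2
  obtain ⟨T, hliab, h7, h34, h34e⟩ := run_tradeCmd H1
  have h33 : (tradeCmd.run I.env a2).arr 3 = a2.arr 3 := Cmd.run_arr_of_not_writes _ rfl _
  generalize tradeCmd.run I.env a2 = a3 at *
  have hx3 : (a3.net I).IsFlow a3.flow :=
    T.isFlow_initial H1 hx2 (fun f hf => congrArg _ (h34 f hf)) (congrArg _ h34e)
  have hprio3 : ∀ f < (a3.net I).edges, (a3.net I).prio f < (a3.net I).prio (a3.net I).edges := by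
    intro f hf
    simp only [Store.net, h33, h23]
    exact hprio1 f hf
  obtain ⟨hx4, hle4, hterm4⟩ :=
    run_saturateCmd (a3.net_stores (I := I)) (T.wellFormed H1) hprio3 hx3
  have h47 : (saturateCmd.run I.env a3).arr 7 = a3.arr 7 := Cmd.run_arr_of_not_writes _ rfl _
  have h42 : (saturateCmd.run I.env a3).arr 2 = a3.arr 2 := Cmd.run_arr_of_not_writes _ rfl _
  generalize saturateCmd.run I.env a3 = a4 at *
  obtain ⟨ho10, ho11, ho12⟩ := run_outputCmd (I := I) (a := a4)
  rw [ho10, ho11, ho12, h47, h7, h42, hliab]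
  have hle : ∀ f < I.m + I.n + I.n, a2.flow f ≤ a4.flow f := by
    intro f hf
    have h : a3.flow f ≤ a4.flow f := hle4 f (Nat.lt_succ_of_lt hf)
    rwa [Store.flow, h34 f hf] at h
  by_cases hlt : a2.arr 4 I.claim < a4.arr 4 (I.m + I.n + I.n)
  · exact Or.inl ⟨if_pos hlt, I.liab_pos _, T.optimalCreditorPositive H1 hx2 hterm2 hx4 hterm4 hle
      (Nat.cast_lt.2 hlt)⟩
  · exact Or.inr ⟨if_neg hlt, T.not_creditorPositive H1 hx2 hterm2 hx4 hterm4 hle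
      (Nat.cast_le.2 (not_lt.1 hlt))⟩

/-- Compute the address of the first array cell and the number of loop iterations. -/
def prologue : Program :=
  .seq (.load 8 5) (.seq (.const 5 1) (.seq (.load 5 5) (.seq (.add 4 5 8) (.seq (.add 4 4 8)
    (.seq (.add 3 5 5) (.seq (.add 3 3 3) (.seq (.add 3 3 8) (.seq (.const 5 4) (.seq (.add 3 3 5)
      (.seq (.const 5 1) (.add 4 4 5)))))))))))

/-- Copy the variables `10`, `11` and `12` to the output registers. -/
def epilogue : Program :=
  .seq (.const 0 0) (.seq (.const 1 0) (.seq (.const 2 0) (.seq (.add 0 36 0) (.seq (.add 1 39 1)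
    (.add 2 42 2)))))

theorem exec_prologue (I : TradeInstance) : ∃ s,
    Exec prologue (startState I.encode) s 12 ∧ Represents I.env ⟨fun _ => 0, fun _ _ => 0⟩ s := by
  have h0 : I.encode.getD 0 0 = I.n := I.inp_n
  have h1 : I.encode.getD 1 0 = I.m := I.inp_m
  refine ⟨_, .seq (.load _ _ _) (.seq (.const _ _ _) (.seq (.load _ _ _) (.seq (.add _ _ _ _)
    (.seq (.add _ _ _ _) (.seq (.add _ _ _ _) (.seq (.add _ _ _ _) (.seq (.add _ _ _ _)
    (.seq (.const _ _ _) (.seq (.add _ _ _ _) (.seq (.const _ _ _) (.add _ _ _ _))))))))))), ?_⟩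
  constructor
  · simp [startState, TradeInstance.env, -List.getD_eq_getElem?_getD, h0, h1]
    omega
  · simp [startState, TradeInstance.env, -List.getD_eq_getElem?_getD, h0, h1]
  · intro i
    have h3 : ¬ 3 * i + 6 = 3 := by omega
    have h4 : ¬ 3 * i + 6 = 4 := by omega
    have h5 : ¬ 3 * i + 6 = 5 := by omega
    have h8 : ¬ 3 * i + 6 = 8 := by omega
    simp [startState, h3, h4, h5, h8]
  · intro k i
    simp only [State.setReg_mem, startState, TradeInstance.env]
    refine List.getD_eq_default _ _ ?_
    rw [I.encode_length]
    omega
  · intro j _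
    rfl

theorem exec_epilogue (s : State) : ∃ s', Exec epilogue s s' 6 ∧ s'.reg 0 = s.reg 36 ∧
    s'.reg 1 = s.reg 39 ∧ s'.reg 2 = s.reg 42 :=
  ⟨_, .seq (.const _ _ _) (.seq (.const _ _ _) (.seq (.const _ _ _) (.seq (.add _ _ _ _)
    (.seq (.add _ _ _ _) (.add _ _ _ _))))), by simp, by simp, by simp⟩

theorem length_le_bitLength (l : List ℕ) : l.length ≤ bitLength l := by
  induction l with
  | nil => simp [bitLength]
  | cons x l ih =>
    simp only [bitLength, List.map_cons, List.sum_cons, List.length_cons] at ih ⊢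
    omega

end ClaimsTrade

theorem proposition3p3 :
    ∃ (c : ClaimsTrade.Program) (P : Polynomial ℕ), ∀ I : ClaimsTrade.TradeInstance,
      ∃ (s : ClaimsTrade.State) (t : ℕ),
        ClaimsTrade.Exec c (ClaimsTrade.startState I.encode) s t ∧
        t ≤ P.eval (ClaimsTrade.bitLength I.encode) ∧
        ((s.reg 0 = 1 ∧ 0 < s.reg 2 ∧
            I.network.OptimalCreditorPositive I.claim I.buyer ((s.reg 1 : ℝ) / (s.reg 2 : ℝ))) ∨
          (s.reg 0 = 0 ∧ ¬ ∃ α : ℝ, I.network.CreditorPositive I.claim I.buyer α)) := by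
  refine ⟨.seq ClaimsTrade.prologue (.seq (ClaimsTrade.mainCmd.code 0) ClaimsTrade.epilogue),
    ClaimsTrade.mainCmd.cost.comp (Polynomial.C 2 * Polynomial.X) + Polynomial.C 18, fun I => ?_⟩
  obtain ⟨s1, h1, hr1⟩ := ClaimsTrade.exec_prologue I
  obtain ⟨s2, t, h2, ht, hr2, -⟩ := ClaimsTrade.mainCmd.exec 0 hr1
  obtain ⟨s3, h3, h30, h31, h32⟩ := ClaimsTrade.exec_epilogue s2
  refine ⟨s3, _, .seq h1 (.seq h2 h3), ?_, ?_⟩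
  · have hlen : I.env.len ≤ 2 * ClaimsTrade.bitLength I.encode := by
      have h := ClaimsTrade.length_le_bitLength I.encode
      rw [I.encode_length] at h
      simp only [ClaimsTrade.TradeInstance.env]
      omega
    have hmono := ClaimsTrade.polynomial_nat_eval_mono ClaimsTrade.mainCmd.cost hlen
    simp only at hmono
    rw [Polynomial.eval_add, Polynomial.eval_comp]
    simp only [Polynomial.eval_mul, Polynomial.eval_C, Polynomial.eval_X]
    omega
  · rw [h30, h31, h32, show 36 = 3 * 10 + 6 from rfl, show 39 = 3 * 11 + 6 from rfl,
      show 42 = 3 * 12 + 6 from rfl, hr2.var, hr2.var, hr2.var]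
    exact ClaimsTrade.run_mainCmd rfl fun _ => rfl
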